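/- Let $K$ be a field of characteristic $0$. A *free-commutative right-sided combinatorial Hopf algebra* (CHA) over $K$ is a vector space $C$ together with a Hopf algebra structure on the symmetric algebra $S(C)$, with its usual product and with counit the augmentation $C\mapsto 0$, such that for every $c\in C$ $$\Delta(c)-c\otimes 1-1\otimes c\in S(C)\otimes C .$$ A morphism from $(C,\Delta)$ to $(C',\Delta')$ is a linear map $\varphi:C\to C'$ whose extension $S(\varphi):S(C)\to S(C')$ is a morphism of Hopf algebras. A *pre-Lie cooperation* on a vector space $C$ is a linear map $\delta:C\to C\otimes C$ such that $(\delta\otimes\mathrm{id})\delta-(\mathrm{id}\otimes\delta)\delta:C\to C\otimes C\otimes C$ is invariant under exchanging the last two tensor factors. Put $G_0=0$ and $G_{n+1}=\{c\in C:\delta(c)\in G_n\otimes C\}$, and $F_0=0$ and $F_{n+1}=\{c\in C:\delta(c)\in F_n\otimes F_n\}$. Call $\delta$ *conilpotent* if $C=\bigcup_n G_n$ (each element is killed by some iterate of $\delta$ in the first factor), and *strongly conilpotent* if $C=\bigcup_n F_n$ (each element is killed by all sufficiently long composites of $\delta$). Since $F_n\subseteq G_n$, strongly conilpotent implies conilpotent.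 A morphism $(C,\delta)\to(C',\delta')$ is a linear map $\varphi$ with $(\varphi\otimes\varphi)\delta=\delta'\varphi$. **Theorem.** (1) For a free-commutative right-sided CHA $(C,\Delta)$ and $c\in C$, write the component of $\Delta(c)$ in $C\otimes C\subseteq S(C)\otimes S(C)$ as $\sum_i p_i\otimes r_i$, and put $\delta(c)=\sum_i r_i\otimes p_i$. Then $\delta$ is a conilpotent pre-Lie cooperation on $C$, and the functor $(C,\Delta)\mapsto(C,\delta)$, $\varphi\mapsto\varphi$, is an equivalence from the category of free-commutative right-sided CHAs to the category of conilpotent pre-Lie coalgebras. (2) Let $T$ be the vector space with basis the isomorphism classes of finite (non-planar, non-empty) rooted trees. There is a free-commutative right-sided CHA structure on $S(T)$ whose coproduct is the Connes–Kreimer coproduct: for each tree $t$, $$\Delta(t)=t\otimes 1+\sum_{c}P_c(t)\otimes R_c(t),$$ where $c$ runs over the sets of edges of $t$ that contain at most one edge of every path from the root to a leaf, $R_c(t)$ is the piece containing the root after the edges of $c$ are removed, and $P_c(t)$ is the product of the other pieces. The corresponding pre-Lie coalgebra $(T,\delta)$ is the cofree pre-Lie coalgebra on one generator: it is strongly conilpotent,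 and if $\pi:T\to K$ is the coefficient of the one-vertex tree, then for every strongly conilpotent pre-Lie coalgebra $(C,\gamma)$ and every linear map $f:C\to K$ there is exactly one morphism of pre-Lie coalgebras $\varphi:C\to T$ with $\pi\circ\varphi=f$. -/

import Mathlib

open scoped TensorProduct
open CategoryTheory

universe u v w

noncomputable section

/-! ## The symmetric algebra: degree-one part and functoriality -/

section SymmetricAlgebraPart

variable (K : Type u) [Field K] {C : Type v} [AddCommGroup C] [Module K C]
  {D : Type w} [AddCommGroup D] [Module K D]

/-- The linear projection `S(C) → C` onto the component of polynomial degree one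
(it sends `1` and every product of at least two elements of `C` to `0`).
It is read off from the algebra morphism `S(C) → K ⊕ C` to the trivial square-zero extension. -/
def symProj : SymmetricAlgebra K C →ₗ[K] C :=
  letI : Module Kᵐᵒᵖ C := Module.compHom _ ((RingHom.id K).fromOpposite mul_comm)
  haveI : IsCentralScalar K C := ⟨fun _ _ => rfl⟩
  (TrivSqZeroExt.sndHom K C).comp
    (SymmetricAlgebra.lift (TrivSqZeroExt.inrHom K C)).toLinearMap

theorem symProj_ι (c : C) : symProj K (SymmetricAlgebra.ι K C c) = c := by
  simp [symProj]

theorem symProj_algebraMap (r : K) :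
    symProj K (algebraMap K (SymmetricAlgebra K C) r) = 0 := by
  simp [symProj, TrivSqZeroExt.algebraMap_eq_inl]

theorem symProj_mul (a b : SymmetricAlgebra K C) :
    symProj K (a * b) = SymmetricAlgebra.algebraMapInv a • symProj K b +
      SymmetricAlgebra.algebraMapInv b • symProj K a := by
  let _ : Module Kᵐᵒᵖ C := Module.compHom _ ((RingHom.id K).fromOpposite mul_comm)
  have _ : IsCentralScalar K C := ⟨fun _ _ => rfl⟩
  have key : (TrivSqZeroExt.fstHom K K C).comp
      (SymmetricAlgebra.lift (TrivSqZeroExt.inrHom K C)) =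
      (SymmetricAlgebra.algebraMapInv : SymmetricAlgebra K C →ₐ[K] K) := by
    apply SymmetricAlgebra.algHom_ext
    ext c
    simp [SymmetricAlgebra.algebraMapInv_ι]
  have hf : ∀ x : SymmetricAlgebra K C,
      (SymmetricAlgebra.lift (TrivSqZeroExt.inrHom K C) x).fst =
        SymmetricAlgebra.algebraMapInv x := fun x => congrArg (fun f => f x) key
  simp only [symProj, LinearMap.comp_apply, AlgHom.toLinearMap_apply, map_mul,
    TrivSqZeroExt.sndHom_apply, TrivSqZeroExt.snd_mul, hf, op_smul_eq_smul]

variable {K}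

/-- The algebra morphism `S(φ) : S(C) → S(D)` extending a linear map `φ : C → D`. -/
def symMap (φ : C →ₗ[K] D) : SymmetricAlgebra K C →ₐ[K] SymmetricAlgebra K D :=
  SymmetricAlgebra.lift (SymmetricAlgebra.ι K D ∘ₗ φ)

theorem symMap_ι (φ : C →ₗ[K] D) (c : C) :
    symMap φ (SymmetricAlgebra.ι K C c) = SymmetricAlgebra.ι K D (φ c) := by
  simp [symMap]

theorem algebraMapInv_symMap (φ : C →ₗ[K] D) (a : SymmetricAlgebra K C) :
    SymmetricAlgebra.algebraMapInv (symMap φ a) =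
      (SymmetricAlgebra.algebraMapInv a : K) := by
  have : (SymmetricAlgebra.algebraMapInv : SymmetricAlgebra K D →ₐ[K] K).comp (symMap φ) =
      SymmetricAlgebra.algebraMapInv := by
    apply SymmetricAlgebra.algHom_ext
    ext c
    simp [symMap_ι, SymmetricAlgebra.algebraMapInv_ι]
  exact congrArg (fun f => f a) this

theorem symProj_symMap (φ : C →ₗ[K] D) :
    symProj K ∘ₗ (symMap φ).toLinearMap = φ ∘ₗ symProj K := by
  ext a
  induction a using SymmetricAlgebra.induction with
  | algebraMap r => simp [symProj_algebraMap]
  | ι c => simp [symMap_ι, symProj_ι]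
  | mul a b ha hb =>
    simp only [LinearMap.comp_apply, AlgHom.toLinearMap_apply] at ha hb ⊢
    simp [symProj_mul, ha, hb, algebraMapInv_symMap]
  | add a b ha hb =>
    rw [map_add, map_add, ha, hb]

end SymmetricAlgebraPart

/-! ## Free-commutative right-sided combinatorial Hopf algebras -/

/-- A right-sided Hopf algebra structure on the commutative algebra `S(C)`, augmented by
`S(C) → K`, `C ↦ 0`, so that `C` is the space of indecomposables. Only the coproduct is
structure; the counit is the augmentation and the antipode is unique when it exists. -/
structure RightSidedHopf (K : Type u) [Field K] (C : Type v) [AddCommGroup C] [Module K C] where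
  /-- The coproduct `Δ : S(C) → S(C) ⊗ S(C)`, a morphism of unital algebras. -/
  comul : SymmetricAlgebra K C →ₐ[K] SymmetricAlgebra K C ⊗[K] SymmetricAlgebra K C
  coassoc : (Algebra.TensorProduct.assoc K K K (SymmetricAlgebra K C) (SymmetricAlgebra K C)
        (SymmetricAlgebra K C)).toAlgHom.comp
      ((Algebra.TensorProduct.map comul (.id K (SymmetricAlgebra K C))).comp comul) =
    (Algebra.TensorProduct.map (.id K (SymmetricAlgebra K C)) comul).comp comul
  rTensor_counit : (Algebra.TensorProduct.map SymmetricAlgebra.algebraMapInv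
      (.id K (SymmetricAlgebra K C))).comp comul =
    (Algebra.TensorProduct.lid K (SymmetricAlgebra K C)).symm
  lTensor_counit : (Algebra.TensorProduct.map (.id K (SymmetricAlgebra K C))
      SymmetricAlgebra.algebraMapInv).comp comul =
    (Algebra.TensorProduct.rid K K (SymmetricAlgebra K C)).symm
  exists_antipode : ∃ S : SymmetricAlgebra K C →ₗ[K] SymmetricAlgebra K C,
    LinearMap.mul' K (SymmetricAlgebra K C) ∘ₗ S.rTensor (SymmetricAlgebra K C) ∘ₗ
        comul.toLinearMap =
      Algebra.linearMap K (SymmetricAlgebra K C) ∘ₗ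
        SymmetricAlgebra.algebraMapInv.toLinearMap ∧
    LinearMap.mul' K (SymmetricAlgebra K C) ∘ₗ S.lTensor (SymmetricAlgebra K C) ∘ₗ
        comul.toLinearMap =
      Algebra.linearMap K (SymmetricAlgebra K C) ∘ₗ
        SymmetricAlgebra.algebraMapInv.toLinearMap
  /-- Right-sidedness: for `c ∈ C` one has `Δ(c) = c ⊗ 1 + 1 ⊗ c + ∑ c₍₁₎ ⊗ c₍₂₎` with all
  `c₍₂₎ ∈ C`, that is, the last sum lies in the image of `S(C) ⊗ C`. -/
  right_sided : ∀ c : C,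
    comul (SymmetricAlgebra.ι K C c) - SymmetricAlgebra.ι K C c ⊗ₜ[K] 1 -
        1 ⊗ₜ[K] SymmetricAlgebra.ι K C c ∈
      LinearMap.range ((SymmetricAlgebra.ι K C).lTensor (SymmetricAlgebra K C))

namespace RightSidedHopf

variable {K : Type u} [Field K] {C : Type v} [AddCommGroup C] [Module K C]

/-- The underlying bialgebra, in Mathlib's sense. -/
abbrev toBialgebra (H : RightSidedHopf K C) : Bialgebra K (SymmetricAlgebra K C) :=
  Bialgebra.ofAlgHom H.comul SymmetricAlgebra.algebraMapInv H.coassoc H.rTensor_counit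
    H.lTensor_counit

/-- The underlying Hopf algebra, in Mathlib's sense. -/
abbrev toHopfAlgebra (H : RightSidedHopf K C) : HopfAlgebra K (SymmetricAlgebra K C) :=
  { H.toBialgebra with
    antipode := H.exists_antipode.choose
    mul_antipode_rTensor_comul := H.exists_antipode.choose_spec.1
    mul_antipode_lTensor_comul := H.exists_antipode.choose_spec.2 }

/-- The cooperation `C → C ⊗ C` of a right-sided Hopf structure: if the component of `Δ(c)` in
`C ⊗ C ⊆ S(C) ⊗ S(C)` is `∑ pᵢ ⊗ rᵢ`, then `δ(c) = ∑ rᵢ ⊗ pᵢ`. The right-hand factor of the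
coproduct (the linear one) is written first, so that `δ` is dual to a product `{x, y}` whose
associator is symmetric in its last two arguments. -/
def delta (H : RightSidedHopf K C) : C →ₗ[K] C ⊗[K] C :=
  (TensorProduct.comm K C C).toLinearMap ∘ₗ TensorProduct.map (symProj K) (symProj K) ∘ₗ
    H.comul.toLinearMap ∘ₗ SymmetricAlgebra.ι K C

end RightSidedHopf

/-- A free-commutative right-sided combinatorial Hopf algebra: a vector space `C` with a
right-sided Hopf algebra structure on `S(C)`. -/
structure RightSidedCHA (K : Type u) [Field K] where
  carrier : Type v
  [addCommGroup : AddCommGroup carrier]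
  [module : Module K carrier]
  str : RightSidedHopf K carrier

attribute [instance] RightSidedCHA.addCommGroup RightSidedCHA.module

namespace RightSidedCHA

variable {K : Type u} [Field K]

/-- A morphism of combinatorial Hopf algebras is a linear map `φ : C → C'` whose extension
`S(φ) : S(C) → S(C')` is a morphism of Hopf algebras. (`S(φ)` is always compatible with
products, units and counits, and a morphism of bialgebras commutes with antipodes, so the
condition is compatibility with the coproducts.) -/
@[ext]
structure Hom (H H' : RightSidedCHA.{u, v} K) where
  toLin : H.carrier →ₗ[K] H'.carrier
  comul_comp : (Algebra.TensorProduct.map (symMap toLin) (symMap toLin)).comp H.str.comul =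
    H'.str.comul.comp (symMap toLin)

theorem symMap_id {C : Type v} [AddCommGroup C] [Module K C] :
    symMap (LinearMap.id : C →ₗ[K] C) = AlgHom.id K _ := by
  apply SymmetricAlgebra.algHom_ext
  ext c
  simp [symMap_ι]

theorem symMap_comp {C C' C'' : Type v} [AddCommGroup C] [Module K C] [AddCommGroup C']
    [Module K C'] [AddCommGroup C''] [Module K C''] (g : C' →ₗ[K] C'') (f : C →ₗ[K] C') :
    symMap (g ∘ₗ f) = (symMap g).comp (symMap f) := by
  apply SymmetricAlgebra.algHom_ext
  ext c
  simp [symMap_ι]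

instance : Category (RightSidedCHA.{u, v} K) where
  Hom := Hom
  id H := ⟨LinearMap.id, by
    rw [symMap_id]
    ext x
    simp⟩
  comp f g := ⟨g.toLin ∘ₗ f.toLin, by
    rw [symMap_comp, Algebra.TensorProduct.map_comp, AlgHom.comp_assoc, f.comul_comp,
      ← AlgHom.comp_assoc, g.comul_comp, AlgHom.comp_assoc]⟩

end RightSidedCHA

/-! ## Pre-Lie coalgebras -/

section PreLie

variable {K : Type u} [Field K] {C : Type v} [AddCommGroup C] [Module K C]

/-- The coassociator `(δ ⊗ id) ∘ δ - (id ⊗ δ) ∘ δ : C → C ⊗ (C ⊗ C)`. -/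
def coassociator (δ : C →ₗ[K] C ⊗[K] C) : C →ₗ[K] C ⊗[K] (C ⊗[K] C) :=
  (TensorProduct.assoc K C C C).toLinearMap ∘ₗ δ.rTensor C ∘ₗ δ - δ.lTensor C ∘ₗ δ

/-- `δ` is a pre-Lie cooperation: the coassociator is invariant under the exchange of its last
two factors. This is the dual of the pre-Lie identity
`{{x, y}, z} - {x, {y, z}} = {{x, z}, y} - {x, {z, y}}`. -/
def IsPreLieCooperation (δ : C →ₗ[K] C ⊗[K] C) : Prop :=
  (TensorProduct.comm K C C).toLinearMap.lTensor C ∘ₗ coassociator δ = coassociator δ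

/-- The filtration `G₀ = 0`, `Gₙ₊₁ = {c | δ(c) ∈ Gₙ ⊗ C}`. Thus `c ∈ Gₙ` if and only if the
`n`-fold iterate of `δ` in the first factor, `c ↦ (δ ⊗ id) ⋯ (δ ⊗ id) δ(c) ∈ C ⊗ C^{⊗ n}`,
vanishes on `c`. -/
def leftFiltration (δ : C →ₗ[K] C ⊗[K] C) : ℕ → Submodule K C
  | 0 => ⊥
  | n + 1 => (LinearMap.range ((leftFiltration δ n).subtype.rTensor C)).comap δ

/-- `δ` is conilpotent: every element is killed by some iterate of `δ` in the first factor. -/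
def IsConilpotent (δ : C →ₗ[K] C ⊗[K] C) : Prop :=
  ∀ c : C, ∃ n : ℕ, c ∈ leftFiltration δ n

/-- The filtration `F₀ = 0`, `Fₙ₊₁ = {c | δ(c) ∈ Fₙ ⊗ Fₙ}`. -/
def fullFiltration (δ : C →ₗ[K] C ⊗[K] C) : ℕ → Submodule K C
  | 0 => ⊥
  | n + 1 => (LinearMap.range
      (TensorProduct.map (fullFiltration δ n).subtype (fullFiltration δ n).subtype)).comap δ

/-- `δ` is strongly conilpotent (conilpotent in the operadic sense): every element is killed by
all sufficiently long composites of `δ`, iterated in arbitrary factors. -/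
def IsStronglyConilpotent (δ : C →ₗ[K] C ⊗[K] C) : Prop :=
  ∀ c : C, ∃ n : ℕ, c ∈ fullFiltration δ n

end PreLie

/-- A (conilpotent) pre-Lie coalgebra. -/
structure PreLieCoalgebra (K : Type u) [Field K] where
  carrier : Type v
  [addCommGroup : AddCommGroup carrier]
  [module : Module K carrier]
  δ : carrier →ₗ[K] carrier ⊗[K] carrier
  preLie : IsPreLieCooperation δ
  conilpotent : IsConilpotent δ

attribute [instance] PreLieCoalgebra.addCommGroup PreLieCoalgebra.module

namespace PreLieCoalgebra

variable {K : Type u} [Field K]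

/-- A morphism of pre-Lie coalgebras: a linear map commuting with the cooperations. -/
@[ext]
structure Hom (A B : PreLieCoalgebra.{u, v} K) where
  toLin : A.carrier →ₗ[K] B.carrier
  map_δ : TensorProduct.map toLin toLin ∘ₗ A.δ = B.δ ∘ₗ toLin

instance : Category (PreLieCoalgebra.{u, v} K) where
  Hom := Hom
  id A := ⟨LinearMap.id, by simp⟩
  comp f g := ⟨g.toLin ∘ₗ f.toLin, by
    rw [TensorProduct.map_comp, LinearMap.comp_assoc, f.map_δ, ← LinearMap.comp_assoc, g.map_δ,
      LinearMap.comp_assoc]⟩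

end PreLieCoalgebra

/-! ## The functor from right-sided Hopf algebras to pre-Lie coalgebras -/

namespace RightSidedCHA

variable {K : Type u} [Field K]

theorem Hom.map_delta {H H' : RightSidedCHA.{u, v} K} (f : Hom H H') :
    TensorProduct.map f.toLin f.toLin ∘ₗ H.str.delta = H'.str.delta ∘ₗ f.toLin := by
  have h1 : ∀ x : SymmetricAlgebra K H.carrier ⊗[K] SymmetricAlgebra K H.carrier,
      TensorProduct.map (symProj K) (symProj K)
        (Algebra.TensorProduct.map (symMap f.toLin) (symMap f.toLin) x) =
      TensorProduct.map f.toLin f.toLin (TensorProduct.map (symProj K) (symProj K) x) := by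
    intro x
    induction x using TensorProduct.induction_on with
    | zero => simp
    | tmul a b =>
      have ha := congrArg (fun g => g a) (symProj_symMap f.toLin)
      have hb := congrArg (fun g => g b) (symProj_symMap f.toLin)
      simp only [LinearMap.comp_apply, AlgHom.toLinearMap_apply] at ha hb
      simp [ha, hb]
    | add a b ha hb => simp only [map_add, ha, hb]
  have h2 : ∀ x : H.carrier ⊗[K] H.carrier,
      TensorProduct.comm K _ _ (TensorProduct.map f.toLin f.toLin x) =
        TensorProduct.map f.toLin f.toLin (TensorProduct.comm K _ _ x) := by
    intro x
    induction x using TensorProduct.induction_on with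
    | zero => simp
    | tmul a b => simp
    | add a b ha hb => simp only [map_add, ha, hb]
  ext c
  have h3 := congrArg (fun g => g (SymmetricAlgebra.ι K _ c)) f.comul_comp
  simp only [AlgHom.comp_apply, symMap_ι] at h3
  simp only [RightSidedHopf.delta, LinearMap.comp_apply, AlgHom.toLinearMap_apply,
    LinearEquiv.coe_coe]
  rw [← h3, h1, h2]

/-- The functor sending a right-sided Hopf algebra `S(C)` to its space of indecomposables `C`
with the cooperation `δ`, and a morphism to its underlying linear map. The argument `h` is the
assertion that `δ` is always a conilpotent pre-Lie cooperation. -/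
def toPreLieCoalgebra
    (h : ∀ H : RightSidedCHA.{u, v} K, IsPreLieCooperation H.str.delta ∧
      IsConilpotent H.str.delta) :
    RightSidedCHA.{u, v} K ⥤ PreLieCoalgebra.{u, v} K where
  obj H :=
    { carrier := H.carrier
      δ := H.str.delta
      preLie := (h H).1
      conilpotent := (h H).2 }
  map f := ⟨f.toLin, Hom.map_delta f⟩

end RightSidedCHA

/-! ## Rooted trees and the Connes-Kreimer coproduct -/

/-- Finite rooted trees with a linear order on the children of every vertex. -/
inductive PlanarTree : Type
  | node (children : List PlanarTree) : PlanarTree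

namespace PlanarTree

/-- Elementary identifications of planar trees: permute the children of the root, or apply an
elementary identification to one child. -/
inductive Rel : PlanarTree → PlanarTree → Prop
  | perm {l l' : List PlanarTree} : l.Perm l' → Rel (node l) (node l')
  | child {t t' : PlanarTree} (a b : List PlanarTree) :
      Rel t t' → Rel (node (a ++ t :: b)) (node (a ++ t' :: b))

mutual

/-- The list of admissible cuts `c` of a planar tree that do not cut under the root (at most one
edge is cut on every path from the root to a leaf), each recorded as the pair
`(P_c, R_c)` of the list of pieces cut off and the piece containing the root. -/
def cuts : PlanarTree → List (List PlanarTree × PlanarTree)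
  | node l => (forestCuts l).map fun c => (c.1, node c.2)

/-- The same for the branches at a vertex: for each branch independently, either the edge leading
to it is cut and the whole branch falls off, or this edge is kept and the branch is cut
admissibly. Each possibility is recorded as the list of pieces cut off and the list of what
remains of the branches that stay. -/
def forestCuts : List PlanarTree → List (List PlanarTree × List PlanarTree)
  | [] => [([], [])]
  | t :: l =>
    (([t], []) :: (cuts t).map fun c => (c.1, [c.2])).flatMap fun x =>
      (forestCuts l).map fun y => (x.1 ++ y.1, x.2 ++ y.2)

end

end PlanarTree

/-- (Non-planar) finite rooted trees, i.e. planar trees up to the order of the children. -/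
def FinRootedTree : Type := Quot PlanarTree.Rel

/-- The rooted tree with a single vertex. -/
def FinRootedTree.single : FinRootedTree := Quot.mk _ (PlanarTree.node [])

section ConnesKreimer

variable (K : Type u) [Field K]

/-- The class of a tree as a generator of the polynomial algebra `S(K[rooted trees])`. -/
def treeGen (t : PlanarTree) : SymmetricAlgebra K (FinRootedTree →₀ K) :=
  SymmetricAlgebra.ι K _ (Finsupp.single (Quot.mk _ t) 1)

/-- The Connes-Kreimer coproduct `∑_c P_c(t) ⊗ R_c(t)` of a tree `t`, the sum being over the
admissible cuts. The cut under the root gives the term `t ⊗ 1`, the empty cut (first component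
the empty product) gives `1 ⊗ t`. -/
def ckCoproduct (t : PlanarTree) :
    SymmetricAlgebra K (FinRootedTree →₀ K) ⊗[K] SymmetricAlgebra K (FinRootedTree →₀ K) :=
  treeGen K t ⊗ₜ[K] 1 +
    (t.cuts.map fun c => (c.1.map (treeGen K)).prod ⊗ₜ[K] treeGen K c.2).sum

/-- `(T, δ)` is a cofree pre-Lie coalgebra on one generator, with projection `π : T → K` to the
space of cogenerators: it is a strongly conilpotent pre-Lie coalgebra, and every linear map
`f : C → K` on a strongly conilpotent pre-Lie coalgebra `(C, γ)` is `π ∘ φ` for exactly one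
morphism `φ : C → T` of pre-Lie coalgebras. -/
def IsCofreeOnOneGenerator {T : Type v} [AddCommGroup T] [Module K T]
    (δ : T →ₗ[K] T ⊗[K] T) (π : T →ₗ[K] K) : Prop :=
  IsPreLieCooperation δ ∧ IsStronglyConilpotent δ ∧
    ∀ (C : Type w) [AddCommGroup C] [Module K C] (γ : C →ₗ[K] C ⊗[K] C),
      IsPreLieCooperation γ → IsStronglyConilpotent γ → ∀ f : C →ₗ[K] K,
        ∃! φ : C →ₗ[K] T, TensorProduct.map φ φ ∘ₗ γ = δ ∘ₗ φ ∧ π ∘ₗ φ = f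

end ConnesKreimer

end

noncomputable section

/-! ## Contractions of tensor products with linear forms -/

section Contraction

variable {K : Type*} [Field K] {M N P Q : Type*} [AddCommGroup M] [Module K M]
  [AddCommGroup N] [Module K N] [AddCommGroup P] [Module K P] [AddCommGroup Q] [Module K Q]

-- For a linear form f on C let R_f = (id ⊗ f)δ, an endomorphism of C, and let D_f be the derivation
-- of S(C) with D_f(c) = f(c) + R_f(c) (`affineDer`). The whole proof runs on these derivations.
--
-- In a right-sided bialgebra D_f is (f∘π ⊗ id)Δ, with π the projection onto C
-- (`leftShift_symProj`). By coassociativity Δ D_f = (D_f ⊗ id)Δ, and a derivation with this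
-- invariance is determined by the form c ↦ ε(D c). The commutator [D_f, D_h] is again invariant,
-- and its linear part is the pre-Lie identity (`isPreLieCooperation_delta`).
--
-- Conilpotence is where the antipode enters. An invariant derivation of this affine form is locally
-- nilpotent (`exists_derivation_pow_eq_zero`): some character φ of S(C) satisfies φ(Dᵐx) = 0 for
-- large m, and the antipode translates φ to the counit. Hence every R_f is locally nilpotent. The
-- R_f form a Lie algebra by the pre-Lie identity, an element c generates a finite-dimensional
-- module under them, and Engel's theorem puts c in some G_k (`isConilpotent_delta`).
--
-- In characteristic 0 an element of S(C) ⊗ M is determined by its images under all D_f ⊗ id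
-- together with its counit (`eq_of_rTensor_affineDer_eq`). Since R_f lowers the filtration G,
-- identities between coproducts follow by induction along G. This extends morphisms of cooperations
-- to bialgebras (`comul_symMap`, fullness), gives coassociativity (`comulOfCoaction_coassoc`), and
-- makes the coaction unipotent, whence an antipode (`exists_conv_eq_unit`).
--
-- For essential surjectivity the coaction ρ : C → S(C) ⊗ C is the solution of (D_f ⊗ id)ρ = ρR_f
-- with counit part the identity. Degree by degree this prescribes all partial derivatives of
-- ρ_{n+1}; the Poincaré lemma solves it, closedness being the pre-Lie identity
-- (`symEuler_coactionCoeff_and_symPartial`). The hard point is that ρ_n(c) = 0 for large n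
-- (`exists_coactionDegree_eq_zero`). Beyond some degree the recursion becomes ∂_f y_{n+1} = -R_f
-- y_n, and a bound on the average filtration weight of the nonzero derivatives of y_n drops by 1/n
-- at each step. The harmonic series diverges, so the bound falls below the least possible weight 1.
--
-- For trees, grafting is an isomorphism B : S(T) ≅ T with ΔB(x) = B(x) ⊗ 1 + (id ⊗ B)Δ(x)
-- (`ckComul_ι_grafting`). This gives the bialgebra axioms by induction on trees, and R_f B = B D_f.
-- Given (C, γ) and f, let ω = (id ⊗ f)ρ for the coaction built from γ; the required morphism is the
-- solution of φ = B S(φ) ω, which exists because ω sends F_{n+1} to polynomials in F_n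
-- (`exists_map_ckBialgebra`).

variable (N) in
/-- Contraction `N ⊗ M → N` of the second factor with a linear form on `M`. -/
def contractSnd (g : M →ₗ[K] K) : N ⊗[K] M →ₗ[K] N :=
  (TensorProduct.rid K N).toLinearMap ∘ₗ g.lTensor N

variable (M) in
/-- Contraction `N ⊗ M → M` of the first factor with a linear form on `N`. -/
def contractFst (f : N →ₗ[K] K) : N ⊗[K] M →ₗ[K] M :=
  (TensorProduct.lid K M).toLinearMap ∘ₗ f.rTensor M

@[simp]
theorem contractSnd_tmul (g : M →ₗ[K] K) (n : N) (m : M) :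
    contractSnd N g (n ⊗ₜ m) = g m • n := by
  simp [contractSnd]

@[simp]
theorem contractFst_tmul (f : N →ₗ[K] K) (n : N) (m : M) :
    contractFst M f (n ⊗ₜ m) = f n • m := by
  simp [contractFst]

theorem contractSnd_rTensor (g : M →ₗ[K] K) (a : N →ₗ[K] P) (x : N ⊗[K] M) :
    contractSnd P g (a.rTensor M x) = a (contractSnd N g x) := by
  induction x using TensorProduct.induction_on with
  | zero => simp
  | tmul n m => simp
  | add x y hx hy => simp only [map_add, hx, hy]

theorem contractSnd_lTensor (g : P →ₗ[K] K) (a : M →ₗ[K] P) (x : N ⊗[K] M) :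
    contractSnd N g (a.lTensor N x) = contractSnd N (g ∘ₗ a) x := by
  induction x using TensorProduct.induction_on with
  | zero => simp
  | tmul n m => simp
  | add x y hx hy => simp only [map_add, hx, hy]

theorem contractSnd_map (g : P →ₗ[K] K) (a : N →ₗ[K] Q) (b : M →ₗ[K] P) (x : N ⊗[K] M) :
    contractSnd Q g (TensorProduct.map a b x) = a (contractSnd N (g ∘ₗ b) x) := by
  induction x using TensorProduct.induction_on with
  | zero => simp
  | tmul n m => simp
  | add x y hx hy => simp only [map_add, hx, hy]

theorem contractFst_map (f : Q →ₗ[K] K) (a : N →ₗ[K] Q) (b : M →ₗ[K] P) (x : N ⊗[K] M) :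
    contractFst P f (TensorProduct.map a b x) = b (contractFst M (f ∘ₗ a) x) := by
  induction x using TensorProduct.induction_on with
  | zero => simp
  | tmul n m => simp
  | add x y hx hy => simp only [map_add, hx, hy]

theorem contractFst_rTensor (f : P →ₗ[K] K) (a : N →ₗ[K] P) (x : N ⊗[K] M) :
    contractFst M f (a.rTensor M x) = contractFst M (f ∘ₗ a) x :=
  contractFst_map f a LinearMap.id x

theorem contractFst_lTensor (f : N →ₗ[K] K) (b : M →ₗ[K] P) (x : N ⊗[K] M) :
    contractFst P f (b.lTensor N x) = b (contractFst M f x) :=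
  contractFst_map f LinearMap.id b x

theorem contractSnd_comm (f : N →ₗ[K] K) (x : N ⊗[K] M) :
    contractSnd M f (TensorProduct.comm K N M x) = contractFst M f x := by
  induction x using TensorProduct.induction_on with
  | zero => simp
  | tmul n m => simp
  | add x y hx hy => simp only [map_add, hx, hy]

theorem contractSnd_add (f g : M →ₗ[K] K) (x : N ⊗[K] M) :
    contractSnd N (f + g) x = contractSnd N f x + contractSnd N g x := by
  simp [contractSnd, LinearMap.lTensor_add]

theorem contractSnd_smul (r : K) (f : M →ₗ[K] K) (x : N ⊗[K] M) :
    contractSnd N (r • f) x = r • contractSnd N f x := by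
  simp [contractSnd, LinearMap.lTensor_smul]

/-- A basis of M identifies N ⊗ M with finitely supported families in N, whose entries are the
contractions with the coordinates. -/
theorem eq_zero_of_contractSnd_coord_eq_zero {I : Type*} (b : Module.Basis I K M) {x : N ⊗[K] M}
    (h : ∀ i, contractSnd N (b.coord i) x = 0) : x = 0 := by
  classical
  apply (TensorProduct.equivFinsuppOfBasisRight b (M := N)).injective
  ext i
  rw [map_zero]
  simp only [Finsupp.coe_zero, Pi.zero_apply]
  rw [← h i]
  clear h
  induction x using TensorProduct.induction_on with
  | zero => simp
  | tmul n m => simp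
  | add x y hx hy => simp only [map_add, Finsupp.add_apply, hx, hy]

theorem eq_zero_of_contractSnd_eq_zero {x : N ⊗[K] M}
    (h : ∀ g : M →ₗ[K] K, contractSnd N g x = 0) : x = 0 :=
  eq_zero_of_contractSnd_coord_eq_zero (Module.Basis.ofVectorSpace K M) fun _ => h _

theorem contractSnd_contractFst (f : N →ₗ[K] K) (g : M →ₗ[K] K) (x : N ⊗[K] M) :
    g (contractFst M f x) = f (contractSnd N g x) := by
  induction x using TensorProduct.induction_on with
  | zero => simp
  | tmul n m => simp [mul_comm]
  | add x y hx hy => simp only [map_add, hx, hy]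

theorem eq_of_contractSnd_eq {x y : N ⊗[K] M}
    (h : ∀ g : M →ₗ[K] K, contractSnd N g x = contractSnd N g y) : x = y :=
  sub_eq_zero.1 (eq_zero_of_contractSnd_eq_zero fun g => by rw [map_sub, h, sub_self])

theorem eq_of_contractFst_eq {x y : N ⊗[K] M}
    (h : ∀ g : N →ₗ[K] K, contractFst M g x = contractFst M g y) : x = y :=
  (TensorProduct.comm K N M).injective
    (eq_of_contractSnd_eq fun g => by rw [contractSnd_comm, contractSnd_comm, h])

/-- Right exactness makes the image of V ⊗ M the kernel of N ⊗ M → (N/V) ⊗ M, and vanishing there is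
tested by contractions. This turns the filtrations into statements about linear forms. -/
theorem mem_range_rTensor_subtype_iff {V : Submodule K N} {x : N ⊗[K] M} :
    x ∈ LinearMap.range (V.subtype.rTensor M) ↔ ∀ g : M →ₗ[K] K, contractSnd N g x ∈ V := by
  have hex : LinearMap.ker (V.mkQ.rTensor M) = LinearMap.range (V.subtype.rTensor M) :=
    (rTensor_exact M (LinearMap.exact_subtype_mkQ V) V.mkQ_surjective).linearMap_ker_eq
  rw [← hex, LinearMap.mem_ker]
  constructor
  · intro h g
    rw [← Submodule.Quotient.mk_eq_zero, ← Submodule.mkQ_apply, ← contractSnd_rTensor, h, map_zero]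
  · intro h
    refine eq_zero_of_contractSnd_eq_zero fun g => ?_
    rw [contractSnd_rTensor, Submodule.mkQ_apply, Submodule.Quotient.mk_eq_zero]
    exact h g

theorem mem_range_lTensor_subtype_iff {V : Submodule K M} {x : N ⊗[K] M} :
    x ∈ LinearMap.range (V.subtype.lTensor N) ↔ ∀ g : N →ₗ[K] K, contractFst M g x ∈ V := by
  have hex : LinearMap.ker (V.mkQ.lTensor N) = LinearMap.range (V.subtype.lTensor N) :=
    (lTensor_exact N (LinearMap.exact_subtype_mkQ V) V.mkQ_surjective).linearMap_ker_eq
  rw [← hex, LinearMap.mem_ker]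
  constructor
  · intro h g
    rw [← Submodule.Quotient.mk_eq_zero, ← Submodule.mkQ_apply, ← contractFst_lTensor, h, map_zero]
  · intro h
    refine eq_of_contractFst_eq fun g => ?_
    rw [contractFst_lTensor, Submodule.mkQ_apply, map_zero, Submodule.Quotient.mk_eq_zero]
    exact h g

/-- A sequence of linear maps that is eventually constant at every point has a linear limit. -/
theorem exists_linearMap_eventually_eq (a : ℕ → M →ₗ[K] N)
    (h : ∀ x, ∃ n, ∀ m, n ≤ m → a m x = a n x) :
    ∃ b : M →ₗ[K] N, ∀ x, ∃ n, ∀ m, n ≤ m → a m x = b x := by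
  choose n hn using h
  refine ⟨{ toFun := fun x => a (n x) x, map_add' := fun x y => ?_, map_smul' := fun r x => ?_ },
    fun x => ⟨n x, hn x⟩⟩
  · have h1 := hn x (n x + n y + n (x + y)) (by omega)
    have h2 := hn y (n x + n y + n (x + y)) (by omega)
    have h3 := hn (x + y) (n x + n y + n (x + y)) (by omega)
    rw [← h1, ← h2, ← h3, map_add]
  · have h1 := hn x (n x + n (r • x)) (by omega)
    have h3 := hn (r • x) (n x + n (r • x)) (by omega)
    simp only [RingHom.id_apply]
    rw [← h1, ← h3, map_smul]

end Contraction

/-! ## Derivations and the degree decomposition of the symmetric algebra -/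

section SymmetricAlgebraCalculus

open SymmetricAlgebra

variable {K : Type*} [Field K] {C : Type*} [AddCommGroup C] [Module K C]

/-- Two linear maps on `S(C)` that satisfy the same Leibniz rule along an algebra morphism agree
if they agree on `C`. -/
theorem symmetricAlgebra_leibniz_ext {B M : Type*} [CommRing B] [Algebra K B] [AddCommGroup M]
    [Module K M] [Module B M] [IsScalarTower K B M]
    (φ : SymmetricAlgebra K C →ₐ[K] B) {d e : SymmetricAlgebra K C →ₗ[K] M}
    (hd : ∀ x y, d (x * y) = φ x • d y + φ y • d x)
    (he : ∀ x y, e (x * y) = φ x • e y + φ y • e x)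
    (h : ∀ c, d (ι K C c) = e (ι K C c)) : d = e := by
  have h1 : ∀ d : SymmetricAlgebra K C →ₗ[K] M,
      (∀ x y, d (x * y) = φ x • d y + φ y • d x) → d 1 = 0 := by
    intro d hd
    have := hd 1 1
    rw [map_one, one_smul, mul_one] at this
    exact left_eq_add.1 this
  ext x
  induction x using SymmetricAlgebra.induction with
  | algebraMap r => rw [Algebra.algebraMap_eq_smul_one, map_smul, map_smul, h1 d hd, h1 e he]
  | ι c => exact h c
  | mul a b ha hb => rw [hd, he, ha, hb]
  | add a b ha hb => rw [map_add, map_add, ha, hb]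

variable {M : Type*} [AddCommGroup M] [Module K M] [Module (SymmetricAlgebra K C) M]
  [IsScalarTower K (SymmetricAlgebra K C) M]

/-- The derivation of `S(C)` extending a linear map `C → M`. -/
def symDer (g : C →ₗ[K] M) : Derivation K (SymmetricAlgebra K C) M :=
  letI : Module (SymmetricAlgebra K C)ᵐᵒᵖ M :=
    Module.compHom _ ((RingHom.id (SymmetricAlgebra K C)).fromOpposite mul_comm)
  haveI : IsCentralScalar (SymmetricAlgebra K C) M := ⟨fun _ _ => rfl⟩
  -- Derivations into M are sections x ↦ x + d(x) of the square-zero extension by M; F is the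
  -- section determined by c ↦ c + g(c).
  let F : SymmetricAlgebra K C →ₐ[K] TrivSqZeroExt (SymmetricAlgebra K C) M :=
    SymmetricAlgebra.lift
      ((TrivSqZeroExt.inlAlgHom K (SymmetricAlgebra K C) M).toLinearMap ∘ₗ ι K C +
        (TrivSqZeroExt.inrHom (SymmetricAlgebra K C) M).restrictScalars K ∘ₗ g)
  have hF : ∀ x, (F x).fst = x := fun x => by
    have : (TrivSqZeroExt.fstHom K (SymmetricAlgebra K C) M).comp F =
        AlgHom.id K (SymmetricAlgebra K C) := by
      apply SymmetricAlgebra.algHom_ext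
      ext c
      simp [F]
    exact congrArg (fun f => f x) this
  Derivation.mk' ((TrivSqZeroExt.sndHom (SymmetricAlgebra K C) M).restrictScalars K ∘ₗ
    F.toLinearMap) fun a b => by
      simp [TrivSqZeroExt.snd_mul, hF]

@[simp]
theorem symDer_ι (g : C →ₗ[K] M) (c : C) : symDer g (ι K C c) = g c := by
  simp [symDer]

end SymmetricAlgebraCalculus

section SymmetricAlgebraDegree

open SymmetricAlgebra

theorem Derivation.rTensor_mul {K A B : Type*} [CommRing K] [CommRing A] [Algebra K A]
    [CommRing B] [Algebra K B] (D : Derivation K A A) (z w : A ⊗[K] B) :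
    (D : A →ₗ[K] A).rTensor B (z * w) =
      z * (D : A →ₗ[K] A).rTensor B w + w * (D : A →ₗ[K] A).rTensor B z := by
  induction z using TensorProduct.induction_on with
  | zero => simp
  | add x y hx hy => rw [add_mul, map_add, hx, hy, map_add]; ring
  | tmul a b =>
    induction w using TensorProduct.induction_on with
    | zero => simp
    | add x y hx hy => rw [mul_add, map_add, hx, hy, map_add]; ring
    | tmul a' b' =>
      simp [TensorProduct.add_tmul, mul_comm b' b]

theorem Derivation.lTensor_mul {K A B : Type*} [CommRing K] [CommRing A] [Algebra K A]
    [CommRing B] [Algebra K B] (D : Derivation K A A) (z w : B ⊗[K] A) :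
    (D : A →ₗ[K] A).lTensor B (z * w) =
      z * (D : A →ₗ[K] A).lTensor B w + w * (D : A →ₗ[K] A).lTensor B z := by
  induction z using TensorProduct.induction_on with
  | zero => simp
  | add x y hx hy => rw [add_mul, map_add, hx, hy, map_add]; ring
  | tmul a b =>
    induction w using TensorProduct.induction_on with
    | zero => simp
    | add x y hx hy => rw [mul_add, map_add, hx, hy, map_add]; ring
    | tmul a' b' =>
      simp [TensorProduct.tmul_add, mul_comm a' a]

variable {K : Type*} [Field K] {C : Type*} [AddCommGroup C] [Module K C]

/-- The partial derivative of `S(C)` in the direction of a linear form on `C`. -/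
def symPartial (g : C →ₗ[K] K) : Derivation K (SymmetricAlgebra K C) (SymmetricAlgebra K C) :=
  symDer (Algebra.linearMap K _ ∘ₗ g)

/-- The derivation of `S(C)` extending an endomorphism of `C`. -/
def symLinDer (A : C →ₗ[K] C) : Derivation K (SymmetricAlgebra K C) (SymmetricAlgebra K C) :=
  symDer (ι K C ∘ₗ A)

@[simp]
theorem symPartial_ι (g : C →ₗ[K] K) (c : C) :
    symPartial g (ι K C c) = algebraMap K _ (g c) := by
  simp [symPartial]

@[simp]
theorem symLinDer_ι (A : C →ₗ[K] C) (c : C) : symLinDer A (ι K C c) = ι K C (A c) := by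
  simp [symLinDer]

/-- Derivations of `S(C)` are determined by their values on `C`. -/
theorem symmetricAlgebra_derivation_ext
    {d e : Derivation K (SymmetricAlgebra K C) (SymmetricAlgebra K C)}
    (h : ∀ c, d (ι K C c) = e (ι K C c)) : d = e := by
  have := symmetricAlgebra_leibniz_ext (AlgHom.id K (SymmetricAlgebra K C))
    (d := d.toLinearMap) (e := e.toLinearMap)
    (by simp) (by simp) h
  ext x
  exact congrArg (fun f => f x) this

open Polynomial in
variable (K C) in
/-- The algebra morphism `S(C) → S(C)[X]`, `c ↦ c X`. -/
def symGrading : SymmetricAlgebra K C →ₐ[K] SymmetricAlgebra K C ⊗[K] K[X] :=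
  SymmetricAlgebra.lift ((TensorProduct.mk K _ _).flip X ∘ₗ ι K C)

open Polynomial in
@[simp]
theorem symGrading_ι (c : C) : symGrading K C (ι K C c) = ι K C c ⊗ₜ X := by
  simp [symGrading]

/-- The projection of `S(C)` onto its component of degree `n`. -/
def symDegree (n : ℕ) : SymmetricAlgebra K C →ₗ[K] SymmetricAlgebra K C :=
  contractSnd _ (Polynomial.lcoeff K n) ∘ₗ (symGrading K C).toLinearMap

/-- Evaluation at X = 1 is a retraction. -/
theorem symGrading_injective : Function.Injective (symGrading K C) := by
  have : ((Algebra.TensorProduct.rid K K (SymmetricAlgebra K C)).toAlgHom.comp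
      (Algebra.TensorProduct.map (.id K _) (Polynomial.aeval (1 : K)))).comp (symGrading K C) =
      AlgHom.id K _ := by
    apply SymmetricAlgebra.algHom_ext
    ext c
    simp
  intro x y h
  have hx := congrArg (fun f => f x) this
  have hy := congrArg (fun f => f y) this
  simp only [AlgHom.comp_apply, h] at hx hy
  exact hx.symm.trans hy

theorem eq_zero_of_symDegree_eq_zero {x : SymmetricAlgebra K C}
    (h : ∀ n, symDegree n x = 0) : x = 0 := by
  apply symGrading_injective
  rw [map_zero]
  refine eq_zero_of_contractSnd_coord_eq_zero (Polynomial.basisMonomials K) fun n => ?_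
  have : (Polynomial.basisMonomials K).coord n = Polynomial.lcoeff K n := by
    ext p
    simp [Polynomial.basisMonomials, Polynomial.coeff_monomial, Finsupp.single_apply,
      Polynomial.toFinsuppIsoLinear]
  rw [this]
  exact h n

theorem symDegree_zero (x : SymmetricAlgebra K C) :
    symDegree 0 x = algebraMap K _ (algebraMapInv x) := by
  have h1 : ((Algebra.TensorProduct.rid K K (SymmetricAlgebra K C)).toAlgHom.comp
      (Algebra.TensorProduct.map (.id K _) (Polynomial.aeval (0 : K)))).comp (symGrading K C) =
      (Algebra.ofId K _).comp algebraMapInv := by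
    apply SymmetricAlgebra.algHom_ext
    ext c
    simp [algebraMapInv_ι]
  have h2 : ∀ z : SymmetricAlgebra K C ⊗[K] Polynomial K,
      contractSnd _ (Polynomial.lcoeff K 0) z =
      ((Algebra.TensorProduct.rid K K (SymmetricAlgebra K C)).toAlgHom.comp
      (Algebra.TensorProduct.map (.id K _) (Polynomial.aeval (0 : K)))) z := by
    intro z
    induction z using TensorProduct.induction_on with
    | zero => simp
    | add x y hx hy => rw [map_add, map_add, hx, hy]
    | tmul a p => simp [Polynomial.coeff_zero_eq_aeval_zero]
  rw [symDegree, LinearMap.comp_apply, h2]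
  exact congrArg (fun f => f x) h1

/-- Applying ∂_g before the grading morphism and then multiplying by X, or applying ∂_g ⊗ id after
it, obey the same Leibniz rule and agree on C. The shift is the coefficient of Xⁿ⁺¹. -/
theorem symDegree_symPartial (g : C →ₗ[K] K) (n : ℕ) (x : SymmetricAlgebra K C) :
    symDegree n (symPartial g x) = symPartial g (symDegree (n + 1) x) := by
  have h1 := symmetricAlgebra_leibniz_ext (symGrading K C)
    (d := LinearMap.mulLeft K (1 ⊗ₜ Polynomial.X) ∘ₗ (symGrading K C).toLinearMap ∘ₗ
      (symPartial g).toLinearMap)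
    (e := (symPartial g).toLinearMap.rTensor _ ∘ₗ (symGrading K C).toLinearMap)
    (by intro x y; simp; ring)
    (by intro x y; simpa using Derivation.rTensor_mul (symPartial g) _ _)
    (by
      intro c
      simp [Algebra.algebraMap_eq_smul_one, TensorProduct.smul_tmul', mul_comm,
        Algebra.TensorProduct.one_def])
  have h2 : ∀ z : SymmetricAlgebra K C ⊗[K] Polynomial K,
      contractSnd _ (Polynomial.lcoeff K (n + 1)) (1 ⊗ₜ Polynomial.X * z) =
        contractSnd _ (Polynomial.lcoeff K n) z := by
    intro z
    induction z using TensorProduct.induction_on with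
    | zero => simp
    | add x y hx hy => rw [mul_add, map_add, map_add, hx, hy]
    | tmul a p => simp [Polynomial.coeff_X_mul]
  have h3 := congrArg (contractSnd _ (Polynomial.lcoeff K (n + 1)))
    (congrArg (fun f => f x) h1)
  simp only [LinearMap.comp_apply, LinearMap.mulLeft_apply, h2, contractSnd_rTensor] at h3
  exact h3

theorem symDegree_symLinDer (A : C →ₗ[K] C) (n : ℕ) (x : SymmetricAlgebra K C) :
    symDegree n (symLinDer A x) = symLinDer A (symDegree n x) := by
  have h1 := symmetricAlgebra_leibniz_ext (symGrading K C)
    (d := (symGrading K C).toLinearMap ∘ₗ (symLinDer A).toLinearMap)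
    (e := (symLinDer A).toLinearMap.rTensor _ ∘ₗ (symGrading K C).toLinearMap)
    (by intro x y; simp)
    (by intro x y; simpa using Derivation.rTensor_mul (symLinDer A) _ _)
    (by intro c; simp)
  have h3 := congrArg (contractSnd _ (Polynomial.lcoeff K n)) (congrArg (fun f => f x) h1)
  simp only [LinearMap.comp_apply, contractSnd_rTensor] at h3
  exact h3

variable (K C) in
/-- The Euler derivation of `S(C)`, which multiplies elements of degree `n` by `n`. -/
def symEuler : Derivation K (SymmetricAlgebra K C) (SymmetricAlgebra K C) :=
  symLinDer LinearMap.id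

@[simp]
theorem symEuler_ι (c : C) : symEuler K C (ι K C c) = ι K C c := by
  simp [symEuler]

/-- Through the grading morphism the Euler derivation becomes X d/dX. -/
theorem symEuler_symDegree (n : ℕ) (x : SymmetricAlgebra K C) :
    symEuler K C (symDegree n x) = (n : K) • symDegree n x := by
  let X' : Derivation K (Polynomial K) (Polynomial K) :=
    (Polynomial.X : Polynomial K) • Polynomial.derivative'
  have h1 := symmetricAlgebra_leibniz_ext (symGrading K C)
    (d := X'.toLinearMap.lTensor _ ∘ₗ (symGrading K C).toLinearMap)
    (e := (symEuler K C).toLinearMap.rTensor _ ∘ₗ (symGrading K C).toLinearMap)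
    (by intro x y; simpa using Derivation.lTensor_mul X' _ _)
    (by intro x y; simpa using Derivation.rTensor_mul (symEuler K C) _ _)
    (by intro c; simp [X'])
  have h3 := congrArg (contractSnd _ (Polynomial.lcoeff K n)) (congrArg (fun f => f x) h1)
  have h4 : Polynomial.lcoeff K n ∘ₗ X'.toLinearMap = (n : K) • Polynomial.lcoeff K n := by
    refine LinearMap.ext fun p => ?_
    cases n with
    | zero => simp [X']
    | succ n => simp [X', Polynomial.coeff_X_mul, Polynomial.coeff_derivative, mul_comm]
  simp only [LinearMap.comp_apply, contractSnd_rTensor, contractSnd_lTensor, h4,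
    contractSnd_smul] at h3
  exact h3.symm

variable (K C) in
/-- The universal derivation `S(C) → S(C) ⊗ C`. -/
def symDiff : Derivation K (SymmetricAlgebra K C) (SymmetricAlgebra K C ⊗[K] C) :=
  symDer (TensorProduct.mk K _ _ 1)

variable (K C) in
/-- The multiplication `S(C) ⊗ C → S(C)`. -/
def symMulι : SymmetricAlgebra K C ⊗[K] C →ₗ[K] SymmetricAlgebra K C :=
  LinearMap.mul' K _ ∘ₗ (ι K C).lTensor _

@[simp]
theorem symMulι_tmul (x : SymmetricAlgebra K C) (c : C) :
    symMulι K C (x ⊗ₜ c) = x * ι K C c := by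
  simp [symMulι]

theorem contractSnd_smul_left (g : C →ₗ[K] K) (x : SymmetricAlgebra K C)
    (z : SymmetricAlgebra K C ⊗[K] C) :
    contractSnd _ g (x • z) = x * contractSnd _ g z := by
  induction z using TensorProduct.induction_on with
  | zero => simp
  | add a b ha hb => rw [smul_add, map_add, map_add, ha, hb, mul_add]
  | tmul a c => simp [TensorProduct.smul_tmul']

theorem symMulι_smul (x : SymmetricAlgebra K C) (z : SymmetricAlgebra K C ⊗[K] C) :
    symMulι K C (x • z) = x * symMulι K C z := by
  induction z using TensorProduct.induction_on with
  | zero => simp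
  | add a b ha hb => rw [smul_add, map_add, map_add, ha, hb, mul_add]
  | tmul a c => simp [TensorProduct.smul_tmul', mul_assoc]

theorem contractSnd_symDiff (g : C →ₗ[K] K) (x : SymmetricAlgebra K C) :
    contractSnd _ g (symDiff K C x) = symPartial g x := by
  have h1 := symmetricAlgebra_leibniz_ext (AlgHom.id K (SymmetricAlgebra K C))
    (d := contractSnd _ g ∘ₗ (symDiff K C).toLinearMap)
    (e := (symPartial g).toLinearMap)
    (by intro x y; simp [contractSnd_smul_left]) (by intro x y; simp)
    (by intro c; simp [symDiff, Algebra.algebraMap_eq_smul_one])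
  exact congrArg (fun f => f x) h1

theorem symMulι_symDiff (x : SymmetricAlgebra K C) :
    symMulι K C (symDiff K C x) = symEuler K C x := by
  have h1 := symmetricAlgebra_leibniz_ext (AlgHom.id K (SymmetricAlgebra K C))
    (d := symMulι K C ∘ₗ (symDiff K C).toLinearMap)
    (e := (symEuler K C).toLinearMap)
    (by intro x y; simp [symMulι_smul]) (by intro x y; simp)
    (by intro c; simp [symDiff])
  exact congrArg (fun f => f x) h1

/-- Euler's formula: the Euler derivation is multiplication applied to the universal derivation,
whose contractions are the partial derivatives. -/
theorem symEuler_eq_zero_of_symPartial_eq_zero {x : SymmetricAlgebra K C}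
    (h : ∀ g, symPartial g x = 0) : symEuler K C x = 0 := by
  rw [← symMulι_symDiff, eq_zero_of_contractSnd_eq_zero (x := symDiff K C x), map_zero]
  intro g
  rw [contractSnd_symDiff, h]

/-- The derivation of `S(C)` with `c ↦ g(c) + A(c)`. -/
def affineDer (g : C →ₗ[K] K) (A : C →ₗ[K] C) :
    Derivation K (SymmetricAlgebra K C) (SymmetricAlgebra K C) :=
  symPartial g + symLinDer A

theorem affineDer_apply (g : C →ₗ[K] K) (A : C →ₗ[K] C) (x : SymmetricAlgebra K C) :
    affineDer g A x = symPartial g x + symLinDer A x := by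
  simp [affineDer]

@[simp]
theorem affineDer_ι (g : C →ₗ[K] K) (A : C →ₗ[K] C) (c : C) :
    affineDer g A (ι K C c) = algebraMap K _ (g c) + ι K C (A c) := by
  simp [affineDer]

/-- An element of the augmentation ideal that is killed by a transitive family of affine
derivations vanishes. -/
theorem eq_zero_of_affineDer_eq_zero [CharZero K] (R : (C →ₗ[K] K) → C →ₗ[K] C)
    {x : SymmetricAlgebra K C} (h : ∀ g, affineDer g (R g) x = 0)
    (h0 : algebraMapInv x = (0 : K)) : x = 0 := by
  refine eq_zero_of_symDegree_eq_zero fun n => ?_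
  induction n with
  | zero => rw [symDegree_zero, h0, map_zero]
  | succ n ih =>
    have h1 : symEuler K C (symDegree (n + 1) x) = 0 := by
      refine symEuler_eq_zero_of_symPartial_eq_zero fun g => ?_
      -- The degree n part of D_g x is ∂_g x_{n+1} + R_g x_n, and x_n = 0 by induction. So all
      -- partial derivatives of x_{n+1} vanish, and (n + 1) x_{n+1} = 0 by Euler's formula.
      have h2 := congrArg (symDegree n) (h g)
      rw [affineDer_apply, map_add, symDegree_symLinDer, ih, map_zero, map_zero, add_zero,
        symDegree_symPartial] at h2
      exact h2
    rw [symEuler_symDegree] at h1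
    exact (smul_eq_zero.1 h1).resolve_left (Nat.cast_ne_zero.2 n.succ_ne_zero)

theorem eq_zero_of_rTensor_affineDer_eq_zero [CharZero K] {M : Type*} [AddCommGroup M] [Module K M]
    (R : (C →ₗ[K] K) → C →ₗ[K] C) {x : SymmetricAlgebra K C ⊗[K] M}
    (h : ∀ g, (affineDer g (R g)).toLinearMap.rTensor M x = 0)
    (h0 : contractFst M (algebraMapInv : SymmetricAlgebra K C →ₐ[K] K).toLinearMap x = 0) :
    x = 0 := by
  refine eq_zero_of_contractSnd_eq_zero fun l => ?_
  refine eq_zero_of_affineDer_eq_zero R (fun g => ?_) ?_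
  · have := congrArg (contractSnd _ l) (h g)
    rw [contractSnd_rTensor, map_zero] at this
    exact this
  · have := congrArg l h0
    rw [contractSnd_contractFst, map_zero] at this
    exact this

theorem eq_of_rTensor_affineDer_eq [CharZero K] {M : Type*} [AddCommGroup M] [Module K M]
    (R : (C →ₗ[K] K) → C →ₗ[K] C) {x y : SymmetricAlgebra K C ⊗[K] M}
    (h : ∀ g, (affineDer g (R g)).toLinearMap.rTensor M x =
      (affineDer g (R g)).toLinearMap.rTensor M y)
    (h0 : contractFst M (algebraMapInv : SymmetricAlgebra K C →ₐ[K] K).toLinearMap x =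
      contractFst M (algebraMapInv : SymmetricAlgebra K C →ₐ[K] K).toLinearMap y) :
    x = y :=
  sub_eq_zero.1 <| eq_zero_of_rTensor_affineDer_eq_zero R (fun g => by rw [map_sub, h, sub_self])
    (by rw [map_sub, h0, sub_self])

end SymmetricAlgebraDegree

/-! ## Right-sided bialgebra structures on the symmetric algebra -/

section PreLieContraction

variable {K : Type*} [Field K] {C : Type*} [AddCommGroup C] [Module K C]

/-- The endomorphism `(id ⊗ f) ∘ δ` of `C` attached to a linear form `f`. -/
def rightContraction (δ : C →ₗ[K] C ⊗[K] C) (f : C →ₗ[K] K) : C →ₗ[K] C :=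
  contractSnd C f ∘ₗ δ

theorem rightContraction_apply (δ : C →ₗ[K] C ⊗[K] C) (f : C →ₗ[K] K) (c : C) :
    rightContraction δ f c = contractSnd C f (δ c) := rfl

theorem rightContraction_add (δ : C →ₗ[K] C ⊗[K] C) (f g : C →ₗ[K] K) :
    rightContraction δ (f + g) = rightContraction δ f + rightContraction δ g := by
  ext c
  simp [rightContraction, contractSnd_add]

theorem rightContraction_smul (δ : C →ₗ[K] C ⊗[K] C) (r : K) (f : C →ₗ[K] K) :
    rightContraction δ (r • f) = r • rightContraction δ f := by
  ext c
  simp [rightContraction, contractSnd_smul]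

theorem rightContraction_sub (δ : C →ₗ[K] C ⊗[K] C) (f g : C →ₗ[K] K) :
    rightContraction δ (f - g) = rightContraction δ f - rightContraction δ g := by
  rw [sub_eq_add_neg, ← neg_one_smul K g, rightContraction_add, rightContraction_smul,
    neg_one_smul, ← sub_eq_add_neg]

theorem contractSnd_contractSnd_coassociator (δ : C →ₗ[K] C ⊗[K] C) (f h : C →ₗ[K] K) (c : C) :
    contractSnd C (LinearMap.mul' K K ∘ₗ TensorProduct.map h f) (coassociator δ c) =
      rightContraction δ h (rightContraction δ f c) -
        rightContraction δ (h ∘ₗ rightContraction δ f) c := by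
  have h1 : ∀ z : C ⊗[K] C, contractSnd C (LinearMap.mul' K K ∘ₗ TensorProduct.map h f)
      (TensorProduct.assoc K C C C (δ.rTensor C z)) =
      rightContraction δ h (contractSnd C f z) := by
    intro z
    induction z using TensorProduct.induction_on with
    | zero => simp
    | add x y hx hy => simp only [map_add, hx, hy]
    | tmul r p =>
      rw [LinearMap.rTensor_tmul, contractSnd_tmul, map_smul, rightContraction_apply]
      induction δ r using TensorProduct.induction_on with
      | zero => simp
      | add x y hx hy => rw [TensorProduct.add_tmul, map_add, map_add, hx, hy, map_add, smul_add]
      | tmul a b => simp [smul_smul, mul_comm]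
  have h2 : ∀ z : C ⊗[K] C, contractSnd C (LinearMap.mul' K K ∘ₗ TensorProduct.map h f)
      (δ.lTensor C z) = contractSnd C (h ∘ₗ rightContraction δ f) z := by
    intro z
    rw [contractSnd_lTensor]
    congr 2
    ext c
    simp only [LinearMap.comp_apply, rightContraction_apply]
    induction δ c using TensorProduct.induction_on with
    | zero => simp
    | add x y hx hy => simp only [map_add, hx, hy]
    | tmul a b => simp [mul_comm]
  rw [coassociator, LinearMap.sub_apply, map_sub]
  simp only [LinearMap.comp_apply, LinearEquiv.coe_coe]
  rw [h1, h2, rightContraction_apply δ (h ∘ₗ _), rightContraction_apply δ f]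

theorem eq_zero_of_contractSnd_map_eq_zero {M N P : Type*} [AddCommGroup M] [Module K M]
    [AddCommGroup N] [Module K N] [AddCommGroup P] [Module K P] {x : P ⊗[K] (M ⊗[K] N)}
    (h : ∀ (f : M →ₗ[K] K) (g : N →ₗ[K] K),
      contractSnd P (LinearMap.mul' K K ∘ₗ TensorProduct.map f g) x = 0) : x = 0 := by
  apply (TensorProduct.assoc K P M N).symm.injective
  rw [map_zero]
  refine eq_zero_of_contractSnd_eq_zero fun g => eq_zero_of_contractSnd_eq_zero fun f => ?_
  rw [← h f g]
  clear h
  induction x using TensorProduct.induction_on with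
  | zero => simp
  | add x y hx hy => simp only [map_add, hx, hy]
  | tmul a z =>
    induction z using TensorProduct.induction_on with
    | zero => simp
    | add x y hx hy => simp only [TensorProduct.tmul_add, map_add, hx, hy]
    | tmul b c => simp [smul_smul, mul_comm]

/-- Contractions by h ⊗ f in the last two factors separate the points of C ⊗ (C ⊗ C), and exchanging
these factors exchanges f and h. -/
theorem isPreLieCooperation_iff (δ : C →ₗ[K] C ⊗[K] C) :
    IsPreLieCooperation δ ↔ ∀ f h : C →ₗ[K] K, ∀ c,
      rightContraction δ h (rightContraction δ f c) -
          rightContraction δ (h ∘ₗ rightContraction δ f) c =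
        rightContraction δ f (rightContraction δ h c) -
          rightContraction δ (f ∘ₗ rightContraction δ h) c := by
  have h1 : ∀ (f h : C →ₗ[K] K) (x : C ⊗[K] (C ⊗[K] C)),
      contractSnd C (LinearMap.mul' K K ∘ₗ TensorProduct.map h f)
        ((TensorProduct.comm K C C).toLinearMap.lTensor C x) =
      contractSnd C (LinearMap.mul' K K ∘ₗ TensorProduct.map f h) x := by
    intro f h x
    rw [contractSnd_lTensor]
    congr 2
    ext a b
    simp [mul_comm]
  constructor
  · intro hδ f h c
    rw [← contractSnd_contractSnd_coassociator, ← contractSnd_contractSnd_coassociator, ← h1]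
    exact congrArg _ (congrArg (fun g => g c) hδ)
  · intro hδ
    refine LinearMap.ext fun c => ?_
    rw [← sub_eq_zero]
    refine eq_zero_of_contractSnd_map_eq_zero fun h f => ?_
    rw [map_sub, LinearMap.comp_apply, h1, contractSnd_contractSnd_coassociator,
      contractSnd_contractSnd_coassociator, hδ f h, sub_self]

theorem mem_leftFiltration_succ {δ : C →ₗ[K] C ⊗[K] C} {n : ℕ} {c : C} :
    c ∈ leftFiltration δ (n + 1) ↔ ∀ f, rightContraction δ f c ∈ leftFiltration δ n := by
  rw [leftFiltration, Submodule.mem_comap, mem_range_rTensor_subtype_iff]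
  rfl

theorem leftFiltration_le_succ (δ : C →ₗ[K] C ⊗[K] C) (n : ℕ) :
    leftFiltration δ n ≤ leftFiltration δ (n + 1) := by
  induction n with
  | zero => exact bot_le
  | succ n ih =>
    intro c hc
    rw [mem_leftFiltration_succ] at hc ⊢
    exact fun f => ih (hc f)

theorem leftFiltration_mono (δ : C →ₗ[K] C ⊗[K] C) : Monotone (leftFiltration δ) :=
  monotone_nat_of_le_succ (leftFiltration_le_succ δ)

end PreLieContraction

/-- A right-sided bialgebra structure on `S(C)`: a right-sided Hopf structure, except that no
antipode is required. -/
structure RightSidedBialgebra (K : Type u) [Field K] (C : Type v) [AddCommGroup C]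
    [Module K C] where
  /-- The coproduct. -/
  comul : SymmetricAlgebra K C →ₐ[K] SymmetricAlgebra K C ⊗[K] SymmetricAlgebra K C
  coassoc : (Algebra.TensorProduct.assoc K K K (SymmetricAlgebra K C) (SymmetricAlgebra K C)
        (SymmetricAlgebra K C)).toAlgHom.comp
      ((Algebra.TensorProduct.map comul (.id K (SymmetricAlgebra K C))).comp comul) =
    (Algebra.TensorProduct.map (.id K (SymmetricAlgebra K C)) comul).comp comul
  rTensor_counit : (Algebra.TensorProduct.map SymmetricAlgebra.algebraMapInv
      (.id K (SymmetricAlgebra K C))).comp comul =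
    (Algebra.TensorProduct.lid K (SymmetricAlgebra K C)).symm
  lTensor_counit : (Algebra.TensorProduct.map (.id K (SymmetricAlgebra K C))
      SymmetricAlgebra.algebraMapInv).comp comul =
    (Algebra.TensorProduct.rid K K (SymmetricAlgebra K C)).symm
  right_sided : ∀ c : C,
    comul (SymmetricAlgebra.ι K C c) - SymmetricAlgebra.ι K C c ⊗ₜ[K] 1 -
        1 ⊗ₜ[K] SymmetricAlgebra.ι K C c ∈
      LinearMap.range ((SymmetricAlgebra.ι K C).lTensor (SymmetricAlgebra K C))

/-- Forget the antipode. -/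
def RightSidedHopf.toRightSidedBialgebra {K : Type u} [Field K] {C : Type v} [AddCommGroup C]
    [Module K C] (H : RightSidedHopf K C) : RightSidedBialgebra K C where
  comul := H.comul
  coassoc := H.coassoc
  rTensor_counit := H.rTensor_counit
  lTensor_counit := H.lTensor_counit
  right_sided := H.right_sided

namespace RightSidedBialgebra

open SymmetricAlgebra

variable {K : Type u} [Field K] {C : Type v} [AddCommGroup C] [Module K C]
  (B : RightSidedBialgebra K C)

/-- The coaction of `S(C)` on `C`, the linear part of the coproduct in the second factor. -/
def coaction : C →ₗ[K] SymmetricAlgebra K C ⊗[K] C :=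
  (symProj K).lTensor _ ∘ₗ B.comul.toLinearMap ∘ₗ ι K C

/-- The cooperation on `C` induced by the coproduct. -/
def delta : C →ₗ[K] C ⊗[K] C :=
  (TensorProduct.comm K C C).toLinearMap ∘ₗ TensorProduct.map (symProj K) (symProj K) ∘ₗ
    B.comul.toLinearMap ∘ₗ ι K C

theorem coaction_apply (c : C) :
    B.coaction c = (symProj K).lTensor _ (B.comul (ι K C c)) := rfl

theorem symProj_one : symProj K (1 : SymmetricAlgebra K C) = 0 := by
  simpa using symProj_algebraMap K (C := C) 1

/-- Both 1 ⊗ c and the right-sided remainder lie in the image of S(C) ⊗ C, where projecting the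
second factor onto C loses nothing. So the coaction determines the coproduct. -/
theorem comul_ι (c : C) :
    B.comul (ι K C c) = ι K C c ⊗ₜ 1 + (ι K C).lTensor _ (B.coaction c) := by
  obtain ⟨z, hz⟩ := B.right_sided c
  have h1 : B.comul (ι K C c) = ι K C c ⊗ₜ 1 + (1 ⊗ₜ ι K C c + (ι K C).lTensor _ z) := by
    rw [hz]; abel
  have h2 : ∀ z : SymmetricAlgebra K C ⊗[K] C,
      (symProj K).lTensor (SymmetricAlgebra K C) ((ι K C).lTensor _ z) = z := by
    intro z
    induction z using TensorProduct.induction_on with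
    | zero => simp
    | add x y hx hy => simp only [map_add, hx, hy]
    | tmul a b => simp [symProj_ι]
  have h3 : B.coaction c = 1 ⊗ₜ c + z := by
    rw [coaction_apply, h1, map_add, map_add, h2]
    simp [symProj_one, symProj_ι]
  rw [h1, h3]
  simp

theorem contractFst_counit_comul (x : SymmetricAlgebra K C) :
    contractFst _ (algebraMapInv : SymmetricAlgebra K C →ₐ[K] K).toLinearMap (B.comul x) = x := by
  have h1 := congrArg (fun f => f x) B.rTensor_counit
  have h2 := congrArg (TensorProduct.lid K (SymmetricAlgebra K C)) h1
  simp only [AlgHom.comp_apply] at h2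
  have h3 : TensorProduct.lid K (SymmetricAlgebra K C) (Algebra.TensorProduct.map algebraMapInv
      (AlgHom.id K (SymmetricAlgebra K C)) (B.comul x)) = x := by simpa using h2
  exact h3

theorem contractSnd_counit_comul (x : SymmetricAlgebra K C) :
    contractSnd _ (algebraMapInv : SymmetricAlgebra K C →ₐ[K] K).toLinearMap (B.comul x) = x := by
  have h1 := congrArg (fun f => f x) B.lTensor_counit
  have h2 := congrArg (TensorProduct.rid K (SymmetricAlgebra K C)) h1
  simp only [AlgHom.comp_apply] at h2
  have h3 : TensorProduct.rid K (SymmetricAlgebra K C) (Algebra.TensorProduct.map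
      (AlgHom.id K (SymmetricAlgebra K C)) algebraMapInv (B.comul x)) = x := by simpa using h2
  exact h3

theorem contractFst_counit_coaction (c : C) :
    contractFst _ (algebraMapInv : SymmetricAlgebra K C →ₐ[K] K).toLinearMap (B.coaction c) =
      c := by
  rw [coaction_apply, contractFst_lTensor, contractFst_counit_comul, symProj_ι]

theorem rightContraction_delta (f : C →ₗ[K] K) (c : C) :
    rightContraction B.delta f c = contractFst C (f ∘ₗ symProj K) (B.coaction c) := by
  rw [rightContraction_apply, delta]
  simp only [LinearMap.comp_apply, LinearEquiv.coe_coe, AlgHom.toLinearMap_apply]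
  rw [contractSnd_comm, contractFst_map, coaction_apply, contractFst_lTensor]

/-- The operator `(φ ⊗ id) ∘ Δ` on `S(C)` attached to a linear form `φ` on `S(C)`. -/
def leftShift (φ : SymmetricAlgebra K C →ₗ[K] K) :
    SymmetricAlgebra K C →ₗ[K] SymmetricAlgebra K C :=
  contractFst _ φ ∘ₗ B.comul.toLinearMap

theorem leftShift_apply (φ : SymmetricAlgebra K C →ₗ[K] K) (x : SymmetricAlgebra K C) :
    B.leftShift φ x = contractFst _ φ (B.comul x) := rfl

/-- Coassociativity contracted with φ in the first of the three factors. -/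
theorem comul_leftShift (φ : SymmetricAlgebra K C →ₗ[K] K) (x : SymmetricAlgebra K C) :
    B.comul (B.leftShift φ x) = (B.leftShift φ).rTensor _ (B.comul x) := by
  have h1 := congrArg (contractFst _ φ) (congrArg (fun f => f x) B.coassoc)
  have h2 : ∀ z : SymmetricAlgebra K C ⊗[K] SymmetricAlgebra K C,
      contractFst _ φ (Algebra.TensorProduct.map (.id K (SymmetricAlgebra K C)) B.comul z) =
        B.comul (contractFst _ φ z) := by
    intro z
    exact contractFst_lTensor φ B.comul.toLinearMap z
  have h3 : ∀ z : SymmetricAlgebra K C ⊗[K] SymmetricAlgebra K C,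
      contractFst _ φ (TensorProduct.assoc K (SymmetricAlgebra K C) (SymmetricAlgebra K C)
        (SymmetricAlgebra K C) (B.comul.toLinearMap.rTensor _ z)) =
        (B.leftShift φ).rTensor _ z := by
    intro z
    induction z using TensorProduct.induction_on with
    | zero => simp
    | add x y hx hy => simp only [map_add, hx, hy]
    | tmul a b =>
      rw [LinearMap.rTensor_tmul, LinearMap.rTensor_tmul, leftShift_apply,
        AlgHom.toLinearMap_apply]
      induction B.comul a using TensorProduct.induction_on with
      | zero => simp
      | add x y hx hy => rw [TensorProduct.add_tmul, map_add, map_add, hx, hy, map_add,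
          TensorProduct.add_tmul]
      | tmul a b => simp [TensorProduct.smul_tmul']
  simp only [AlgHom.comp_apply] at h1
  rw [h2] at h1
  rw [leftShift_apply, ← h1, ← h3]
  rfl

theorem contractFst_symProj_mul (f : C →ₗ[K] K)
    (z w : SymmetricAlgebra K C ⊗[K] SymmetricAlgebra K C) :
    contractFst _ (f ∘ₗ symProj K) (z * w) =
      contractFst _ (algebraMapInv : SymmetricAlgebra K C →ₐ[K] K).toLinearMap z *
          contractFst _ (f ∘ₗ symProj K) w +
        contractFst _ (algebraMapInv : SymmetricAlgebra K C →ₐ[K] K).toLinearMap w *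
          contractFst _ (f ∘ₗ symProj K) z := by
  induction z using TensorProduct.induction_on with
  | zero => simp
  | add x y hx hy => simp only [add_mul, map_add, hx, hy, mul_add]; abel
  | tmul a b =>
    induction w using TensorProduct.induction_on with
    | zero => simp
    | add x y hx hy => simp only [add_mul, map_add, hx, hy, mul_add]; abel
    | tmul a' b' =>
      simp only [Algebra.TensorProduct.tmul_mul_tmul, contractFst_tmul, LinearMap.comp_apply,
        symProj_mul, map_add, map_smul, AlgHom.toLinearMap_apply, smul_eq_mul, add_smul,
        smul_mul_smul_comm, mul_comm b' b]

/-- Since f ∘ π is a derivation along the counit, (f ∘ π ⊗ id)Δ is a derivation of S(C); its value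
on c is read off from Δ(c) = c ⊗ 1 + ρ(c). -/
theorem leftShift_symProj (f : C →ₗ[K] K) :
    B.leftShift (f ∘ₗ symProj K) =
      (affineDer f (rightContraction B.delta f)).toLinearMap := by
  refine symmetricAlgebra_leibniz_ext (AlgHom.id K (SymmetricAlgebra K C)) ?_ (by simp) ?_
  · intro x y
    simp only [leftShift_apply, map_mul, contractFst_symProj_mul, contractFst_counit_comul,
      AlgHom.coe_id, id_eq, smul_eq_mul]
  · intro c
    rw [leftShift_apply, comul_ι, map_add, contractFst_lTensor, ← rightContraction_delta]
    simp [symProj_ι, Algebra.algebraMap_eq_smul_one]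

/-- The coproduct intertwines the derivations `(f ∘ π ⊗ id) ∘ Δ`. -/
theorem comul_affineDer (f : C →ₗ[K] K) (x : SymmetricAlgebra K C) :
    B.comul (affineDer f (rightContraction B.delta f) x) =
      (affineDer f (rightContraction B.delta f)).toLinearMap.rTensor _ (B.comul x) := by
  rw [← leftShift_symProj, ← comul_leftShift, leftShift_symProj]
  rfl

theorem rTensor_affineDer_coaction (f : C →ₗ[K] K) (c : C) :
    (affineDer f (rightContraction B.delta f)).toLinearMap.rTensor _ (B.coaction c) =
      B.coaction (rightContraction B.delta f c) := by
  rw [coaction_apply, ← LinearMap.comp_apply, LinearMap.rTensor_comp_lTensor,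
    ← LinearMap.lTensor_comp_rTensor, LinearMap.comp_apply, ← comul_affineDer, affineDer_ι,
    map_add, map_add, coaction_apply, Algebra.algebraMap_eq_smul_one, map_smul, map_one,
    map_smul, Algebra.TensorProduct.one_def, LinearMap.lTensor_tmul, symProj_one,
    TensorProduct.tmul_zero, smul_zero, zero_add]

/-- Invariance and the counit axiom recover D from the linear form ε ∘ D, as for invariant vector
fields and their values at the identity. -/
theorem rTensor_counit_affineDer {D : Derivation K (SymmetricAlgebra K C) (SymmetricAlgebra K C)}
    (hD : ∀ x, B.comul (D x) = D.toLinearMap.rTensor _ (B.comul x)) (x : SymmetricAlgebra K C) :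
    D x = contractFst _ ((algebraMapInv : SymmetricAlgebra K C →ₐ[K] K).toLinearMap ∘ₗ
      D.toLinearMap) (B.comul x) := by
  rw [← contractFst_rTensor, ← hD, contractFst_counit_comul]

/-- A derivation of `S(C)` that commutes with the coproduct is determined by the linear form it
induces on `C`. -/
theorem derivation_eq_affineDer
    {D : Derivation K (SymmetricAlgebra K C) (SymmetricAlgebra K C)}
    (hD : ∀ x, B.comul (D x) = D.toLinearMap.rTensor _ (B.comul x)) {f : C →ₗ[K] K}
    (hf : ∀ c, algebraMapInv (D (ι K C c)) = f c) (x : SymmetricAlgebra K C) :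
    D x = affineDer f (rightContraction B.delta f) x := by
  have h1 : (algebraMapInv : SymmetricAlgebra K C →ₐ[K] K).toLinearMap ∘ₗ D.toLinearMap =
      f ∘ₗ symProj K := by
    refine symmetricAlgebra_leibniz_ext (algebraMapInv : SymmetricAlgebra K C →ₐ[K] K) ?_ ?_ ?_
    · intro x y; simp
    · intro x y; simp [symProj_mul]
    · intro c; simp [symProj_ι, hf]
  rw [B.rTensor_counit_affineDer hD, h1, ← leftShift_apply, leftShift_symProj]
  rfl

/-- The bracket of two invariant derivations is invariant, hence again of the form D_k with k its
constant part on C. Comparing the linear parts of [D_f, D_h](c) and D_k(c) gives the pre-Lie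
identity. -/
theorem isPreLieCooperation_delta : IsPreLieCooperation B.delta := by
  rw [isPreLieCooperation_iff]
  intro f h c
  set R := rightContraction B.delta with hR
  let D : Derivation K (SymmetricAlgebra K C) (SymmetricAlgebra K C) :=
    ⁅affineDer f (R f), affineDer h (R h)⁆
  have hD1 : ∀ x, D x = affineDer f (R f) (affineDer h (R h) x) -
      affineDer h (R h) (affineDer f (R f) x) := fun x => Derivation.commutator_apply _
  have hD : ∀ x, B.comul (D x) = D.toLinearMap.rTensor _ (B.comul x) := by
    intro x
    have : D.toLinearMap = (affineDer f (R f)).toLinearMap ∘ₗ (affineDer h (R h)).toLinearMap -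
        (affineDer h (R h)).toLinearMap ∘ₗ (affineDer f (R f)).toLinearMap :=
      LinearMap.ext hD1
    rw [this, LinearMap.rTensor_sub, LinearMap.rTensor_comp, LinearMap.rTensor_comp, hD1, map_sub]
    simp only [hR, comul_affineDer, LinearMap.sub_apply, LinearMap.comp_apply]
  -- The constant term of D_f(D_h c) is f(R_h c), which explains the form f ∘ R_h - h ∘ R_f.
  have h1 := B.derivation_eq_affineDer hD (f := f ∘ₗ R h - h ∘ₗ R f) (fun c => by
    simp [hD1, algebraMapInv_ι, algebraMap_leftInverse C _]) (ι K C c)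
  have h2 := congrArg (symProj K) h1
  rw [hD1] at h2
  simp only [affineDer_ι, map_add, map_sub, Derivation.map_algebraMap, symProj_ι, zero_add,
    symProj_algebraMap] at h2
  rw [← hR, hR, rightContraction_sub, ← hR, LinearMap.sub_apply, sub_eq_sub_iff_add_eq_add] at h2
  rw [sub_eq_sub_iff_add_eq_add, add_comm (R h (R f c)), ← h2]

end RightSidedBialgebra

/-! ## Conilpotence of the cooperation of a right-sided Hopf algebra -/

section LocalFiniteness

open SymmetricAlgebra

variable {K : Type*} [Field K]

theorem exists_finiteDimensional_contractFst_mem {M N : Type*} [AddCommGroup M] [Module K M]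
    [AddCommGroup N] [Module K N] (z : N ⊗[K] M) :
    ∃ V : Submodule K M, FiniteDimensional K V ∧ ∀ ψ : N →ₗ[K] K, contractFst M ψ z ∈ V := by
  induction z using TensorProduct.induction_on with
  | zero => exact ⟨⊥, inferInstance, fun ψ => by simp⟩
  | tmul n m =>
    exact ⟨K ∙ m, inferInstance, fun ψ => by
      rw [contractFst_tmul]
      exact Submodule.smul_mem _ _ (Submodule.mem_span_singleton_self m)⟩
  | add x y hx hy =>
    obtain ⟨V, hV, hx⟩ := hx
    obtain ⟨W, hW, hy⟩ := hy
    exact ⟨V ⊔ W, inferInstance, fun ψ => by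
      rw [map_add]
      exact Submodule.add_mem_sup (hx ψ) (hy ψ)⟩

theorem exists_contractFst_eventually_eq_zero {M N : Type*} [AddCommGroup M] [Module K M]
    [AddCommGroup N] [Module K N] {ψ : ℕ → N →ₗ[K] K}
    (h : ∀ x, ∃ n, ∀ m, n ≤ m → ψ m x = 0) (z : N ⊗[K] M) :
    ∃ n, ∀ m, n ≤ m → contractFst M (ψ m) z = 0 := by
  induction z using TensorProduct.induction_on with
  | zero => exact ⟨0, by simp⟩
  | tmul a b =>
    obtain ⟨n, hn⟩ := h a
    exact ⟨n, fun m hm => by rw [contractFst_tmul, hn m hm, zero_smul]⟩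
  | add x y hx hy =>
    obtain ⟨n, hx⟩ := hx
    obtain ⟨n', hy⟩ := hy
    exact ⟨max n n', fun m hm => by
      rw [map_add, hx m (le_trans (le_max_left _ _) hm), hy m (le_trans (le_max_right _ _) hm),
        add_zero]⟩

/-- An endomorphism whose iterates keep a vector in a finite-dimensional subspace satisfies a
polynomial equation at this vector. -/
theorem exists_aeval_apply_eq_zero {M : Type*} [AddCommGroup M] [Module K M] (D : Module.End K M)
    (x : M) (V : Submodule K M) [FiniteDimensional K V] (h : ∀ n : ℕ, (D ^ n) x ∈ V) :
    ∃ p : Polynomial K, p ≠ 0 ∧ Polynomial.aeval D p x = 0 := by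
  by_contra! hp
  let F : Polynomial K →ₗ[K] M :=
    LinearMap.applyₗ x ∘ₗ (Polynomial.aeval D).toLinearMap
  have hF : ∀ p, F p ∈ V := by
    intro p
    induction p using Polynomial.induction_on' with
    | add p q hp hq => rw [map_add]; exact V.add_mem hp hq
    | monomial n a =>
      have : F (Polynomial.monomial n a) = a • (D ^ n) x := by
        simp [F, Polynomial.aeval_monomial, Module.algebraMap_end_apply]
      rw [this]
      exact V.smul_mem _ (h n)
  have hinj : Function.Injective (F.codRestrict V hF) := by
    rw [injective_iff_map_eq_zero]
    intro p hp'
    by_contra hne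
    exact hp p hne (congrArg Subtype.val hp')
  exact Polynomial.not_finite (R := K) (Module.Finite.of_injective _ hinj)

/-- The elements killed by a polynomial in `D` with nonzero constant term, inside a `D`-stable
subspace. -/
def unitTorsion {M : Type*} [AddCommGroup M] [Module K M] (D : Module.End K M)
    (A : Submodule K M) : Submodule K M where
  carrier := {y | y ∈ A ∧ ∃ p : Polynomial K, p.coeff 0 ≠ 0 ∧ Polynomial.aeval D p y = 0}
  zero_mem' := ⟨A.zero_mem, 1, by simp, by simp⟩
  add_mem' := by
    rintro x y ⟨hx, p, hp, hpx⟩ ⟨hy, q, hq, hqy⟩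
    refine ⟨A.add_mem hx hy, p * q, by simp [Polynomial.mul_coeff_zero, hp, hq], ?_⟩
    rw [map_add]
    nth_rewrite 1 [mul_comm]
    rw [map_mul, map_mul, Module.End.mul_apply, Module.End.mul_apply, hpx, hqy, map_zero,
      map_zero, add_zero]
  smul_mem' := by
    rintro r x ⟨hx, p, hp, hpx⟩
    exact ⟨A.smul_mem _ hx, p, hp, by rw [map_smul, hpx, smul_zero]⟩

theorem apply_mem_unitTorsion {M : Type*} [AddCommGroup M] [Module K M] {D : Module.End K M}
    {A : Submodule K M} (hA : ∀ y ∈ A, D y ∈ A) {y : M} (hy : y ∈ unitTorsion D A) :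
    D y ∈ unitTorsion D A := by
  obtain ⟨hy, p, hp, hpy⟩ := hy
  refine ⟨hA y hy, p, hp, ?_⟩
  have : Polynomial.aeval D p * D = D * Polynomial.aeval D p := by
    have h1 : Polynomial.aeval D (p * Polynomial.X) = Polynomial.aeval D (Polynomial.X * p) := by
      rw [mul_comm]
    simpa using h1
  rw [← Module.End.mul_apply, this, Module.End.mul_apply, hpy, map_zero]

theorem exists_pow_apply_mem_unitTorsion {M : Type*} [AddCommGroup M] [Module K M]
    {D : Module.End K M} {A : Submodule K M} (hA : ∀ y ∈ A, D y ∈ A) {y : M} (hy : y ∈ A)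
    (h : ∃ p : Polynomial K, p ≠ 0 ∧ Polynomial.aeval D p y = 0) :
    ∃ n : ℕ, (D ^ n) y ∈ unitTorsion D A := by
  obtain ⟨p, hp, hpy⟩ := h
  -- Write p = Xᵏ q with q(0) ≠ 0; then q(D) kills Dᵏ y.
  obtain ⟨q, hq, hdvd⟩ := Polynomial.exists_eq_pow_rootMultiplicity_mul_and_not_dvd p hp 0
  rw [map_zero, sub_zero] at hq hdvd
  refine ⟨p.rootMultiplicity 0, ?_, q, fun h0 => hdvd (Polynomial.X_dvd_iff.2 h0), ?_⟩
  · induction p.rootMultiplicity 0 with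
    | zero => simpa using hy
    | succ n ih => rw [pow_succ', Module.End.mul_apply]; exact hA _ ih
  · rw [hq, mul_comm, map_mul, map_pow, Polynomial.aeval_X, Module.End.mul_apply] at hpy
    exact hpy

/-- If the iterates of a derivation move two elements into a stable ideal, they move the product
into this ideal. -/
theorem Derivation.pow_apply_mul_mem {A : Type*} [CommRing A] [Algebra K A] (D : Derivation K A A)
    {J : Ideal A} (hJ : ∀ y ∈ J, D y ∈ J) (n : ℕ) : ∀ (a b : ℕ), a + b = n → ∀ x y : A,
      (D.toLinearMap ^ a : Module.End K A) x ∈ J → (D.toLinearMap ^ b : Module.End K A) y ∈ J →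
      (D.toLinearMap ^ n : Module.End K A) (x * y) ∈ J := by
  have hpow : ∀ (m : ℕ) (x : A), x ∈ J → (D.toLinearMap ^ m : Module.End K A) x ∈ J := by
    intro m x hx
    induction m with
    | zero => simpa using hx
    | succ m ih => rw [pow_succ', Module.End.mul_apply]; exact hJ _ ih
  induction n with
  | zero =>
    intro a b hab x y hx _
    obtain rfl : a = 0 := by omega
    simpa using J.mul_mem_right y (by simpa using hx)
  | succ n ih =>
    intro a b hab x y hx hy
    rcases a with _ | a
    · exact hpow _ _ (J.mul_mem_right y (by simpa using hx))
    rcases b with _ | b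
    · exact hpow _ _ (J.mul_mem_left x (by simpa using hy))
    have hx' := hx
    have hy' := hy
    rw [pow_succ, Module.End.mul_apply] at hx' hy'
    rw [pow_succ, Module.End.mul_apply]
    have : D.toLinearMap (x * y) = x * D y + y * D x := by simp
    rw [this, map_add]
    refine J.add_mem (ih (a + 1) b (by omega) _ _ hx hy') ?_
    rw [mul_comm]
    exact ih a (b + 1) (by omega) _ _ hx' hy

end LocalFiniteness

namespace RightSidedHopf

open SymmetricAlgebra

attribute [local instance] LieRing.ofAssociativeRing

variable {K : Type u} [Field K] {C : Type v} [AddCommGroup C] [Module K C]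

theorem toLinearMap_pow_eq_contractFst (B : RightSidedBialgebra K C)
    {D : Module.End K (SymmetricAlgebra K C)}
    (hD : ∀ x, B.comul (D x) = D.rTensor _ (B.comul x)) (n : ℕ) (x : SymmetricAlgebra K C) :
    B.comul ((D ^ n) x) = (D ^ n).rTensor _ (B.comul x) ∧
    (D ^ n) x = contractFst _ ((algebraMapInv : SymmetricAlgebra K C →ₐ[K] K).toLinearMap ∘ₗ
      (D ^ n)) (B.comul x) := by
  have h : B.comul ((D ^ n) x) = (D ^ n).rTensor _ (B.comul x) := by
    induction n with
    | zero => simp [Module.End.one_eq_id]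
    | succ n ih =>
      rw [pow_succ', Module.End.mul_apply, hD, ih, Module.End.mul_eq_comp,
        LinearMap.rTensor_comp, LinearMap.comp_apply]
  refine ⟨h, ?_⟩
  rw [← contractFst_rTensor, ← h, B.contractFst_counit_comul]

/-- A derivation of a right-sided Hopf algebra that commutes with the coproduct is locally
nilpotent. -/
theorem exists_derivation_pow_eq_zero (H : RightSidedHopf K C)
    (D : Derivation K (SymmetricAlgebra K C) (SymmetricAlgebra K C))
    (hD : ∀ x, H.comul (D x) = D.toLinearMap.rTensor _ (H.comul x))
    (hDι : ∀ c, ∃ (r : K) (c' : C), D (ι K C c) = algebraMap K _ r + ι K C c')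
    (x : SymmetricAlgebra K C) :
    ∃ n, ∀ m, n ≤ m → (D.toLinearMap ^ m : Module.End K _) x = 0 := by
  set E : Module.End K (SymmetricAlgebra K C) := D.toLinearMap with hE
  have hpow := fun n x => toLinearMap_pow_eq_contractFst H.toRightSidedBialgebra (D := E) hD n x
  -- K ⊕ C is stable under D. Its `unitTorsion` is the part on which D is not nilpotent; the goal is
  -- a character of S(C) that kills this part.
  let A : Submodule K (SymmetricAlgebra K C) :=
    LinearMap.range (Algebra.linearMap K (SymmetricAlgebra K C)) ⊔ LinearMap.range (ι K C)
  have hAr : ∀ (r : K), algebraMap K _ r ∈ A := fun r => Submodule.mem_sup_left ⟨r, rfl⟩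
  have hAι : ∀ c, ι K C c ∈ A := fun c => Submodule.mem_sup_right ⟨c, rfl⟩
  have hAmem : ∀ y ∈ A, ∃ (r : K) (c : C), y = algebraMap K _ r + ι K C c := by
    intro y hy
    obtain ⟨_, ⟨r, rfl⟩, _, ⟨c, rfl⟩, rfl⟩ := Submodule.mem_sup.1 hy
    exact ⟨r, c, rfl⟩
  have hA : ∀ y ∈ A, E y ∈ A := by
    intro y hy
    obtain ⟨r, c, rfl⟩ := hAmem y hy
    obtain ⟨r', c', h⟩ := hDι c
    rw [map_add]
    simp only [hE, Derivation.coeFn_coe, Derivation.map_algebraMap, zero_add, h]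
    exact A.add_mem (hAr _) (hAι _)
  -- As D(1) = 0, the element p(D)(1) is p(0) · 1.
  have h1 : (1 : SymmetricAlgebra K C) ∉ unitTorsion E A := by
    rintro ⟨-, p, hp, hp1⟩
    have : Polynomial.aeval E p 1 = p.coeff 0 • (1 : SymmetricAlgebra K C) := by
      clear hp hp1
      induction p using Polynomial.induction_on' with
      | add p q hp hq =>
        rw [map_add, LinearMap.add_apply, hp, hq, Polynomial.coeff_add, add_smul]
      | monomial n a =>
        rcases n with _ | n
        · simp [Algebra.algebraMap_eq_smul_one]
        · simp [Polynomial.aeval_monomial, pow_succ, hE]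
    rw [this] at hp1
    exact hp ((smul_eq_zero.1 hp1).resolve_right one_ne_zero)
  -- Take a form l on S(C) that vanishes on the torsion but not at 1. The character φ with φ(c) =
  -- l(c)/l(1) agrees with l/l(1) on K ⊕ C, so it kills the torsion and the D-stable ideal J it
  -- generates.
  obtain ⟨l, hl1, hl⟩ := Submodule.exists_le_ker_of_notMem h1
  let φ : SymmetricAlgebra K C →ₐ[K] K := SymmetricAlgebra.lift ((l 1)⁻¹ • l ∘ₗ ι K C)
  have hφ : ∀ y ∈ unitTorsion E A, φ y = 0 := by
    intro y hy
    have hly := hl hy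
    obtain ⟨r, c, rfl⟩ := hAmem y hy.1
    rw [LinearMap.mem_ker, map_add, Algebra.algebraMap_eq_smul_one, map_smul, smul_eq_mul] at hly
    rw [map_add, AlgHom.commutes]
    simp only [φ, lift_ι_apply, LinearMap.smul_apply, LinearMap.comp_apply, smul_eq_mul,
      Algebra.algebraMap_self, RingHom.id_apply]
    field_simp
    linear_combination hly
  let J : Ideal (SymmetricAlgebra K C) := Ideal.span (unitTorsion E A)
  have hJ : ∀ y ∈ J, D y ∈ J := by
    intro y hy
    induction hy using Submodule.span_induction with
    | mem y hy => exact Ideal.subset_span (apply_mem_unitTorsion hA hy)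
    | zero => simp
    | add x y _ _ hx hy => rw [map_add]; exact J.add_mem hx hy
    | smul a y hy ih =>
      rw [smul_eq_mul, Derivation.leibniz]
      exact J.add_mem (J.mul_mem_left _ ih) (J.mul_mem_right _ hy)
  have hφJ : ∀ y ∈ J, φ y = 0 := fun y hy =>
    (Ideal.span_le (I := RingHom.ker φ)).2 hφ hy
  -- For c in C, the vectors Dⁿc = (εDⁿ ⊗ id)Δ(c) stay in a finite-dimensional space, so a nonzero
  -- polynomial in D kills c and some Dⁿc is torsion. The Leibniz rule extends this to products.
  have hJmem : ∀ y, ∃ n : ℕ, (E ^ n) y ∈ J := by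
    intro y
    induction y using SymmetricAlgebra.induction with
    | algebraMap r => exact ⟨1, by simp [hE]⟩
    | ι c =>
      obtain ⟨V, hV, hmem⟩ := exists_finiteDimensional_contractFst_mem (H.comul (ι K C c))
      obtain ⟨n, hn⟩ := exists_pow_apply_mem_unitTorsion hA (hAι c)
        (exists_aeval_apply_eq_zero E (ι K C c) V fun n => by
          rw [(hpow n _).2]
          exact hmem _)
      exact ⟨n, Ideal.subset_span hn⟩
    | mul x y hx hy =>
      obtain ⟨a, ha⟩ := hx
      obtain ⟨b, hb⟩ := hy
      exact ⟨a + b, D.pow_apply_mul_mem hJ _ a b rfl x y ha hb⟩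
    | add x y hx hy =>
      obtain ⟨a, ha⟩ := hx
      obtain ⟨b, hb⟩ := hy
      have hmono : ∀ (m : ℕ) (x : SymmetricAlgebra K C), x ∈ J → (E ^ m) x ∈ J := by
        intro m x hx
        induction m with
        | zero => simpa using hx
        | succ m ih => rw [pow_succ', Module.End.mul_apply]; exact hJ _ ih
      refine ⟨a + b, ?_⟩
      rw [map_add]
      refine J.add_mem ?_ ?_
      · rw [add_comm, pow_add, Module.End.mul_apply]; exact hmono _ _ ha
      · rw [pow_add, Module.End.mul_apply]; exact hmono _ _ hb
  have hφpow : ∀ y, ∃ n, ∀ m, n ≤ m → (φ.toLinearMap ∘ₗ (E ^ m)) y = 0 := by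
    intro y
    obtain ⟨n, hn⟩ := hJmem y
    refine ⟨n, fun m hm => ?_⟩
    obtain ⟨k, rfl⟩ := Nat.exists_eq_add_of_le' hm
    rw [LinearMap.comp_apply, AlgHom.toLinearMap_apply]
    apply hφJ
    clear hm
    induction k with
    | zero => simpa using hn
    | succ k ih => rw [add_right_comm, pow_succ', Module.End.mul_apply]; exact hJ _ ih
  obtain ⟨S, -, hS⟩ := H.exists_antipode
  have hSφ : ∀ z : SymmetricAlgebra K C ⊗[K] SymmetricAlgebra K C,
      φ (LinearMap.mul' K _ (S.lTensor _ z)) = φ (S (contractFst _ φ.toLinearMap z)) := by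
    intro z
    induction z using TensorProduct.induction_on with
    | zero => simp
    | tmul a b => simp
    | add x y hx hy => simp only [map_add, hx, hy]
  -- The antipode makes φ invertible: ε(x) is the sum of φ(x₁) φ(S x₂). Putting x = Dᵐy moves Dᵐ to
  -- the first factor of Δ(y), where φ ∘ Dᵐ eventually vanishes.
  have hε : ∀ y, ∃ n, ∀ m, n ≤ m →
      ((algebraMapInv : SymmetricAlgebra K C →ₐ[K] K).toLinearMap ∘ₗ (E ^ m)) y = 0 := by
    intro y
    obtain ⟨n, hn⟩ := exists_contractFst_eventually_eq_zero hφpow (H.comul y)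
    refine ⟨n, fun m hm => ?_⟩
    have h2 := congrArg φ (congrArg (fun f => f ((E ^ m) y)) hS)
    simp only [LinearMap.comp_apply, AlgHom.toLinearMap_apply, Algebra.linearMap_apply,
      AlgHom.commutes] at h2
    have h3 := (hpow m y).1
    change H.comul _ = (E ^ m).rTensor _ (H.comul y) at h3
    rw [hSφ, h3, contractFst_rTensor, hn m hm, map_zero, map_zero] at h2
    exact h2.symm
  obtain ⟨n, hn⟩ := exists_contractFst_eventually_eq_zero hε (H.comul x)
  refine ⟨n, fun m hm => ?_⟩
  rw [(hpow m x).2]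
  exact hn m hm

/-- Modulo constants D_f acts on C as R_f. -/
theorem exists_rightContraction_pow_eq_zero (H : RightSidedHopf K C) (f : C →ₗ[K] K) (c : C) :
    ∃ n, (rightContraction H.delta f ^ n : Module.End K C) c = 0 := by
  set R : Module.End K C := rightContraction H.delta f with hR
  obtain ⟨n, hn⟩ := H.exists_derivation_pow_eq_zero (affineDer f R)
    (H.toRightSidedBialgebra.comul_affineDer f) (fun c => ⟨_, _, affineDer_ι f R c⟩) (ι K C c)
  refine ⟨n, ?_⟩
  have h : ∀ m : ℕ, ∃ r : K,
      ((affineDer f R).toLinearMap ^ m : Module.End K (SymmetricAlgebra K C)) (ι K C c) =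
        algebraMap K _ r + ι K C ((R ^ m) c) := by
    intro m
    induction m with
    | zero => exact ⟨0, by simp⟩
    | succ m ih =>
      obtain ⟨r, hr⟩ := ih
      refine ⟨f ((R ^ m) c), ?_⟩
      rw [pow_succ', Module.End.mul_apply, hr, pow_succ', Module.End.mul_apply]
      simp
  obtain ⟨r, hr⟩ := h n
  rw [hn n le_rfl] at hr
  have := congrArg (symProj K) hr
  rw [map_zero, map_add, symProj_algebraMap, symProj_ι, zero_add] at this
  exact this.symm

/-- Engel's theorem: by the pre-Lie identity the R_f form a Lie algebra on the finite-dimensional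
space V that they generate from c, and each acts nilpotently. -/
theorem isConilpotent_delta (H : RightSidedHopf K C) : IsConilpotent H.delta := by
  intro c
  set B := H.toRightSidedBialgebra with hB
  set R : (C →ₗ[K] K) → Module.End K C := rightContraction H.delta with hR
  let A : Subalgebra K (Module.End K C) := Algebra.adjoin K (Set.range R)
  have hRA : ∀ f, R f ∈ A := fun f => Algebra.subset_adjoin ⟨f, rfl⟩
  -- Every product a of operators R_f passes through the coaction to an operator D on its first
  -- factor. Hence a(c) = (εD ⊗ id)ρ(c) lies in a finite-dimensional space independent of a.
  have hA : ∀ a ∈ A, ∃ D : Module.End K (SymmetricAlgebra K C),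
      ∀ c, B.coaction (a c) = D.rTensor _ (B.coaction c) := by
    intro a ha
    induction ha using Algebra.adjoin_induction with
    | mem a ha =>
      obtain ⟨f, rfl⟩ := ha
      exact ⟨_, fun c => (B.rTensor_affineDer_coaction f c).symm⟩
    | algebraMap r =>
      exact ⟨algebraMap K _ r, fun c => by
        simp [Module.algebraMap_end_eq_smul_id, LinearMap.rTensor_smul]⟩
    | add a b _ _ ha hb =>
      obtain ⟨D, hD⟩ := ha
      obtain ⟨E, hE⟩ := hb
      exact ⟨D + E, fun c => by
        rw [LinearMap.add_apply, map_add, hD, hE, LinearMap.rTensor_add, LinearMap.add_apply]⟩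
    | mul a b _ _ ha hb =>
      obtain ⟨D, hD⟩ := ha
      obtain ⟨E, hE⟩ := hb
      exact ⟨D * E, fun c => by
        rw [Module.End.mul_apply, hD, hE, LinearMap.rTensor_mul, Module.End.mul_apply]⟩
  obtain ⟨V₀, hV₀, hmem⟩ := exists_finiteDimensional_contractFst_mem (B.coaction c)
  let V : Submodule K C := A.toSubmodule.map (LinearMap.applyₗ c)
  have hVle : V ≤ V₀ := by
    rintro _ ⟨a, ha, rfl⟩
    obtain ⟨D, hD⟩ := hA a ha
    rw [LinearMap.applyₗ_apply_apply, ← B.contractFst_counit_coaction (a c), hD,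
      contractFst_rTensor]
    exact hmem _
  have hVfin : FiniteDimensional K V := Submodule.finiteDimensional_of_le hVle
  have hVR : ∀ f, ∀ x ∈ V, R f x ∈ V := by
    rintro f _ ⟨a, ha, rfl⟩
    exact ⟨R f * a, A.mul_mem (hRA f) ha, rfl⟩
  have hcV : c ∈ V := ⟨1, A.one_mem, rfl⟩
  let ρ : (C →ₗ[K] K) →ₗ[K] Module.End K V :=
    { toFun := fun f => (R f).restrict (hVR f)
      map_add' := fun f g => by
        ext x
        simp [hR, rightContraction_add]
      map_smul' := fun r f => by
        ext x
        simp [hR, rightContraction_smul] }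
  have hρ : ∀ f (x : V), (ρ f x : C) = R f x := fun f x => rfl
  let L : LieSubalgebra K (Module.End K V) :=
    { LinearMap.range ρ with
      lie_mem' := by
        rintro _ _ ⟨f, rfl⟩ ⟨h, rfl⟩
        refine ⟨f ∘ₗ R h - h ∘ₗ R f, ?_⟩
        ext x
        have := (isPreLieCooperation_iff _).1 B.isPreLieCooperation_delta f h x
        rw [map_sub, LinearMap.sub_apply, Ring.lie_def, LinearMap.sub_apply, Module.End.mul_apply,
          Module.End.mul_apply, AddSubgroupClass.coe_sub, AddSubgroupClass.coe_sub]
        simp only [hρ]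
        rw [sub_eq_sub_iff_add_eq_add] at this ⊢
        change R h (R f x) + R (f ∘ₗ R h) x = R f (R h x) + R (h ∘ₗ R f) x at this
        rw [← this, add_comm] }
  have hL : LieModule.IsNilpotent L V := by
    rw [LieModule.isNilpotent_iff_forall' (R := K)]
    rintro ⟨_, ⟨f, rfl⟩⟩
    change IsNilpotent (ρ f)
    rw [Module.End.isNilpotent_iff_of_finite]
    intro x
    obtain ⟨n, hn⟩ := H.exists_rightContraction_pow_eq_zero f x
    refine ⟨n, Subtype.ext ?_⟩
    rw [ZeroMemClass.coe_zero, ← hn]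
    clear hn
    induction n with
    | zero => simp
    | succ n ih => rw [pow_succ', Module.End.mul_apply, hρ, ih, pow_succ', Module.End.mul_apply]
  obtain ⟨k, hk⟩ := (LieModule.isNilpotent_iff K L V).1 hL
  -- Each R_f moves one step down the lower central series, so the term m lies in G_{k-m} once the
  -- term k is zero.
  have hlcs : ∀ n m : ℕ, m + n = k → ∀ x ∈ LieModule.lowerCentralSeries K L V m,
      (x : C) ∈ leftFiltration H.delta n := by
    intro n
    induction n with
    | zero =>
      intro m hm x hx
      obtain rfl : m = k := by omega
      rw [hk, LieSubmodule.mem_bot] at hx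
      rw [hx]
      exact Submodule.zero_mem _
    | succ n ih =>
      intro m hm x hx
      rw [mem_leftFiltration_succ]
      intro f
      refine ih (m + 1) (by omega) (ρ f x) ?_
      rw [LieModule.lowerCentralSeries_succ]
      exact LieSubmodule.lie_mem_lie (LieSubmodule.mem_top (⟨ρ f, ⟨f, rfl⟩⟩ : L)) hx
  exact ⟨k, hlcs k 0 (zero_add k) ⟨c, hcV⟩ (LieSubmodule.mem_top _)⟩

end RightSidedHopf

/-! ## Morphisms, antipodes and construction of right-sided bialgebras -/

section Morphisms

open SymmetricAlgebra

variable {K : Type*} [Field K] {C C' : Type*} [AddCommGroup C] [Module K C]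
  [AddCommGroup C'] [Module K C']

theorem symmetricAlgebra_algHom_ext {A : Type*} [Semiring A] [Algebra K A]
    {F G : SymmetricAlgebra K C →ₐ[K] A} (h : ∀ c, F (ι K C c) = G (ι K C c)) : F = G := by
  refine AlgHom.ext fun x => ?_
  induction x using SymmetricAlgebra.induction with
  | algebraMap r => rw [AlgHom.commutes, AlgHom.commutes]
  | ι c => exact h c
  | mul a b ha hb => rw [map_mul, map_mul, ha, hb]
  | add a b ha hb => rw [map_add, map_add, ha, hb]

theorem rightContraction_comp_of_map_comp_eq {δ : C →ₗ[K] C ⊗[K] C} {δ' : C' →ₗ[K] C' ⊗[K] C'}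
    {φ : C →ₗ[K] C'} (h : TensorProduct.map φ φ ∘ₗ δ = δ' ∘ₗ φ) (f : C' →ₗ[K] K) (c : C) :
    rightContraction δ' f (φ c) = φ (rightContraction δ (f ∘ₗ φ) c) := by
  have := congrArg (fun g => g c) h
  simp only [LinearMap.comp_apply] at this
  rw [rightContraction_apply, ← this, contractSnd_map, rightContraction_apply]

theorem map_comp_eq_of_rightContraction {δ : C →ₗ[K] C ⊗[K] C} {δ' : C' →ₗ[K] C' ⊗[K] C'}
    {φ : C →ₗ[K] C'}
    (h : ∀ f c, rightContraction δ' f (φ c) = φ (rightContraction δ (f ∘ₗ φ) c)) :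
    TensorProduct.map φ φ ∘ₗ δ = δ' ∘ₗ φ := by
  refine LinearMap.ext fun c => eq_of_contractSnd_eq fun g => ?_
  simp only [LinearMap.comp_apply]
  rw [contractSnd_map]
  exact (h g c).symm

theorem affineDer_symMap (φ : C →ₗ[K] C') (f : C' →ₗ[K] K) {A : C →ₗ[K] C} {A' : C' →ₗ[K] C'}
    (h : ∀ c, A' (φ c) = φ (A c)) (x : SymmetricAlgebra K C) :
    affineDer f A' (symMap φ x) = symMap φ (affineDer (f ∘ₗ φ) A x) := by
  have h1 := symmetricAlgebra_leibniz_ext (symMap φ)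
    (d := (affineDer f A').toLinearMap ∘ₗ (symMap φ).toLinearMap)
    (e := (symMap φ).toLinearMap ∘ₗ (affineDer (f ∘ₗ φ) A).toLinearMap)
    (by intro x y; simp) (by intro x y; simp) (by intro c; simp [symMap_ι, h])
  exact congrArg (fun g => g x) h1

theorem algebraMapInv_affineDer (f : C →ₗ[K] K) (A : C →ₗ[K] C) :
    (algebraMapInv : SymmetricAlgebra K C →ₐ[K] K).toLinearMap ∘ₗ (affineDer f A).toLinearMap =
      f ∘ₗ symProj K := by
  refine symmetricAlgebra_leibniz_ext (algebraMapInv : SymmetricAlgebra K C →ₐ[K] K) ?_ ?_ ?_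
  · intro x y; simp
  · intro x y; simp [symProj_mul]
  · intro c; simp [symProj_ι, algebraMapInv_ι, algebraMap_leftInverse C _]

end Morphisms

namespace RightSidedBialgebra

open SymmetricAlgebra

/-- A morphism of the induced cooperations extends to a morphism of bialgebras. -/
theorem comul_symMap {K : Type*} [Field K] [CharZero K] {C C' : Type*} [AddCommGroup C]
    [Module K C] [AddCommGroup C'] [Module K C'] (B : RightSidedBialgebra K C)
    (B' : RightSidedBialgebra K C') (hB : IsConilpotent B.delta) {φ : C →ₗ[K] C'}
    (hφ : TensorProduct.map φ φ ∘ₗ B.delta = B'.delta ∘ₗ φ) :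
    (Algebra.TensorProduct.map (symMap φ) (symMap φ)).comp B.comul =
      B'.comul.comp (symMap φ) := by
  have hR := rightContraction_comp_of_map_comp_eq hφ
  have h1 : ∀ n, ∀ c ∈ leftFiltration B.delta n,
      TensorProduct.map (symMap φ).toLinearMap (symMap φ).toLinearMap (B.comul (ι K C c)) =
        B'.comul (ι K C' (φ c)) := by
    intro n
    induction n with
    | zero =>
      intro c hc
      rw [show c = 0 from hc]
      simp
    | succ n ih =>
      intro c hc
      rw [mem_leftFiltration_succ] at hc
      -- Applying D_f ⊗ id replaces c by a constant plus R c with R c in G_n, where the induction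
      -- hypothesis applies. Both counits are the image of c.
      refine eq_of_rTensor_affineDer_eq (rightContraction B'.delta) (fun f => ?_) ?_
      · have h2 : (affineDer f (rightContraction B'.delta f)).toLinearMap ∘ₗ
            (symMap φ).toLinearMap = (symMap φ).toLinearMap ∘ₗ
              (affineDer (f ∘ₗ φ) (rightContraction B.delta (f ∘ₗ φ))).toLinearMap :=
          LinearMap.ext fun x => affineDer_symMap φ f (hR f) x
        rw [← LinearMap.comp_apply, LinearMap.rTensor_comp_map, h2, ← LinearMap.map_comp_rTensor,
          LinearMap.comp_apply, ← comul_affineDer, ← comul_affineDer, affineDer_ι, affineDer_ι,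
          hR, map_add, map_add, map_add, ih _ (hc _), AlgHom.commutes, AlgHom.commutes]
        simp [Algebra.TensorProduct.algebraMap_apply]
      · have h3 : (algebraMapInv : SymmetricAlgebra K C' →ₐ[K] K).toLinearMap ∘ₗ
            (symMap φ).toLinearMap = (algebraMapInv : SymmetricAlgebra K C →ₐ[K] K).toLinearMap :=
          LinearMap.ext fun x => algebraMapInv_symMap φ x
        rw [contractFst_map, h3, contractFst_counit_comul, contractFst_counit_comul,
          AlgHom.toLinearMap_apply, symMap_ι]
  refine symmetricAlgebra_algHom_ext fun c => ?_
  obtain ⟨n, hn⟩ := hB c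
  simp only [AlgHom.comp_apply, symMap_ι]
  exact h1 n c hn

variable {K : Type*} [Field K] {C : Type*} [AddCommGroup C] [Module K C]

theorem lTensor_mkQ_eq_zero_iff {M N : Type*} [AddCommGroup M] [Module K M]
    [AddCommGroup N] [Module K N] {V : Submodule K M} {x : N ⊗[K] M} :
    V.mkQ.lTensor N x = 0 ↔ x ∈ LinearMap.range (V.subtype.lTensor N) := by
  rw [← (lTensor_exact N (LinearMap.exact_subtype_mkQ V) V.mkQ_surjective).linearMap_ker_eq,
    LinearMap.mem_ker]

theorem range_lTensor_subtype_mono {M N : Type*} [AddCommGroup M] [Module K M]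
    [AddCommGroup N] [Module K N] {V W : Submodule K M} (h : V ≤ W) :
    LinearMap.range (V.subtype.lTensor N) ≤ LinearMap.range (W.subtype.lTensor N) := by
  intro x hx
  rw [mem_range_lTensor_subtype_iff] at hx ⊢
  exact fun g => h (hx g)

theorem tmul_mem_range_lTensor_subtype {M N : Type*} [AddCommGroup M] [Module K M]
    [AddCommGroup N] [Module K N] {V : Submodule K M} (n : N) {m : M} (h : m ∈ V) :
    n ⊗ₜ[K] m ∈ LinearMap.range (V.subtype.lTensor N) :=
  ⟨n ⊗ₜ ⟨m, h⟩, by simp⟩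

/-- The coaction is unipotent with respect to the filtration of `C` by conilpotence. -/
theorem coaction_sub_mem [CharZero K] (B : RightSidedBialgebra K C) (n : ℕ) :
    (∀ c ∈ leftFiltration B.delta n,
      B.coaction c ∈ LinearMap.range ((leftFiltration B.delta n).subtype.lTensor _)) ∧
    ∀ c ∈ leftFiltration B.delta (n + 1),
      B.coaction c - 1 ⊗ₜ c ∈
        LinearMap.range ((leftFiltration B.delta n).subtype.lTensor _) := by
  have step : ∀ n, (∀ c ∈ leftFiltration B.delta n,
      B.coaction c ∈ LinearMap.range ((leftFiltration B.delta n).subtype.lTensor _)) →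
      ∀ c ∈ leftFiltration B.delta (n + 1), B.coaction c - 1 ⊗ₜ c ∈
        LinearMap.range ((leftFiltration B.delta n).subtype.lTensor _) := by
    intro n h c hc
    rw [mem_leftFiltration_succ] at hc
    rw [← lTensor_mkQ_eq_zero_iff]
    -- Modulo G_n the element ρ(c) - 1 ⊗ c is killed by every D_f ⊗ id, because (D_f ⊗ id)ρ(c) =
    -- ρ(R_f c) has second factors in G_n and D_f(1) = 0. Its counit part is c - c.
    refine eq_zero_of_rTensor_affineDer_eq_zero (rightContraction B.delta) (fun f => ?_) ?_
    · rw [← LinearMap.comp_apply, LinearMap.rTensor_comp_lTensor,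
        ← LinearMap.lTensor_comp_rTensor, LinearMap.comp_apply, map_sub,
        rTensor_affineDer_coaction, lTensor_mkQ_eq_zero_iff]
      simpa using h _ (hc f)
    · rw [contractFst_lTensor, map_sub, contractFst_counit_coaction]
      simp
  induction n with
  | zero =>
    have h0 : ∀ c ∈ leftFiltration B.delta 0,
        B.coaction c ∈ LinearMap.range ((leftFiltration B.delta 0).subtype.lTensor _) := by
      intro c hc
      rw [show c = 0 from hc, map_zero]
      exact Submodule.zero_mem _
    exact ⟨h0, step 0 h0⟩
  | succ n ih =>
    have h1 : ∀ c ∈ leftFiltration B.delta (n + 1),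
        B.coaction c ∈ LinearMap.range ((leftFiltration B.delta (n + 1)).subtype.lTensor _) := by
      intro c hc
      rw [← sub_add_cancel (B.coaction c) (1 ⊗ₜ c)]
      exact Submodule.add_mem _
        (range_lTensor_subtype_mono (leftFiltration_le_succ _ n) (ih.2 c hc))
        (tmul_mem_range_lTensor_subtype _ hc)
    exact ⟨h1, step _ h1⟩

/-- An additive map that is unipotent with respect to an exhaustive filtration is bijective. -/
theorem bijective_of_unipotent {M : Type*} [AddCommGroup M] [Module K M] {T : M → M}
    (hT : ∀ x y, T (x + y) = T x + T y) (F : ℕ → Submodule K M) (h0 : F 0 = ⊥)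
    (hF : ∀ x, ∃ n, x ∈ F n) (h : ∀ n, ∀ x ∈ F (n + 1), T x - x ∈ F n) :
    Function.Bijective T := by
  let T' : M →+ M := AddMonoidHom.mk' T hT
  constructor
  · change Function.Injective T'
    rw [injective_iff_map_eq_zero]
    intro x hx
    obtain ⟨n, hn⟩ := hF x
    induction n with
    | zero => rw [h0] at hn; exact hn
    | succ n ih =>
      refine ih ?_
      have := h n x hn
      change T' x - x ∈ F n at this
      rw [hx, zero_sub] at this
      exact neg_mem_iff.1 this
  · intro y
    obtain ⟨n, hn⟩ := hF y
    change ∃ x, T' x = y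
    induction n generalizing y with
    | zero =>
      rw [h0] at hn
      rw [show y = 0 from hn]
      exact ⟨0, map_zero T'⟩
    | succ n ih =>
      obtain ⟨x, hx⟩ := ih _ (h n y hn)
      refine ⟨y - x, ?_⟩
      change T' x = T' y - y at hx
      rw [map_sub, hx, sub_sub_cancel]

variable (B : RightSidedBialgebra K C)

/-- The convolution product of algebra endomorphisms of `S(C)`. -/
def conv (φ ψ : SymmetricAlgebra K C →ₐ[K] SymmetricAlgebra K C) :
    SymmetricAlgebra K C →ₐ[K] SymmetricAlgebra K C :=
  (Algebra.TensorProduct.productMap φ ψ).comp B.comul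

variable (K C) in
/-- The unit of the convolution product. -/
def convUnit : SymmetricAlgebra K C →ₐ[K] SymmetricAlgebra K C :=
  (Algebra.ofId K _).comp algebraMapInv

theorem conv_assoc (φ ψ χ : SymmetricAlgebra K C →ₐ[K] SymmetricAlgebra K C) :
    B.conv (B.conv φ ψ) χ = B.conv φ (B.conv ψ χ) := by
  have h1 : (Algebra.TensorProduct.productMap (B.conv φ ψ) χ) =
      (Algebra.TensorProduct.productMap (Algebra.TensorProduct.productMap φ ψ) χ).comp
        (Algebra.TensorProduct.map B.comul (.id K _)) := by
    apply Algebra.TensorProduct.ext'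
    intro a b
    simp [conv]
  have h2 : (Algebra.TensorProduct.productMap φ (B.conv ψ χ)) =
      (Algebra.TensorProduct.productMap φ (Algebra.TensorProduct.productMap ψ χ)).comp
        (Algebra.TensorProduct.map (.id K _) B.comul) := by
    apply Algebra.TensorProduct.ext'
    intro a b
    simp [conv]
  have h3 : Algebra.TensorProduct.productMap (Algebra.TensorProduct.productMap φ ψ) χ =
      (Algebra.TensorProduct.productMap φ (Algebra.TensorProduct.productMap ψ χ)).comp
        (Algebra.TensorProduct.assoc K K K (SymmetricAlgebra K C) (SymmetricAlgebra K C)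
        (SymmetricAlgebra K C)).toAlgHom := by
    ext <;> simp [Algebra.TensorProduct.one_def]
  change (Algebra.TensorProduct.productMap (B.conv φ ψ) χ).comp B.comul =
    (Algebra.TensorProduct.productMap φ (B.conv ψ χ)).comp B.comul
  rw [h1, h2, h3, AlgHom.comp_assoc, AlgHom.comp_assoc, AlgHom.comp_assoc,
    ← B.coassoc]

theorem conv_unit (φ : SymmetricAlgebra K C →ₐ[K] SymmetricAlgebra K C) :
    B.conv φ (convUnit K C) = φ := by
  ext x
  have h1 : ∀ z, Algebra.TensorProduct.productMap φ (convUnit K C) z =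
      φ (contractSnd _ (algebraMapInv : SymmetricAlgebra K C →ₐ[K] K).toLinearMap z) := by
    intro z
    induction z using TensorProduct.induction_on with
    | zero => simp
    | add x y hx hy => simp only [map_add, hx, hy]
    | tmul a b =>
      simp [convUnit, Algebra.ofId_apply, Algebra.algebraMap_eq_smul_one]
  simp [conv, h1, contractSnd_counit_comul]

theorem unit_conv (φ : SymmetricAlgebra K C →ₐ[K] SymmetricAlgebra K C) :
    B.conv (convUnit K C) φ = φ := by
  ext x
  have h1 : ∀ z, Algebra.TensorProduct.productMap (convUnit K C) φ z =
      φ (contractFst _ (algebraMapInv : SymmetricAlgebra K C →ₐ[K] K).toLinearMap z) := by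
    intro z
    induction z using TensorProduct.induction_on with
    | zero => simp
    | add x y hx hy => simp only [map_add, hx, hy]
    | tmul a b =>
      simp [convUnit, Algebra.ofId_apply, Algebra.algebraMap_eq_smul_one]
  simp [conv, h1, contractFst_counit_comul]

/-- The S(C)-linear map T on S(C) ⊗ C extending (φ ⊗ id)ρ is unipotent for the filtration S(C) ⊗
G_n, like a unipotent matrix, hence invertible. If h is the S(C)-linear extension of ψ restricted to
C, the equation to solve is φ(c) + h(T(1 ⊗ c)) = 0. Its solution is h = -ev ∘ T⁻¹ with ev(a ⊗ c) = a
φ(c). -/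
theorem exists_conv_eq_unit [CharZero K] (hB : IsConilpotent B.delta)
    (φ : SymmetricAlgebra K C →ₐ[K] SymmetricAlgebra K C) :
    ∃ ψ, B.conv φ ψ = convUnit K C := by
  let ρ : C →ₗ[K] SymmetricAlgebra K C ⊗[K] C := φ.toLinearMap.rTensor C ∘ₗ B.coaction
  let T : SymmetricAlgebra K C ⊗[K] C →ₗ[SymmetricAlgebra K C] SymmetricAlgebra K C ⊗[K] C :=
    LinearMap.liftBaseChange _ ρ
  have hsmul : ∀ (V : Submodule K C) (a : SymmetricAlgebra K C)
      (z : SymmetricAlgebra K C ⊗[K] C), z ∈ LinearMap.range (V.subtype.lTensor _) →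
      a • z ∈ LinearMap.range (V.subtype.lTensor (SymmetricAlgebra K C)) := by
    rintro V a _ ⟨z, rfl⟩
    refine ⟨a • z, ?_⟩
    induction z using TensorProduct.induction_on with
    | zero => simp
    | add x y hx hy => simp only [smul_add, map_add, hx, hy]
    | tmul b c => simp [TensorProduct.smul_tmul']
  have hφ : ∀ (V : Submodule K C) (z : SymmetricAlgebra K C ⊗[K] C),
      z ∈ LinearMap.range (V.subtype.lTensor _) →
      φ.toLinearMap.rTensor C z ∈ LinearMap.range (V.subtype.lTensor _) := by
    rintro V _ ⟨z, rfl⟩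
    refine ⟨φ.toLinearMap.rTensor V z, ?_⟩
    rw [← LinearMap.comp_apply, ← LinearMap.comp_apply, LinearMap.lTensor_comp_rTensor,
      LinearMap.rTensor_comp_lTensor]
  have hT : Function.Bijective T := by
    refine bijective_of_unipotent (K := K) (fun x y => map_add T x y)
      (fun n => LinearMap.range ((leftFiltration B.delta n).subtype.lTensor _)) ?_ ?_ ?_
    · rw [eq_bot_iff]
      intro x hx
      rw [mem_range_lTensor_subtype_iff] at hx
      exact eq_of_contractFst_eq fun g => by rw [map_zero]; exact hx g
    · intro x
      induction x using TensorProduct.induction_on with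
      | zero => exact ⟨0, Submodule.zero_mem _⟩
      | tmul a c =>
        obtain ⟨n, hn⟩ := hB c
        exact ⟨n, tmul_mem_range_lTensor_subtype _ hn⟩
      | add x y hx hy =>
        obtain ⟨n, hn⟩ := hx
        obtain ⟨m, hm⟩ := hy
        exact ⟨max n m, Submodule.add_mem _
          (range_lTensor_subtype_mono (leftFiltration_mono _ (le_max_left n m)) hn)
          (range_lTensor_subtype_mono (leftFiltration_mono _ (le_max_right n m)) hm)⟩
    · rintro n _ ⟨z, rfl⟩
      induction z using TensorProduct.induction_on with
      | zero => simp
      | add x y hx hy =>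
        rw [map_add, map_add, add_sub_add_comm]
        exact Submodule.add_mem _ hx hy
      | tmul a c =>
        have h1 : T ((leftFiltration B.delta (n + 1)).subtype.lTensor _ (a ⊗ₜ c)) -
            (leftFiltration B.delta (n + 1)).subtype.lTensor _ (a ⊗ₜ c) =
            a • φ.toLinearMap.rTensor C (B.coaction c - 1 ⊗ₜ (c : C)) := by
          simp [T, ρ, smul_sub, TensorProduct.smul_tmul']
        rw [h1]
        exact hsmul _ _ _ (hφ _ _ ((B.coaction_sub_mem n).2 c c.2))
  let T' := LinearEquiv.ofBijective T hT
  let ev : SymmetricAlgebra K C ⊗[K] C →ₗ[SymmetricAlgebra K C] SymmetricAlgebra K C :=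
    LinearMap.liftBaseChange _ (φ.toLinearMap ∘ₗ ι K C)
  let h : SymmetricAlgebra K C ⊗[K] C →ₗ[SymmetricAlgebra K C] SymmetricAlgebra K C :=
    -(ev ∘ₗ T'.symm.toLinearMap)
  let ψ : SymmetricAlgebra K C →ₐ[K] SymmetricAlgebra K C :=
    SymmetricAlgebra.lift (h.restrictScalars K ∘ₗ TensorProduct.mk K _ _ 1)
  refine ⟨ψ, symmetricAlgebra_algHom_ext fun c => ?_⟩
  have h1 : ∀ z : SymmetricAlgebra K C ⊗[K] C,
      Algebra.TensorProduct.productMap φ ψ ((ι K C).lTensor _ z) =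
        h (φ.toLinearMap.rTensor C z) := by
    intro z
    induction z using TensorProduct.induction_on with
    | zero => simp
    | add x y hx hy => simp only [map_add, hx, hy]
    | tmul a c =>
      have : φ a ⊗ₜ[K] c = φ a • ((1 : SymmetricAlgebra K C) ⊗ₜ[K] c) := by
        simp [TensorProduct.smul_tmul']
      simp only [LinearMap.lTensor_tmul, Algebra.TensorProduct.productMap_apply_tmul,
        LinearMap.rTensor_tmul, AlgHom.toLinearMap_apply, this, map_smul, smul_eq_mul]
      simp [ψ]
  have h2 : h (φ.toLinearMap.rTensor C (B.coaction c)) = - φ (ι K C c) := by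
    have : φ.toLinearMap.rTensor C (B.coaction c) = T' (1 ⊗ₜ c) := by
      simp [T', T, ρ]
    rw [this]
    simp [h, ev]
  simp only [conv, AlgHom.comp_apply, comul_ι, map_add, h1, h2]
  simp [convUnit, algebraMapInv_ι]

theorem exists_antipode [CharZero K] (hB : IsConilpotent B.delta) :
    ∃ S : SymmetricAlgebra K C →ₗ[K] SymmetricAlgebra K C,
    LinearMap.mul' K (SymmetricAlgebra K C) ∘ₗ S.rTensor (SymmetricAlgebra K C) ∘ₗ
        B.comul.toLinearMap =
      Algebra.linearMap K (SymmetricAlgebra K C) ∘ₗ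
        SymmetricAlgebra.algebraMapInv.toLinearMap ∧
    LinearMap.mul' K (SymmetricAlgebra K C) ∘ₗ S.lTensor (SymmetricAlgebra K C) ∘ₗ
        B.comul.toLinearMap =
      Algebra.linearMap K (SymmetricAlgebra K C) ∘ₗ
        SymmetricAlgebra.algebraMapInv.toLinearMap := by
  obtain ⟨S, hS⟩ := B.exists_conv_eq_unit hB (.id K _)
  obtain ⟨S', hS'⟩ := B.exists_conv_eq_unit hB S
  -- A right inverse S' of a right inverse S of the identity is the identity, so S is a two-sided
  -- inverse.
  have h1 : S' = .id K _ := by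
    rw [← B.unit_conv S', ← hS, conv_assoc, hS', conv_unit]
  rw [h1] at hS'
  have h2 : ∀ z : SymmetricAlgebra K C ⊗[K] SymmetricAlgebra K C,
      LinearMap.mul' K _ (S.toLinearMap.rTensor _ z) =
        Algebra.TensorProduct.productMap S (.id K _) z := by
    intro z
    induction z using TensorProduct.induction_on with
    | zero => simp
    | add x y hx hy => simp only [map_add, hx, hy]
    | tmul a b => simp
  have h3 : ∀ z : SymmetricAlgebra K C ⊗[K] SymmetricAlgebra K C,
      LinearMap.mul' K _ (S.toLinearMap.lTensor _ z) =
        Algebra.TensorProduct.productMap (.id K _) S z := by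
    intro z
    induction z using TensorProduct.induction_on with
    | zero => simp
    | add x y hx hy => simp only [map_add, hx, hy]
    | tmul a b => simp
  refine ⟨S.toLinearMap, LinearMap.ext fun x => ?_, LinearMap.ext fun x => ?_⟩
  · simp only [LinearMap.comp_apply, h2, AlgHom.toLinearMap_apply]
    exact congrArg (fun f => f x) hS'
  · simp only [LinearMap.comp_apply, h3, AlgHom.toLinearMap_apply]
    exact congrArg (fun f => f x) hS

/-- A right-sided bialgebra with conilpotent cooperation is a right-sided Hopf algebra. -/
def toRightSidedHopf [CharZero K] (hB : IsConilpotent B.delta) : RightSidedHopf K C where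
  comul := B.comul
  coassoc := B.coassoc
  rTensor_counit := B.rTensor_counit
  lTensor_counit := B.lTensor_counit
  exists_antipode := B.exists_antipode hB
  right_sided := B.right_sided

end RightSidedBialgebra

/-! ## Right-sided bialgebras from coactions -/

namespace RightSidedBialgebra

open SymmetricAlgebra

variable {K : Type*} [Field K] {C : Type*} [AddCommGroup C] [Module K C]

theorem rTensor_lTensor_apply {M N P Q : Type*} [AddCommGroup M] [Module K M] [AddCommGroup N]
    [Module K N] [AddCommGroup P] [Module K P] [AddCommGroup Q] [Module K Q] (a : M →ₗ[K] P)
    (b : N →ₗ[K] Q) (z : M ⊗[K] N) :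
    a.rTensor Q (b.lTensor M z) = b.lTensor P (a.rTensor N z) := by
  rw [← LinearMap.comp_apply, ← LinearMap.comp_apply, LinearMap.rTensor_comp_lTensor,
    LinearMap.lTensor_comp_rTensor]

/-- The algebra morphism `S(C) → S(C) ⊗ S(C)` with `c ↦ c ⊗ 1 + ρ(c)`. -/
def comulOfCoaction (ρ : C →ₗ[K] SymmetricAlgebra K C ⊗[K] C) :
    SymmetricAlgebra K C →ₐ[K] SymmetricAlgebra K C ⊗[K] SymmetricAlgebra K C :=
  SymmetricAlgebra.lift ((TensorProduct.mk K _ _).flip 1 ∘ₗ ι K C + (ι K C).lTensor _ ∘ₗ ρ)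

theorem comulOfCoaction_ι (ρ : C →ₗ[K] SymmetricAlgebra K C ⊗[K] C) (c : C) :
    comulOfCoaction ρ (ι K C c) = ι K C c ⊗ₜ 1 + (ι K C).lTensor _ (ρ c) := by
  simp [comulOfCoaction]

section

variable {δ : C →ₗ[K] C ⊗[K] C} {ρ : C →ₗ[K] SymmetricAlgebra K C ⊗[K] C}

/-- Both sides satisfy the Leibniz rule along the coproduct, so the compatibility of ρ on C
suffices. -/
theorem comulOfCoaction_affineDer
    (hD : ∀ f c, (affineDer f (rightContraction δ f)).toLinearMap.rTensor _ (ρ c) =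
      ρ (rightContraction δ f c)) (f : C →ₗ[K] K) (x : SymmetricAlgebra K C) :
    comulOfCoaction ρ (affineDer f (rightContraction δ f) x) =
      (affineDer f (rightContraction δ f)).toLinearMap.rTensor _ (comulOfCoaction ρ x) := by
  have h1 := symmetricAlgebra_leibniz_ext (comulOfCoaction ρ)
    (d := (comulOfCoaction ρ).toLinearMap ∘ₗ (affineDer f (rightContraction δ f)).toLinearMap)
    (e := (affineDer f (rightContraction δ f)).toLinearMap.rTensor _ ∘ₗ
      (comulOfCoaction ρ).toLinearMap)
    (by intro x y; simp)
    (by intro x y; simpa using Derivation.rTensor_mul (affineDer f (rightContraction δ f)) _ _)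
    (by
      intro c
      have h2 : (affineDer f (rightContraction δ f)).toLinearMap.rTensor _
          ((ι K C).lTensor _ (ρ c)) = (ι K C).lTensor _ (ρ (rightContraction δ f c)) := by
        rw [← hD, rTensor_lTensor_apply]
      simp only [LinearMap.comp_apply, AlgHom.toLinearMap_apply, comulOfCoaction_ι, map_add, h2,
        LinearMap.rTensor_tmul, Derivation.coeFn_coe, affineDer_ι, AlgHom.commutes,
        TensorProduct.add_tmul, Algebra.TensorProduct.algebraMap_apply, add_assoc])
  exact congrArg (fun g => g x) h1

theorem contractFst_counit_comulOfCoaction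
    (hε : ∀ c, contractFst _ (algebraMapInv : SymmetricAlgebra K C →ₐ[K] K).toLinearMap (ρ c) = c) :
    (Algebra.TensorProduct.map algebraMapInv (.id K (SymmetricAlgebra K C))).comp
      (comulOfCoaction ρ) = (Algebra.TensorProduct.lid K (SymmetricAlgebra K C)).symm := by
  have h1 : ∀ z : SymmetricAlgebra K C ⊗[K] SymmetricAlgebra K C,
      Algebra.TensorProduct.map algebraMapInv (.id K (SymmetricAlgebra K C)) z =
      1 ⊗ₜ contractFst _ (algebraMapInv : SymmetricAlgebra K C →ₐ[K] K).toLinearMap z := by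
    intro z
    induction z using TensorProduct.induction_on with
    | zero => simp
    | add x y hx hy => rw [map_add, hx, hy, map_add, TensorProduct.tmul_add]
    | tmul a b => simp [TensorProduct.smul_tmul']
  refine symmetricAlgebra_algHom_ext fun c => ?_
  rw [AlgHom.comp_apply, h1, comulOfCoaction_ι, map_add, contractFst_lTensor, hε]
  simp [algebraMapInv_ι]

theorem contractSnd_counit_comulOfCoaction :
    (Algebra.TensorProduct.map (.id K (SymmetricAlgebra K C)) algebraMapInv).comp
      (comulOfCoaction ρ) = (Algebra.TensorProduct.rid K K (SymmetricAlgebra K C)).symm := by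
  have h1 : ∀ z : SymmetricAlgebra K C ⊗[K] SymmetricAlgebra K C,
      Algebra.TensorProduct.map (.id K (SymmetricAlgebra K C)) algebraMapInv z =
      contractSnd _ (algebraMapInv : SymmetricAlgebra K C →ₐ[K] K).toLinearMap z ⊗ₜ 1 := by
    intro z
    induction z using TensorProduct.induction_on with
    | zero => simp
    | add x y hx hy => rw [map_add, hx, hy, map_add, TensorProduct.add_tmul]
    | tmul a b => simp [TensorProduct.smul_tmul]
  have h2 : (algebraMapInv : SymmetricAlgebra K C →ₐ[K] K).toLinearMap ∘ₗ ι K C = 0 :=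
    LinearMap.ext fun c => algebraMapInv_ι c
  refine symmetricAlgebra_algHom_ext fun c => ?_
  rw [AlgHom.comp_apply, h1, comulOfCoaction_ι, map_add, contractSnd_lTensor, h2]
  simp [contractSnd]

/-- Both sides of coassociativity intertwine D_f with D_f on the first factor, and both contract to
Δ(c) under the counit there. Hence they agree on C by induction along G. -/
theorem comulOfCoaction_coassoc [CharZero K]
    (hε : ∀ c, contractFst _ (algebraMapInv : SymmetricAlgebra K C →ₐ[K] K).toLinearMap (ρ c) = c)
    (hD : ∀ f c, (affineDer f (rightContraction δ f)).toLinearMap.rTensor _ (ρ c) =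
      ρ (rightContraction δ f c)) (hδ : IsConilpotent δ) :
    (Algebra.TensorProduct.assoc K K K (SymmetricAlgebra K C) (SymmetricAlgebra K C)
        (SymmetricAlgebra K C)).toAlgHom.comp
      ((Algebra.TensorProduct.map (comulOfCoaction ρ) (.id K (SymmetricAlgebra K C))).comp
        (comulOfCoaction ρ)) =
    (Algebra.TensorProduct.map (.id K (SymmetricAlgebra K C)) (comulOfCoaction ρ)).comp
      (comulOfCoaction ρ) := by
  set Δ := comulOfCoaction ρ with hΔ
  have hcounit : ∀ x, contractFst _ (algebraMapInv : SymmetricAlgebra K C →ₐ[K] K).toLinearMap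
      (Δ x) = x := by
    intro x
    have h1 := congrArg (fun f => f x) (contractFst_counit_comulOfCoaction hε)
    have h2 := congrArg (TensorProduct.lid K (SymmetricAlgebra K C)) h1
    simp only [AlgHom.comp_apply] at h2
    have h3 : TensorProduct.lid K (SymmetricAlgebra K C) (Algebra.TensorProduct.map algebraMapInv
        (AlgHom.id K (SymmetricAlgebra K C)) (Δ x)) = x := by simpa using h2
    exact h3
  have hassoc : ∀ (D : SymmetricAlgebra K C →ₗ[K] SymmetricAlgebra K C),
      (∀ x, Δ (D x) = D.rTensor _ (Δ x)) → ∀ z,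
      D.rTensor _ (TensorProduct.assoc K (SymmetricAlgebra K C) (SymmetricAlgebra K C)
        (SymmetricAlgebra K C) (Δ.toLinearMap.rTensor _ z)) =
      TensorProduct.assoc K (SymmetricAlgebra K C) (SymmetricAlgebra K C)
        (SymmetricAlgebra K C) (Δ.toLinearMap.rTensor _ (D.rTensor _ z)) := by
    intro D hD z
    induction z using TensorProduct.induction_on with
    | zero => simp
    | add x y hx hy => simp only [map_add, hx, hy]
    | tmul a b =>
      rw [LinearMap.rTensor_tmul, LinearMap.rTensor_tmul, LinearMap.rTensor_tmul,
        AlgHom.toLinearMap_apply, AlgHom.toLinearMap_apply, hD]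
      induction Δ a using TensorProduct.induction_on with
      | zero => simp
      | add x y hx hy => simp only [TensorProduct.add_tmul, map_add, hx, hy]
      | tmul a b => simp
  have hcontr : ∀ z, contractFst _ (algebraMapInv : SymmetricAlgebra K C →ₐ[K] K).toLinearMap
      (TensorProduct.assoc K (SymmetricAlgebra K C) (SymmetricAlgebra K C)
        (SymmetricAlgebra K C) (Δ.toLinearMap.rTensor _ z)) = z := by
    intro z
    induction z using TensorProduct.induction_on with
    | zero => simp
    | add x y hx hy => simp only [map_add, hx, hy]
    | tmul a b =>
      rw [LinearMap.rTensor_tmul, AlgHom.toLinearMap_apply]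
      nth_rewrite 2 [← hcounit a]
      induction Δ a using TensorProduct.induction_on with
      | zero => simp
      | add x y hx hy => simp only [TensorProduct.add_tmul, map_add, hx, hy]
      | tmul a b => simp [TensorProduct.smul_tmul']
  have key : ∀ n, ∀ c ∈ leftFiltration δ n,
      TensorProduct.assoc K (SymmetricAlgebra K C) (SymmetricAlgebra K C)
        (SymmetricAlgebra K C) (Δ.toLinearMap.rTensor _ (Δ (ι K C c))) =
      Δ.toLinearMap.lTensor _ (Δ (ι K C c)) := by
    intro n
    induction n with
    | zero =>
      intro c hc
      rw [show c = 0 from hc]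
      simp
    | succ n ih =>
      intro c hc
      rw [mem_leftFiltration_succ] at hc
      refine eq_of_rTensor_affineDer_eq (rightContraction δ) (fun f => ?_) ?_
      · have hDf := comulOfCoaction_affineDer hD f
        have h2 : ∀ z, (affineDer f (rightContraction δ f)).toLinearMap.rTensor _
            (Δ.toLinearMap.lTensor _ z) = Δ.toLinearMap.lTensor _
              ((affineDer f (rightContraction δ f)).toLinearMap.rTensor _ z) := by
          exact fun z => rTensor_lTensor_apply _ _ z
        rw [hassoc _ hDf, h2, ← hDf, affineDer_ι]
        simp only [map_add, ih _ (hc f), ← hΔ, AlgHom.commutes]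
        simp [Algebra.TensorProduct.one_def,
          Algebra.algebraMap_eq_smul_one, TensorProduct.smul_tmul']
      · rw [hcontr, contractFst_lTensor, hcounit, AlgHom.toLinearMap_apply]
  apply symmetricAlgebra_algHom_ext
  intro c
  obtain ⟨n, hn⟩ := hδ c
  exact key n c hn

/-- The right-sided bialgebra defined by a coaction that is compatible with a conilpotent
cooperation. -/
def ofCoaction [CharZero K]
    (hε : ∀ c, contractFst _ (algebraMapInv : SymmetricAlgebra K C →ₐ[K] K).toLinearMap (ρ c) = c)
    (hD : ∀ f c, (affineDer f (rightContraction δ f)).toLinearMap.rTensor _ (ρ c) =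
      ρ (rightContraction δ f c)) (hδ : IsConilpotent δ) : RightSidedBialgebra K C where
  comul := comulOfCoaction ρ
  coassoc := comulOfCoaction_coassoc hε hD hδ
  rTensor_counit := contractFst_counit_comulOfCoaction hε
  lTensor_counit := contractSnd_counit_comulOfCoaction
  right_sided c := ⟨ρ c - 1 ⊗ₜ c, by
    rw [comulOfCoaction_ι, map_sub, LinearMap.lTensor_tmul]
    abel⟩

theorem coaction_ofCoaction [CharZero K]
    (hε : ∀ c, contractFst _ (algebraMapInv : SymmetricAlgebra K C →ₐ[K] K).toLinearMap (ρ c) = c)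
    (hD : ∀ f c, (affineDer f (rightContraction δ f)).toLinearMap.rTensor _ (ρ c) =
      ρ (rightContraction δ f c)) (hδ : IsConilpotent δ) :
    (ofCoaction hε hD hδ).coaction = ρ := by
  refine LinearMap.ext fun c => ?_
  have h : symProj K ∘ₗ ι K C = LinearMap.id := LinearMap.ext fun c => symProj_ι K c
  change (symProj K).lTensor _ (comulOfCoaction ρ (ι K C c)) = ρ c
  rw [comulOfCoaction_ι, map_add, ← LinearMap.comp_apply ((symProj K).lTensor _),
    ← LinearMap.lTensor_comp, h]
  simp [symProj_one]

/-- Since f ∘ π = ε ∘ D_f, contracting ρ(c) with f ∘ π gives the counit part of (D_f ⊗ id)ρ(c) =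
ρ(R_f c), which is R_f c. -/
theorem delta_ofCoaction [CharZero K]
    (hε : ∀ c, contractFst _ (algebraMapInv : SymmetricAlgebra K C →ₐ[K] K).toLinearMap (ρ c) = c)
    (hD : ∀ f c, (affineDer f (rightContraction δ f)).toLinearMap.rTensor _ (ρ c) =
      ρ (rightContraction δ f c)) (hδ : IsConilpotent δ) :
    (ofCoaction hε hD hδ).delta = δ := by
  refine LinearMap.ext fun c => eq_of_contractSnd_eq fun f => ?_
  rw [← rightContraction_apply, rightContraction_delta, coaction_ofCoaction,
    ← algebraMapInv_affineDer f (rightContraction δ f), ← contractFst_rTensor, hD, hε,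
    rightContraction_apply]

end

end RightSidedBialgebra

/-! ## The coaction of a pre-Lie cooperation, degree by degree -/

section PreLieCoaction

open SymmetricAlgebra

variable {K : Type*} [Field K] {C : Type*} [AddCommGroup C] [Module K C]

theorem symPartial_symMulι (f : C →ₗ[K] K) (z : SymmetricAlgebra K C ⊗[K] C) :
    symPartial f (symMulι K C z) =
      contractSnd _ f z + symMulι K C ((symPartial f).toLinearMap.rTensor C z) := by
  induction z using TensorProduct.induction_on with
  | zero => simp
  | add x y hx hy => simp only [map_add, hx, hy]; abel
  | tmul a c => simp [Algebra.algebraMap_eq_smul_one, mul_comm]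

/-- The Poincaré lemma for closed one-forms on `S(C)`. -/
theorem symPartial_symMulι_of_closed {z : SymmetricAlgebra K C ⊗[K] C} {n : ℕ}
    (hn : ∀ f, symEuler K C (contractSnd _ f z) = (n : K) • contractSnd _ f z)
    (hz : ∀ f h, symPartial h (contractSnd _ f z) = symPartial f (contractSnd _ h z))
    (f : C →ₗ[K] K) :
    symPartial f (symMulι K C z) = ((n + 1 : ℕ) : K) • contractSnd _ f z := by
  -- Closedness says that ∂_f z is the differential of the contraction z_f. Multiplying out, ∂_f of
  -- the product is z_f plus the Euler derivation of z_f, that is (n + 1) z_f.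
  have h1 : (symPartial f).toLinearMap.rTensor C z = symDiff K C (contractSnd _ f z) := by
    refine eq_of_contractSnd_eq fun h => ?_
    rw [contractSnd_rTensor, contractSnd_symDiff, hz]
    rfl
  rw [symPartial_symMulι, h1, symMulι_symDiff, hn, Nat.cast_succ, add_smul, one_smul, add_comm]

theorem symEuler_symMulι_of_symPartial {z : SymmetricAlgebra K C ⊗[K] C}
    {x : SymmetricAlgebra K C} (h : ∀ f, symPartial f x = contractSnd _ f z) :
    symEuler K C x = symMulι K C z := by
  rw [← symMulι_symDiff]
  congr 1
  exact eq_of_contractSnd_eq fun f => by rw [contractSnd_symDiff, h]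

theorem symPartial_comm (f h : C →ₗ[K] K) (x : SymmetricAlgebra K C) :
    symPartial f (symPartial h x) = symPartial h (symPartial f x) := by
  have h1 : ⁅symPartial f, symPartial h⁆ = 0 := by
    refine symmetricAlgebra_derivation_ext fun c => ?_
    simp [Derivation.commutator_apply]
  have h2 := congrArg (fun d => d x) h1
  simpa [Derivation.commutator_apply, sub_eq_zero] using h2

theorem symPartial_symLinDer (f : C →ₗ[K] K) (A : C →ₗ[K] C) (x : SymmetricAlgebra K C) :
    symPartial f (symLinDer A x) = symLinDer A (symPartial f x) + symPartial (f ∘ₗ A) x := by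
  have h1 : ⁅symPartial f, symLinDer A⁆ = symPartial (f ∘ₗ A) := by
    refine symmetricAlgebra_derivation_ext fun c => ?_
    simp [Derivation.commutator_apply]
  rw [← h1, Derivation.commutator_apply]
  abel

theorem symLinDer_symLinDer {A B A' B' : C →ₗ[K] C} (h : ∀ c, A (B c) + B' c = B (A c) + A' c)
    (x : SymmetricAlgebra K C) :
    symLinDer A (symLinDer B x) + symLinDer B' x =
      symLinDer B (symLinDer A x) + symLinDer A' x := by
  have h1 : ⁅symLinDer A, symLinDer B⁆ + symLinDer B' = symLinDer A' := by
    refine symmetricAlgebra_derivation_ext fun c => ?_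
    simp only [Derivation.add_apply, Derivation.commutator_apply, symLinDer_ι, ← map_sub,
      ← map_add]
    rw [sub_add_eq_add_sub, h, add_sub_cancel_left]
  have h2 := congrArg (fun d => d x) h1
  simp only [Derivation.add_apply, Derivation.commutator_apply] at h2
  rw [← h2]
  abel

theorem symEuler_symLinDer (A : C →ₗ[K] C) (x : SymmetricAlgebra K C) :
    symEuler K C (symLinDer A x) = symLinDer A (symEuler K C x) := by
  have := symLinDer_symLinDer (A := LinearMap.id) (B := A) (A' := 0) (B' := 0) (by simp) x
  simpa [symEuler, symLinDer, symDer] using this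

theorem symEuler_algebraMapInv (x : SymmetricAlgebra K C) :
    algebraMapInv (symEuler K C x) = (0 : K) := by
  have h1 := symmetricAlgebra_leibniz_ext (algebraMapInv : SymmetricAlgebra K C →ₐ[K] K)
    (d := (algebraMapInv : SymmetricAlgebra K C →ₐ[K] K).toLinearMap ∘ₗ
      (symEuler K C).toLinearMap) (e := 0)
    (by intro x y; simp) (by intro x y; simp) (by intro c; simp [algebraMapInv_ι])
  exact congrArg (fun f => f x) h1

variable (δ : C →ₗ[K] C ⊗[K] C)

/-- The derivation `S(C) → S(C) ⊗ C` extending `δ`. -/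
def preLieDiff : Derivation K (SymmetricAlgebra K C) (SymmetricAlgebra K C ⊗[K] C) :=
  symDer ((ι K C).rTensor C ∘ₗ δ)

theorem contractSnd_preLieDiff (f : C →ₗ[K] K) (x : SymmetricAlgebra K C) :
    contractSnd _ f (preLieDiff δ x) = symLinDer (rightContraction δ f) x := by
  have h1 := symmetricAlgebra_leibniz_ext (AlgHom.id K (SymmetricAlgebra K C))
    (d := contractSnd _ f ∘ₗ (preLieDiff δ).toLinearMap)
    (e := (symLinDer (rightContraction δ f)).toLinearMap)
    (by intro x y; simp [contractSnd_smul_left]) (by intro x y; simp)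
    (by
      intro c
      simp [preLieDiff, contractSnd_rTensor, rightContraction_apply])
  exact congrArg (fun f => f x) h1

/-- One step of the recursion for the components of the coaction, with values contracted by a
linear form. -/
def coactionForm (a : C →ₗ[K] SymmetricAlgebra K C) : C →ₗ[K] SymmetricAlgebra K C ⊗[K] C :=
  a.rTensor C ∘ₗ δ - (preLieDiff δ).toLinearMap ∘ₗ a

theorem contractSnd_coactionForm (a : C →ₗ[K] SymmetricAlgebra K C) (f : C →ₗ[K] K) (c : C) :
    contractSnd _ f (coactionForm δ a c) =
      a (rightContraction δ f c) - symLinDer (rightContraction δ f) (a c) := by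
  rw [coactionForm, LinearMap.sub_apply, map_sub, LinearMap.comp_apply, contractSnd_rTensor,
    LinearMap.comp_apply, ← contractSnd_preLieDiff]
  rfl

/-- The degree `n` component of the coaction, contracted by a linear form on `C`. -/
def coactionCoeff (l : C →ₗ[K] K) : ℕ → C →ₗ[K] SymmetricAlgebra K C
  | 0 => Algebra.linearMap K _ ∘ₗ l
  | n + 1 => ((n + 1 : ℕ) : K)⁻¹ • symMulι K C ∘ₗ coactionForm δ (coactionCoeff l n)

/-- The degree `n` component of the coaction attached to a pre-Lie cooperation. -/
def coactionDegree : ℕ → C →ₗ[K] SymmetricAlgebra K C ⊗[K] C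
  | 0 => TensorProduct.mk K _ _ 1
  | n + 1 => ((n + 1 : ℕ) : K)⁻¹ •
      ((symMulι K C).rTensor C ∘ₗ (TensorProduct.rightComm K _ C C).toLinearMap ∘ₗ
          (coactionDegree n).rTensor C ∘ₗ δ -
        (symMulι K C ∘ₗ (preLieDiff δ).toLinearMap).rTensor C ∘ₗ coactionDegree n)

theorem contractSnd_coactionDegree (l : C →ₗ[K] K) (n : ℕ) (c : C) :
    contractSnd _ l (coactionDegree δ n c) = coactionCoeff δ l n c := by
  induction n generalizing c with
  | zero => simp [coactionDegree, coactionCoeff, Algebra.algebraMap_eq_smul_one]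
  | succ n ih =>
    have h1 : ∀ z : C ⊗[K] C, contractSnd _ l ((symMulι K C).rTensor C
        (TensorProduct.rightComm K _ C C ((coactionDegree δ n).rTensor C z))) =
        symMulι K C ((coactionCoeff δ l n).rTensor C z) := by
      intro z
      induction z using TensorProduct.induction_on with
      | zero => simp
      | add x y hx hy => simp only [map_add, hx, hy]
      | tmul r p =>
        rw [LinearMap.rTensor_tmul, LinearMap.rTensor_tmul, ← ih, contractSnd_rTensor]
        induction coactionDegree δ n r using TensorProduct.induction_on with
        | zero => simp
        | add x y hx hy => simp only [TensorProduct.add_tmul, map_add, hx, hy]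
        | tmul a b => simp
    simp only [coactionDegree, coactionCoeff, coactionForm, LinearMap.smul_apply,
      LinearMap.sub_apply, LinearMap.comp_apply, map_smul, map_sub, LinearEquiv.coe_coe, h1,
      contractSnd_rTensor, ih]

variable {δ}

/-- The two claims need each other. The Poincaré lemma uses homogeneity in degree n and closedness
of `coactionForm`; closedness in the next degree follows from the recursion in the previous one and
the pre-Lie identity; homogeneity of the next term follows from Euler's formula. -/
theorem symEuler_coactionCoeff_and_symPartial [CharZero K] (hδ : IsPreLieCooperation δ)
    (l : C →ₗ[K] K) (n : ℕ) :
    (∀ c, symEuler K C (coactionCoeff δ l n c) = (n : K) • coactionCoeff δ l n c) ∧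
    ∀ f c, symPartial f (coactionCoeff δ l (n + 1) c) =
      coactionCoeff δ l n (rightContraction δ f c) -
        symLinDer (rightContraction δ f) (coactionCoeff δ l n c) := by
  rw [isPreLieCooperation_iff] at hδ
  have step : ∀ n, (∀ c, symEuler K C (coactionCoeff δ l n c) = (n : K) • coactionCoeff δ l n c) →
      (∀ f h c, symPartial h (contractSnd _ f (coactionForm δ (coactionCoeff δ l n) c)) =
        symPartial f (contractSnd _ h (coactionForm δ (coactionCoeff δ l n) c))) →
      ∀ f c, symPartial f (coactionCoeff δ l (n + 1) c) =
        contractSnd _ f (coactionForm δ (coactionCoeff δ l n) c) := by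
    intro n hn hclosed f c
    rw [coactionCoeff, LinearMap.smul_apply, LinearMap.comp_apply, Derivation.map_smul,
      symPartial_symMulι_of_closed (n := n) _ (fun f h => hclosed f h c), smul_smul,
      inv_mul_cancel₀ (Nat.cast_ne_zero.2 n.succ_ne_zero), one_smul]
    intro f
    rw [contractSnd_coactionForm, map_sub, symEuler_symLinDer, hn, hn, Derivation.map_smul, smul_sub]
  induction n with
  | zero =>
    have h0 : ∀ c, symEuler K C (coactionCoeff δ l 0 c) = ((0 : ℕ) : K) • coactionCoeff δ l 0 c := by
      intro c
      simp [coactionCoeff]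
    refine ⟨h0, fun f c => ?_⟩
    rw [step 0 h0 _ f c, contractSnd_coactionForm]
    intro f h c
    simp [contractSnd_coactionForm, coactionCoeff]
  | succ n ih =>
    obtain ⟨ih1, ih2⟩ := ih
    have h1 : ∀ c, symEuler K C (coactionCoeff δ l (n + 1) c) =
        ((n + 1 : ℕ) : K) • coactionCoeff δ l (n + 1) c := by
      intro c
      rw [symEuler_symMulι_of_symPartial (z := coactionForm δ (coactionCoeff δ l n) c)
        fun f => by rw [ih2, contractSnd_coactionForm], coactionCoeff, LinearMap.smul_apply,
        smul_smul, mul_inv_cancel₀ (Nat.cast_ne_zero.2 n.succ_ne_zero), one_smul]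
      rfl
    refine ⟨h1, fun f c => ?_⟩
    rw [step (n + 1) h1 _ f c, contractSnd_coactionForm]
    intro f h c
    have e1 := symLinDer_symLinDer (A := rightContraction δ f) (B := rightContraction δ h)
      (A' := rightContraction δ (f ∘ₗ rightContraction δ h))
      (B' := rightContraction δ (h ∘ₗ rightContraction δ f))
      (fun c => by
        have := hδ f h c
        rw [sub_eq_sub_iff_add_eq_add] at this
        rw [← this])
      (coactionCoeff δ l n c)
    have e2 := congrArg (coactionCoeff δ l n) (hδ f h c)
    rw [map_sub, map_sub] at e2
    simp only [contractSnd_coactionForm, map_sub, symPartial_symLinDer, ih2]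
    -- The mixed terms R_h a(R_f c) and R_f a(R_h c) are symmetric. What remains is the pre-Lie
    -- identity twice: acting on the value a(c), and inside the argument of a.
    linear_combination e1 + e2

theorem symEuler_coactionCoeff [CharZero K] (hδ : IsPreLieCooperation δ) (l : C →ₗ[K] K) (n : ℕ)
    (c : C) : symEuler K C (coactionCoeff δ l n c) = (n : K) • coactionCoeff δ l n c :=
  (symEuler_coactionCoeff_and_symPartial hδ l n).1 c

theorem symPartial_coactionCoeff [CharZero K] (hδ : IsPreLieCooperation δ) (l : C →ₗ[K] K)
    (n : ℕ) (f : C →ₗ[K] K) (c : C) :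
    symPartial f (coactionCoeff δ l (n + 1) c) =
      coactionCoeff δ l n (rightContraction δ f c) -
        symLinDer (rightContraction δ f) (coactionCoeff δ l n c) :=
  (symEuler_coactionCoeff_and_symPartial hδ l n).2 f c

/-- The sum telescopes: in ∂_f of the degree i + 1 term, the part -R_f of the degree i term cancels
the linear part of D_f. Only the top degree leaves a boundary term. -/
theorem affineDer_sum_coactionCoeff [CharZero K] (hδ : IsPreLieCooperation δ) (l : C →ₗ[K] K)
    (n : ℕ) (f : C →ₗ[K] K) (c : C) :
    affineDer f (rightContraction δ f) (∑ i ∈ Finset.range (n + 1), coactionCoeff δ l i c) =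
      ∑ i ∈ Finset.range n, coactionCoeff δ l i (rightContraction δ f c) +
        symLinDer (rightContraction δ f) (coactionCoeff δ l n c) := by
  induction n with
  | zero => simp [coactionCoeff]
  | succ n ih =>
    rw [Finset.sum_range_succ, map_add, ih, affineDer_apply, symPartial_coactionCoeff hδ,
      Finset.sum_range_succ]
    abel

theorem algebraMapInv_coactionCoeff_succ [CharZero K] (hδ : IsPreLieCooperation δ) (l : C →ₗ[K] K)
    (n : ℕ) (c : C) : algebraMapInv (coactionCoeff δ l (n + 1) c) = (0 : K) := by
  have h := symEuler_algebraMapInv (coactionCoeff δ l (n + 1) c)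
  rw [symEuler_coactionCoeff hδ, map_smul, smul_eq_mul] at h
  exact (mul_eq_zero.1 h).resolve_left (Nat.cast_ne_zero.2 n.succ_ne_zero)

/-- Components of the coaction of an element are polynomials in the factors of its
coproduct. -/
theorem coactionCoeff_mem_adjoin {U W : Submodule K C} (hUW : U ≤ W)
    (hW : ∀ c ∈ W, δ c ∈ LinearMap.range (TensorProduct.map U.subtype U.subtype))
    (l : C →ₗ[K] K) (n : ℕ) :
    ∀ c ∈ W, coactionCoeff δ l n c ∈ Algebra.adjoin K (ι K C '' U) := by
  set A := Algebra.adjoin K (ι K C '' U) with hA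
  have hUA : ∀ u ∈ U, ι K C u ∈ A := fun u hu => Algebra.subset_adjoin ⟨u, hu, rfl⟩
  have hmul : ∀ a : C →ₗ[K] SymmetricAlgebra K C, (∀ u ∈ U, a u ∈ A) →
      ∀ z ∈ LinearMap.range (TensorProduct.map U.subtype U.subtype),
      symMulι K C (a.rTensor C z) ∈ A := by
    rintro a ha _ ⟨z, rfl⟩
    induction z using TensorProduct.induction_on with
    | zero => simp
    | add x y hx hy => rw [map_add, map_add, map_add]; exact A.add_mem hx hy
    | tmul r p => simpa using A.mul_mem (ha r r.2) (hUA p p.2)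
  have hdiff : ∀ x ∈ A, symMulι K C (preLieDiff δ x) ∈ A := by
    intro x hx
    induction hx using Algebra.adjoin_induction with
    | mem x hx =>
      obtain ⟨u, hu, rfl⟩ := hx
      have : preLieDiff δ (ι K C u) = (ι K C).rTensor C (δ u) := by simp [preLieDiff]
      rw [this]
      exact hmul _ hUA _ (hW u (hUW hu))
    | algebraMap r => simp
    | add x y _ _ hx hy => rw [map_add, map_add]; exact A.add_mem hx hy
    | mul x y hxA hyA hx hy =>
      rw [Derivation.leibniz, map_add, symMulι_smul, symMulι_smul]
      exact A.add_mem (A.mul_mem hxA hy) (A.mul_mem hyA hx)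
  induction n with
  | zero => exact fun c _ => A.algebraMap_mem _
  | succ n ih =>
    intro c hc
    rw [coactionCoeff, LinearMap.smul_apply, LinearMap.comp_apply, coactionForm,
      LinearMap.sub_apply, map_sub]
    exact A.smul_mem (A.sub_mem (hmul _ (fun u hu => ih u (hUW hu)) _ (hW c hc))
      (hdiff _ (ih c hc))) _

end PreLieCoaction

/-! ## Local finiteness of the coaction -/

section CoactionFinite

open SymmetricAlgebra

variable {K : Type*} [Field K] {C : Type*} [AddCommGroup C] [Module K C]

/-- The composite of the directional derivatives attached to a list of linear forms, each
decorated by an index that bounds the filtration step on which it vanishes. -/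
def iteratedSymPartial : List ((C →ₗ[K] K) × ℕ) → SymmetricAlgebra K C →ₗ[K] SymmetricAlgebra K C
  | [] => LinearMap.id
  | p :: L => iteratedSymPartial L ∘ₗ (symPartial p.1).toLinearMap

theorem iteratedSymPartial_cons (p : (C →ₗ[K] K) × ℕ) (L : List ((C →ₗ[K] K) × ℕ))
    (x : SymmetricAlgebra K C) :
    iteratedSymPartial (p :: L) x = iteratedSymPartial L (symPartial p.1 x) := rfl

theorem iteratedSymPartial_perm {L L' : List ((C →ₗ[K] K) × ℕ)} (h : L.Perm L') :
    iteratedSymPartial L = iteratedSymPartial L' := by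
  induction h with
  | nil => rfl
  | cons p _ ih => exact LinearMap.ext fun x => by rw [iteratedSymPartial_cons, ih]; rfl
  | swap p q L =>
    refine LinearMap.ext fun x => ?_
    simp only [iteratedSymPartial_cons]
    rw [symPartial_comm]
  | trans _ _ h1 h2 => exact h1.trans h2

theorem algebraMapInv_symLinDer (A : C →ₗ[K] C) (x : SymmetricAlgebra K C) :
    algebraMapInv (symLinDer A x) = (0 : K) := by
  have h1 := symmetricAlgebra_leibniz_ext (algebraMapInv : SymmetricAlgebra K C →ₐ[K] K)
    (d := (algebraMapInv : SymmetricAlgebra K C →ₐ[K] K).toLinearMap ∘ₗ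
      (symLinDer A).toLinearMap) (e := 0)
    (by intro x y; simp) (by intro x y; simp) (by intro c; simp [algebraMapInv_ι])
  exact congrArg (fun f => f x) h1

/-- Moving the linear derivation out past the partial derivatives leaves one commutator ∂_{p∘A} for
each entry p, and the last term has no constant part. The raised index anticipates that p ∘ R_f
vanishes one filtration step further than p. -/
theorem iteratedSymPartial_symLinDer_eq_zero (A : C →ₗ[K] C) (L : List ((C →ₗ[K] K) × ℕ))
    (x : SymmetricAlgebra K C)
    (h : ∀ L₁ p L₂, L = L₁ ++ p :: L₂ →
      algebraMapInv (iteratedSymPartial (L₁ ++ (p.1 ∘ₗ A, p.2 + 1) :: L₂) x) = (0 : K)) :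
    algebraMapInv (iteratedSymPartial L (symLinDer A x)) = (0 : K) := by
  induction L generalizing x with
  | nil => exact algebraMapInv_symLinDer A x
  | cons p L ih =>
    rw [iteratedSymPartial_cons, symPartial_symLinDer, map_add, map_add,
      ih (symPartial p.1 x) fun L₁ q L₂ hL => h (p :: L₁) q L₂ (by rw [hL]; rfl), zero_add]
    exact h [] p L rfl

/-- Taylor's formula for a homogeneous element in characteristic 0. The decoration 0 imposes nothing
on the forms, as G₀ = 0. -/
theorem eq_zero_of_iteratedSymPartial_eq_zero [CharZero K] {n : ℕ} {x : SymmetricAlgebra K C}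
    (hx : symEuler K C x = (n : K) • x)
    (h : ∀ L : List ((C →ₗ[K] K) × ℕ), L.length = n → (∀ p ∈ L, p.2 = 0) →
      algebraMapInv (iteratedSymPartial L x) = (0 : K)) : x = 0 := by
  induction n generalizing x with
  | zero =>
    refine eq_zero_of_symDegree_eq_zero fun k => ?_
    cases k with
    | zero =>
      rw [symDegree_zero]
      have := h [] rfl (by simp)
      rw [show iteratedSymPartial [] x = x from rfl] at this
      rw [this, map_zero]
    | succ k =>
      have h1 := symEuler_symDegree (k + 1) x
      rw [symEuler, ← symDegree_symLinDer] at h1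
      rw [symEuler, Nat.cast_zero, zero_smul] at hx
      rw [hx, map_zero] at h1
      exact (smul_eq_zero.1 h1.symm).resolve_left (Nat.cast_ne_zero.2 k.succ_ne_zero)
  | succ n ih =>
    have h1 : ∀ f, symPartial f x = 0 := by
      intro f
      refine ih ?_ fun L hL h0 => ?_
      · have h2 := symPartial_symLinDer f LinearMap.id x
        rw [← symEuler, hx, Derivation.map_smul, LinearMap.comp_id, Nat.cast_succ, add_smul,
          one_smul] at h2
        exact (add_right_cancel h2).symm
      · exact h ((f, 0) :: L) (by simp [hL]) (by simpa using h0)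
    have h2 := symEuler_eq_zero_of_symPartial_eq_zero h1
    rw [hx] at h2
    exact (smul_eq_zero.1 h2).resolve_left (Nat.cast_ne_zero.2 n.succ_ne_zero)

variable (δ : C →ₗ[K] C ⊗[K] C)

/-- All `n`-fold derivatives of `x` in directions whose total filtration index exceeds `s` have
zero constant term. -/
def DerivativesVanish (n : ℕ) (s : ℝ) (x : SymmetricAlgebra K C) : Prop :=
  ∀ L : List ((C →ₗ[K] K) × ℕ), L.length = n →
    (∀ p ∈ L, ∀ c ∈ leftFiltration δ p.2, p.1 c = 0) →
    s < ((L.map fun p => p.2 + 1).sum : ℕ) → algebraMapInv (iteratedSymPartial L x) = (0 : K)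

variable {δ}

/-- Among n directions of total weight above nj, one has index at least j and hence vanishes on G_j.
Derivatives commute, so it may be applied first. -/
theorem derivativesVanish_of_symPartial {n j : ℕ} {x : SymmetricAlgebra K C}
    (h : ∀ f : C →ₗ[K] K, (∀ c ∈ leftFiltration δ j, f c = 0) → symPartial f x = 0) :
    DerivativesVanish δ n (n * j) x := by
  intro L hL hLδ hs
  obtain ⟨p, hp, hpj⟩ : ∃ p ∈ L, j < p.2 + 1 := by
    refine List.exists_lt_of_sum_lt (fun _ => j) (fun p : (C →ₗ[K] K) × ℕ => p.2 + 1) ?_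
    rw [List.map_const', List.sum_replicate, hL, smul_eq_mul]
    exact_mod_cast hs
  obtain ⟨L₁, L₂, rfl⟩ := List.append_of_mem hp
  rw [iteratedSymPartial_perm List.perm_middle, iteratedSymPartial_cons,
    h p.1 fun c hc => hLδ p hp c (leftFiltration_mono δ (Nat.lt_succ_iff.1 hpj) hc), map_zero,
    map_zero]

/-- Remove from the n + 1 directions one of at most average weight and apply it first. The recursion
turns it into R_f on x, which raises the weight of one other direction by 1. The bound on the
average therefore drops by 1/n. -/
theorem DerivativesVanish.succ {n : ℕ} (hn : n ≠ 0) {m : ℝ} {x y : SymmetricAlgebra K C}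
    (hxy : ∀ f, symPartial f y = -symLinDer (rightContraction δ f) x)
    (hx : DerivativesVanish δ n (n * m) x) :
    DerivativesVanish δ (n + 1) (((n + 1 : ℕ) : ℝ) * (m - 1 / n)) y := by
  intro L hL hLδ hs
  set s := (L.map fun p => p.2 + 1).sum with hs'
  -- If s is the total weight, p is chosen with weight at most s/(n + 1); the others keep at least
  -- sn/(n + 1) > nm - 1, and the raised index restores the missing 1.
  obtain ⟨p, hp, hps⟩ : ∃ p ∈ L, (p.2 + 1) * (n + 1) ≤ s := by
    refine List.exists_le_of_sum_le (l := L) (by rintro rfl; simp at hL)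
      (f := fun p => (p.2 + 1) * (n + 1)) (g := fun _ => s) ?_
    rw [List.map_const', List.sum_replicate, hL, smul_eq_mul, List.sum_map_mul_right, ← hs',
      mul_comm]
  obtain ⟨L₁, L₂, rfl⟩ := List.append_of_mem hp
  rw [iteratedSymPartial_perm List.perm_middle, iteratedSymPartial_cons, hxy, map_neg, map_neg,
    neg_eq_zero]
  have hsum : s = ((L₁ ++ L₂).map fun p => p.2 + 1).sum + (p.2 + 1) := by
    rw [hs']
    simp only [List.map_append, List.map_cons, List.sum_append, List.sum_cons]
    omega
  have hlen : (L₁ ++ L₂).length = n := by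
    simp only [List.length_append, List.length_cons] at hL ⊢
    omega
  have hbound : (n : ℝ) * m < (((L₁ ++ L₂).map fun p => p.2 + 1).sum + 1 : ℕ) := by
    have hn' : (0 : ℝ) < n := Nat.cast_pos.2 (Nat.pos_of_ne_zero hn)
    have h1 : ((p.2 + 1 : ℕ) : ℝ) * ((n + 1 : ℕ) : ℝ) ≤ s := by exact_mod_cast hps
    have h2 : (s : ℝ) = (((L₁ ++ L₂).map fun p => p.2 + 1).sum : ℕ) + ((p.2 + 1 : ℕ) : ℝ) := by
      exact_mod_cast hsum
    generalize (((L₁ ++ L₂).map fun p => p.2 + 1).sum : ℕ) = t at *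
    generalize ((p.2 + 1 : ℕ) : ℝ) = q at *
    have h3 : ((n + 1 : ℕ) : ℝ) * (m - 1 / n) * n = ((n + 1 : ℕ) : ℝ) * (n * m - 1) := by
      field_simp
    have h4 : ((n + 1 : ℕ) : ℝ) * (n * m - 1) < s * n := by
      rw [← h3]
      exact mul_lt_mul_of_pos_right hs hn'
    push_cast at *
    have h5 : ((n : ℝ) + 1) * (n * m - 1) < (n + 1) * t := by
      nlinarith
    have := lt_of_mul_lt_mul_left h5 (by positivity)
    linarith
  refine iteratedSymPartial_symLinDer_eq_zero _ _ _ fun M₁ q M₂ hM => ?_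
  rw [hM] at hlen hbound
  have hmem : ∀ r ∈ M₁ ++ q :: M₂, ∀ c ∈ leftFiltration δ r.2, r.1 c = 0 := by
    rw [← hM]
    intro r hr
    refine hLδ r ?_
    simp only [List.mem_append, List.mem_cons] at hr ⊢
    tauto
  refine hx _ ?_ ?_ ?_
  · simpa using hlen
  · intro r hr
    rw [List.mem_append, List.mem_cons] at hr
    rcases hr with hr | rfl | hr
    · exact hmem r (by simp [hr])
    · intro c hc
      exact hmem q (by simp) _ (mem_leftFiltration_succ.1 hc p.1)
    · exact hmem r (by simp [hr])
  · refine hbound.trans_le (Nat.cast_le.2 (le_of_eq ?_))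
    simp only [List.map_append, List.map_cons, List.sum_append, List.sum_cons]
    omega

/-- Starting from the average bound j in degree a + 1, each step subtracts the reciprocal of the
current degree. Every direction has weight at least 1, so once the bound is below 1 all derivatives
of full order vanish. -/
theorem eq_zero_of_symPartial_eq_neg_symLinDer [CharZero K] {y : ℕ → SymmetricAlgebra K C} {a j : ℕ}
    (hy : ∀ n, symEuler K C (y n) = (n : K) • y n)
    (hrec : ∀ n, a + 1 ≤ n → ∀ f, symPartial f (y (n + 1)) =
      -symLinDer (rightContraction δ f) (y n))
    (hj : ∀ f : C →ₗ[K] K, (∀ c ∈ leftFiltration δ j, f c = 0) → symPartial f (y (a + 1)) = 0)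
    {k : ℕ} (hk : (j : ℝ) - ∑ i ∈ Finset.range k, 1 / ((a + 1 + i : ℕ) : ℝ) < 1) :
    y (a + 1 + k) = 0 := by
  have hV : ∀ k, DerivativesVanish δ (a + 1 + k) (((a + 1 + k : ℕ) : ℝ) *
      (j - ∑ i ∈ Finset.range k, 1 / ((a + 1 + i : ℕ) : ℝ))) (y (a + 1 + k)) := by
    intro k
    induction k with
    | zero =>
      rw [Finset.sum_range_zero, sub_zero]
      exact derivativesVanish_of_symPartial hj
    | succ k ih =>
      rw [Finset.sum_range_succ, ← sub_sub]
      have hne : a + 1 + k ≠ 0 := by omega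
      exact ih.succ hne (hrec (a + 1 + k) (Nat.le_add_right _ _))
  refine eq_zero_of_iteratedSymPartial_eq_zero (hy _) fun L hL h0 => hV k L hL ?_ ?_
  · intro p hp c hc
    rw [h0 p hp, leftFiltration, Submodule.mem_bot] at hc
    rw [hc, map_zero]
  · have h1 : L.map (fun p => p.2 + 1) = L.map fun _ => 1 :=
      List.map_congr_left fun p hp => by rw [h0 p hp]
    rw [h1, List.map_const', List.sum_replicate, hL, smul_eq_mul, mul_one]
    have h2 : (0 : ℝ) < ((a + 1 + k : ℕ) : ℝ) := by positivity
    calc _ < ((a + 1 + k : ℕ) : ℝ) * 1 := mul_lt_mul_of_pos_left hk h2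
      _ = _ := mul_one _

/-- Divergence of the harmonic series, with its first a terms absorbed into the threshold. -/
theorem eventually_sub_sum_lt_one (a j : ℕ) :
    ∃ k₀, ∀ k, k₀ ≤ k → (j : ℝ) - ∑ i ∈ Finset.range k, 1 / ((a + 1 + i : ℕ) : ℝ) < 1 := by
  have h := Real.tendsto_sum_range_one_div_nat_succ_atTop.eventually_gt_atTop
    ((j : ℝ) - 1 + ∑ i ∈ Finset.range a, (1 / ((i : ℝ) + 1)))
  obtain ⟨k₀, hk₀⟩ := Filter.eventually_atTop.1 h
  refine ⟨k₀, fun k hk => ?_⟩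
  have h1 := hk₀ (a + k) (by omega)
  rw [Finset.sum_range_add] at h1
  have h2 : ∑ i ∈ Finset.range k, 1 / ((a + 1 + i : ℕ) : ℝ) =
      ∑ i ∈ Finset.range k, 1 / (((a + i : ℕ) : ℝ) + 1) :=
    Finset.sum_congr rfl fun i _ => by push_cast; ring_nf
  rw [h2]
  linarith

theorem exists_symPartial_eq_zero (hδ : IsConilpotent δ) (x : SymmetricAlgebra K C) :
    ∃ j, ∀ f : C →ₗ[K] K, (∀ c ∈ leftFiltration δ j, f c = 0) → symPartial f x = 0 := by
  induction x using SymmetricAlgebra.induction with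
  | algebraMap r => exact ⟨0, fun f _ => by simp⟩
  | ι c =>
    obtain ⟨j, hj⟩ := hδ c
    exact ⟨j, fun f hf => by rw [symPartial_ι, hf c hj, map_zero]⟩
  | mul x y hx hy =>
    obtain ⟨i, hi⟩ := hx
    obtain ⟨j, hj⟩ := hy
    refine ⟨max i j, fun f hf => ?_⟩
    rw [Derivation.leibniz,
      hi f fun c hc => hf c (leftFiltration_mono δ (le_max_left i j) hc),
      hj f fun c hc => hf c (leftFiltration_mono δ (le_max_right i j) hc)]
    simp
  | add x y hx hy =>
    obtain ⟨i, hi⟩ := hx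
    obtain ⟨j, hj⟩ := hy
    refine ⟨max i j, fun f hf => ?_⟩
    rw [map_add,
      hi f fun c hc => hf c (leftFiltration_mono δ (le_max_left i j) hc),
      hj f fun c hc => hf c (leftFiltration_mono δ (le_max_right i j) hc), add_zero]

theorem exists_symPartial_contractSnd_eq_zero (hδ : IsConilpotent δ)
    (z : SymmetricAlgebra K C ⊗[K] C) :
    ∃ j, ∀ l f : C →ₗ[K] K, (∀ c ∈ leftFiltration δ j, f c = 0) →
      symPartial f (contractSnd _ l z) = 0 := by
  induction z using TensorProduct.induction_on with
  | zero => exact ⟨0, fun l f _ => by simp⟩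
  | tmul x c =>
    obtain ⟨j, hj⟩ := exists_symPartial_eq_zero hδ x
    exact ⟨j, fun l f hf => by rw [contractSnd_tmul, Derivation.map_smul, hj f hf, smul_zero]⟩
  | add x y hx hy =>
    obtain ⟨i, hi⟩ := hx
    obtain ⟨j, hj⟩ := hy
    refine ⟨max i j, fun l f hf => ?_⟩
    rw [map_add, map_add,
      hi l f fun c hc => hf c (leftFiltration_mono δ (le_max_left i j) hc),
      hj l f fun c hc => hf c (leftFiltration_mono δ (le_max_right i j) hc), add_zero]

/-- Induction on the step of G containing c. For large n the term ρ_n(R_f c) vanishes, so the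
recursion becomes the homogeneous one treated by the weight argument. -/
theorem exists_coactionDegree_eq_zero [CharZero K] (hδ : IsPreLieCooperation δ)
    (hδ' : IsConilpotent δ) (c : C) : ∃ n₀, ∀ n, n₀ ≤ n → coactionDegree δ n c = 0 := by
  obtain ⟨m, hm⟩ := hδ' c
  induction m generalizing c with
  | zero =>
    rw [leftFiltration, Submodule.mem_bot] at hm
    exact ⟨0, fun n _ => by rw [hm, map_zero]⟩
  | succ m ih =>
    -- The bound is uniform in f because δ(c) is a finite sum of tensors with first factors in G_m.
    have h1 : ∃ N, ∀ f : C →ₗ[K] K, ∀ n, N ≤ n →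
        coactionDegree δ n (rightContraction δ f c) = 0 := by
      rw [leftFiltration, Submodule.mem_comap] at hm
      obtain ⟨z, hz⟩ := hm
      simp only [rightContraction_apply, ← hz, contractSnd_rTensor]
      clear hz
      induction z using TensorProduct.induction_on with
      | zero => exact ⟨0, fun f n _ => by simp⟩
      | tmul r p =>
        obtain ⟨N, hN⟩ := ih r r.2
        exact ⟨N, fun f n hn => by simp [hN n hn]⟩
      | add x y hx hy =>
        obtain ⟨i, hi⟩ := hx
        obtain ⟨j, hj⟩ := hy
        refine ⟨max i j, fun f n hn => ?_⟩
        rw [map_add, map_add, map_add, hi f n (le_trans (le_max_left i j) hn),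
          hj f n (le_trans (le_max_right i j) hn), add_zero]
    obtain ⟨a, ha⟩ := h1
    obtain ⟨j, hj⟩ := exists_symPartial_contractSnd_eq_zero hδ' (coactionDegree δ (a + 1) c)
    obtain ⟨k₀, hk₀⟩ := eventually_sub_sum_lt_one a j
    refine ⟨a + 1 + k₀, fun n hn => eq_zero_of_contractSnd_eq_zero fun l => ?_⟩
    obtain ⟨k, rfl⟩ := Nat.exists_eq_add_of_le (show a + 1 ≤ n by omega)
    rw [contractSnd_coactionDegree]
    refine eq_zero_of_symPartial_eq_neg_symLinDer (δ := δ) (j := j)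
      (y := fun n => coactionCoeff δ l n c) (fun n => symEuler_coactionCoeff hδ l n c)
      (fun n hn f => ?_) (fun f hf => ?_) (hk₀ k (by omega))
    · rw [symPartial_coactionCoeff hδ, ← contractSnd_coactionDegree δ l n (rightContraction δ f c),
        ha f n (by omega), map_zero, zero_sub]
    · rw [← contractSnd_coactionDegree]
      exact hj l f hf

/-- Every conilpotent pre-Lie cooperation is induced by a right-sided bialgebra structure. -/
theorem exists_rightSidedBialgebra [CharZero K] (hδ : IsPreLieCooperation δ)
    (hδ' : IsConilpotent δ) :
    ∃ B : RightSidedBialgebra K C, B.delta = δ ∧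
      ∀ U W : Submodule K C, U ≤ W →
        (∀ c ∈ W, δ c ∈ LinearMap.range (TensorProduct.map U.subtype U.subtype)) →
        ∀ c ∈ W, ∀ l, contractSnd _ l (B.coaction c) ∈ Algebra.adjoin K (ι K C '' U) := by
  have hlim : ∀ c, ∃ n, ∀ m, n ≤ m → (∑ i ∈ Finset.range m, coactionDegree δ i) c =
      (∑ i ∈ Finset.range n, coactionDegree δ i) c := by
    intro c
    obtain ⟨n, hn⟩ := exists_coactionDegree_eq_zero hδ hδ' c
    refine ⟨n, fun m hm => ?_⟩
    induction m, hm using Nat.le_induction with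
    | base => rfl
    | succ m hm ih => rw [Finset.sum_range_succ, LinearMap.add_apply, ih, hn m hm, add_zero]
  obtain ⟨ρ, hρ⟩ := exists_linearMap_eventually_eq _ hlim
  have hρ' : ∀ l c, ∃ n₀, ∀ n, n₀ ≤ n →
      contractSnd _ l (ρ c) = ∑ i ∈ Finset.range n, coactionCoeff δ l i c := by
    intro l c
    obtain ⟨n₀, hn₀⟩ := hρ c
    refine ⟨n₀, fun n hn => ?_⟩
    rw [← hn₀ n hn, LinearMap.sum_apply, map_sum]
    exact Finset.sum_congr rfl fun i _ => contractSnd_coactionDegree δ l i c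
  have hε : ∀ c, contractFst _ (algebraMapInv : SymmetricAlgebra K C →ₐ[K] K).toLinearMap (ρ c) =
      c := by
    intro c
    rw [← sub_eq_zero, ← Module.forall_dual_apply_eq_zero_iff K]
    intro l
    rw [map_sub, contractSnd_contractFst, sub_eq_zero]
    obtain ⟨n, hn⟩ := hρ' l c
    rw [hn (n + 1) n.le_succ, Finset.sum_range_succ', AlgHom.toLinearMap_apply, map_add, map_sum,
      Finset.sum_eq_zero fun i _ => algebraMapInv_coactionCoeff_succ hδ l i c, zero_add]
    simp [coactionCoeff]
  have hD : ∀ f c, (affineDer f (rightContraction δ f)).toLinearMap.rTensor _ (ρ c) =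
      ρ (rightContraction δ f c) := by
    intro f c
    refine eq_of_contractSnd_eq fun l => ?_
    obtain ⟨n₁, hn₁⟩ := hρ' l c
    obtain ⟨n₂, hn₂⟩ := hρ' l (rightContraction δ f c)
    obtain ⟨n₃, hn₃⟩ := exists_coactionDegree_eq_zero hδ hδ' c
    -- D_f lowers the degree by one, so the truncation at c is one term longer than the one at R_f
    -- c. Passing n₃ kills the boundary term of the telescoping sum.
    rw [contractSnd_rTensor, hn₁ (n₁ + n₂ + n₃ + 1) (by omega), hn₂ (n₁ + n₂ + n₃) (by omega)]
    refine (affineDer_sum_coactionCoeff hδ l _ f c).trans ?_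
    rw [← contractSnd_coactionDegree δ l (n₁ + n₂ + n₃) c, hn₃ _ (by omega)]
    simp
  refine ⟨.ofCoaction hε hD hδ', RightSidedBialgebra.delta_ofCoaction hε hD hδ', ?_⟩
  intro U W hUW hW c hc l
  rw [RightSidedBialgebra.coaction_ofCoaction]
  obtain ⟨n, hn⟩ := hρ' l c
  rw [hn n le_rfl]
  exact Subalgebra.sum_mem _ fun i _ => coactionCoeff_mem_adjoin hUW hW l i c hc

end CoactionFinite

/-! ## Rooted trees -/

namespace PlanarTree

theorem induction {P : PlanarTree → Prop} (h : ∀ l, (∀ t ∈ l, P t) → P (node l)) (t : PlanarTree) :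
    P t :=
  match t with
  | node l => h l fun t _ => induction h t

mutual

/-- The number of vertices of a planar tree. -/
def vertexCount : PlanarTree → ℕ
  | node l => forestVertexCount l + 1

/-- The number of vertices of a planar forest. -/
def forestVertexCount : List PlanarTree → ℕ
  | [] => 0
  | t :: l => vertexCount t + forestVertexCount l

end

theorem vertexCount_pos (t : PlanarTree) : 0 < t.vertexCount := by
  cases t
  rw [vertexCount]
  omega

theorem forestVertexCount_append (l l' : List PlanarTree) :
    forestVertexCount (l ++ l') = forestVertexCount l + forestVertexCount l' := by
  induction l with
  | nil => simp [forestVertexCount]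
  | cons t l ih => simp only [List.cons_append, forestVertexCount, ih]; omega

theorem forestVertexCount_of_mem_forestCuts {l : List PlanarTree}
    (hl : ∀ t ∈ l, ∀ c ∈ cuts t, forestVertexCount c.1 + vertexCount c.2 = vertexCount t) :
    ∀ c ∈ forestCuts l,
      forestVertexCount c.1 + forestVertexCount c.2 = forestVertexCount l := by
  induction l with
  | nil => simp [forestCuts, forestVertexCount]
  | cons t l ih =>
    intro c hc
    rw [forestCuts, List.mem_flatMap] at hc
    obtain ⟨x, hx, hc⟩ := hc
    obtain ⟨y, hy, rfl⟩ := List.mem_map.1 hc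
    have h1 := ih (fun s hs => hl s (List.mem_cons_of_mem _ hs)) y hy
    have h2 : forestVertexCount x.1 + forestVertexCount x.2 = vertexCount t := by
      rcases List.mem_cons.1 hx with rfl | hx
      · simp [forestVertexCount]
      · obtain ⟨z, hz, rfl⟩ := List.mem_map.1 hx
        simpa [forestVertexCount] using hl t List.mem_cons_self z hz
    simp only [forestVertexCount_append, forestVertexCount]
    omega

theorem vertexCount_of_mem_cuts (t : PlanarTree) :
    ∀ c ∈ cuts t, forestVertexCount c.1 + vertexCount c.2 = vertexCount t := by
  induction t using PlanarTree.induction with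
  | h l ih =>
    intro c hc
    rw [cuts] at hc
    obtain ⟨y, hy, rfl⟩ := List.mem_map.1 hc
    have := forestVertexCount_of_mem_forestCuts ih y hy
    simp only [vertexCount]
    omega

end PlanarTree

namespace FinRootedTree

open PlanarTree

/-- The rooted tree underlying a planar tree. -/
def mk (t : PlanarTree) : FinRootedTree := Quot.mk _ t

/-- A planar representative of a rooted tree. -/
def out (t : FinRootedTree) : PlanarTree := Quot.out t

theorem mk_out (t : FinRootedTree) : mk t.out = t := Quot.out_eq t

theorem mk_node_append_cons {t t' : PlanarTree} (h : mk t = mk t') (a b : List PlanarTree) :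
    mk (node (a ++ t :: b)) = mk (node (a ++ t' :: b)) :=
  congrArg (Quot.lift (fun t => mk (node (a ++ t :: b)))
    fun _ _ h => Quot.sound (Rel.child a b h)) h

theorem mk_node_congr {l l' : List PlanarTree} (h : l.map mk = l'.map mk) (a : List PlanarTree) :
    mk (node (a ++ l)) = mk (node (a ++ l')) := by
  induction l generalizing l' a with
  | nil => rw [List.map_nil, eq_comm, List.map_eq_nil_iff] at h; rw [h]
  | cons t l ih =>
    cases l' with
    | nil => simp at h
    | cons t' l' =>
      rw [List.map_cons, List.map_cons, List.cons.injEq] at h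
      rw [mk_node_append_cons h.1]
      simpa using ih h.2 (a ++ [t'])

/-- The branches at the root. -/
def branches : FinRootedTree → Multiset FinRootedTree :=
  Quot.lift (fun t => match t with | node l => (l.map mk : Multiset FinRootedTree)) <| by
    rintro _ _ (h | ⟨a, b, h⟩)
    · exact Multiset.coe_eq_coe.2 (h.map mk)
    · simp only [List.map_append, List.map_cons, show mk _ = mk _ from Quot.sound h]

theorem branches_mk_node (l : List PlanarTree) :
    branches (mk (node l)) = (l.map mk : Multiset FinRootedTree) := rfl

/-- The tree with given branches at the root. -/
def ofBranches : Multiset FinRootedTree → FinRootedTree :=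
  Quot.lift (fun l => mk (node (l.map out)))
    fun _ _ h => Quot.sound (Rel.perm (List.Perm.map _ h))

theorem ofBranches_map_mk (l : List PlanarTree) :
    ofBranches (l.map mk : Multiset FinRootedTree) = mk (node l) :=
  mk_node_congr (l := (l.map mk).map out) (by
    rw [List.map_map, List.map_map]
    exact List.map_congr_left fun t _ => mk_out (mk t)) []

/-- A rooted tree is the same as the multiset of its branches. -/
def branchesEquiv : Multiset FinRootedTree ≃ FinRootedTree where
  toFun := ofBranches
  invFun := branches
  left_inv s := by
    induction s using Quot.inductionOn with
    | h l =>
      change branches (mk (node (l.map out))) = (l : Multiset FinRootedTree)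
      rw [branches_mk_node, List.map_map]
      exact congrArg _ ((List.map_congr_left fun t _ => mk_out t).trans l.map_id)
  right_inv t := by
    induction t using Quot.inductionOn with
    | h t =>
      cases t with
      | node l => exact ofBranches_map_mk l

end FinRootedTree

-- Grafting as an isomorphism from forests to trees

section Grafting

open FinRootedTree PlanarTree

variable (K : Type u) [Field K]

open Classical in
/-- The basis of `S(T)` formed by the products of trees, indexed by the tree that is obtained by
grafting all factors on a common root. -/
def forestBasis : Module.Basis FinRootedTree K (SymmetricAlgebra K (FinRootedTree →₀ K)) :=
  (Finsupp.basisSingleOne (R := K) (ι := FinRootedTree)).symmetricAlgebra.reindex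
    (Multiset.toFinsupp.toEquiv.symm.trans branchesEquiv)

open Classical in
theorem prod_map_treeGen (l : List PlanarTree) :
    (l.map (treeGen K)).prod = (Finsupp.basisSingleOne (R := K)).symmetricAlgebra
      (Multiset.toFinsupp (l.map mk : Multiset FinRootedTree)) := by
  rw [Module.Basis.symmetricAlgebra, Module.Basis.map_apply, MvPolynomial.coe_basisMonomials]
  induction l with
  | nil => simp
  | cons t l ih =>
    rw [List.map_cons, List.prod_cons, ih, List.map_cons, ← Multiset.cons_coe,
      ← Multiset.singleton_add, map_add, Multiset.toFinsupp_singleton]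
    simp only [AlgEquiv.toLinearEquiv_apply]
    have h1 : ∀ m n : FinRootedTree →₀ ℕ, MvPolynomial.monomial (m + n) (1 : K) =
        MvPolynomial.monomial m 1 * MvPolynomial.monomial n 1 := fun m n => by
      rw [MvPolynomial.monomial_mul, one_mul]
    rw [h1, map_mul]
    congr 1
    exact ((SymmetricAlgebra.equivMvPolynomial_symm_X Finsupp.basisSingleOne (mk t)).trans
      (by rw [Finsupp.coe_basisSingleOne]; rfl)).symm

theorem forestBasis_mk_node (l : List PlanarTree) :
    forestBasis K (mk (node l)) = (l.map (treeGen K)).prod := by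
  classical
  rw [prod_map_treeGen, forestBasis, Module.Basis.reindex_apply]
  rfl

/-- The linear isomorphism `S(T) ≃ T` that grafts the trees of a forest on a common root. -/
def grafting : SymmetricAlgebra K (FinRootedTree →₀ K) ≃ₗ[K] (FinRootedTree →₀ K) :=
  (forestBasis K).repr

theorem grafting_prod (l : List PlanarTree) :
    grafting K (l.map (treeGen K)).prod = Finsupp.single (mk (node l)) 1 := by
  rw [← forestBasis_mk_node, grafting, Module.Basis.repr_self]

variable {K} in
theorem linearMap_ext_prod_treeGen {M : Type*} [AddCommGroup M] [Module K M]
    {F G : SymmetricAlgebra K (FinRootedTree →₀ K) →ₗ[K] M}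
    (h : ∀ l : List PlanarTree, F (l.map (treeGen K)).prod = G (l.map (treeGen K)).prod) :
    F = G := by
  refine (forestBasis K).ext fun t => ?_
  induction t using Quot.inductionOn with
  | h t =>
    cases t with
    | node l =>
      change F (forestBasis K (mk (node l))) = G (forestBasis K (mk (node l)))
      rw [forestBasis_mk_node, h]

/-- Only the empty forest grafts to the one-vertex tree, and the counit reads off its coefficient.
-/
theorem lapply_grafting (x : SymmetricAlgebra K (FinRootedTree →₀ K)) :
    (Finsupp.lapply FinRootedTree.single : (FinRootedTree →₀ K) →ₗ[K] K) (grafting K x) =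
      (SymmetricAlgebra.algebraMapInv x : K) := by
  refine LinearMap.congr_fun (f := Finsupp.lapply FinRootedTree.single ∘ₗ (grafting K).toLinearMap)
    (g := (SymmetricAlgebra.algebraMapInv :
      SymmetricAlgebra K (FinRootedTree →₀ K) →ₐ[K] K).toLinearMap) (linearMap_ext_prod_treeGen fun l => ?_) x
  rw [LinearMap.comp_apply, LinearEquiv.coe_coe, grafting_prod, AlgHom.toLinearMap_apply]
  cases l with
  | nil =>
    rw [List.map_nil, List.prod_nil, map_one]
    exact Finsupp.single_eq_same
  | cons t l =>
    have h1 : mk (node (t :: l)) ≠ FinRootedTree.single := fun h => by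
      have := congrArg branches h
      exact Multiset.cons_ne_zero (a := mk t) (m := (l.map mk : Multiset FinRootedTree)) this
    rw [Finsupp.lapply_apply, Finsupp.single_eq_of_ne' h1, List.map_cons, List.prod_cons, map_mul,
      treeGen, SymmetricAlgebra.algebraMapInv_ι, zero_mul]

end Grafting

-- The cocycle equation and the Connes–Kreimer bialgebra

section ConnesKreimerBialgebra

open FinRootedTree PlanarTree SymmetricAlgebra

variable (K : Type u) [Field K]

/-- Cuts of distinct branches are chosen independently, so the list of forest cuts expands the
product. -/
theorem prod_ckCoproduct (l : List PlanarTree) :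
    (l.map (ckCoproduct K)).prod = ((forestCuts l).map fun y =>
      (y.1.map (treeGen K)).prod ⊗ₜ[K] (y.2.map (treeGen K)).prod).sum := by
  induction l with
  | nil => simp [forestCuts, Algebra.TensorProduct.one_def]
  | cons t l ih =>
    have h1 : ckCoproduct K t =
        ((([t], []) :: (cuts t).map fun c => (c.1, [c.2])).map fun x =>
          (x.1.map (treeGen K)).prod ⊗ₜ[K] (x.2.map (treeGen K)).prod).sum := by
      simp [ckCoproduct, Function.comp_def]
    rw [List.map_cons, List.prod_cons, ih, h1, forestCuts]
    generalize (([t], []) :: (cuts t).map fun c => (c.1, [c.2])) = m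
    induction m with
    | nil => simp
    | cons x m ihm =>
      rw [List.map_cons, List.sum_cons, add_mul, ihm, List.flatMap_cons, List.map_append,
        List.sum_append, ← List.sum_map_mul_left, List.map_map]
      congr 2
      refine List.map_congr_left fun y _ => ?_
      simp [Algebra.TensorProduct.tmul_mul_tmul]

/-- A cut that spares the root is a choice of forest cut of the branches, and the remaining branches
are grafted back on the root. -/
theorem ckCoproduct_node (l : List PlanarTree) :
    ckCoproduct K (node l) = treeGen K (node l) ⊗ₜ[K] 1 +
      (ι K _ ∘ₗ (grafting K).toLinearMap).lTensor _ (l.map (ckCoproduct K)).prod := by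
  rw [ckCoproduct, prod_ckCoproduct, map_list_sum, cuts, List.map_map, List.map_map]
  congr 2
  refine List.map_congr_left fun y _ => ?_
  simp only [Function.comp_apply, LinearMap.lTensor_tmul, LinearMap.comp_apply,
    LinearEquiv.coe_coe, grafting_prod]
  rfl

/-- The right-hand side of the cocycle equation is a commutative product over the branches, so it
ignores their order; a change inside one branch is handled by induction. -/
theorem ckCoproduct_congr {t t' : PlanarTree} (h : PlanarTree.Rel t t') :
    ckCoproduct K t = ckCoproduct K t' := by
  have hgen : ∀ {s s'}, PlanarTree.Rel s s' → treeGen K s = treeGen K s' := fun h => by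
      rw [treeGen, treeGen, Quot.sound h]
  induction h with
  | perm h =>
    rw [ckCoproduct_node, ckCoproduct_node, hgen (Rel.perm h), (h.map _).prod_eq]
  | child a b h ih =>
    rw [ckCoproduct_node, ckCoproduct_node, hgen (Rel.child a b h)]
    simp only [List.map_append, List.map_cons, ih]

/-- The Connes–Kreimer coproduct on the symmetric algebra of the space of rooted trees. -/
def ckComul : SymmetricAlgebra K (FinRootedTree →₀ K) →ₐ[K]
    SymmetricAlgebra K (FinRootedTree →₀ K) ⊗[K] SymmetricAlgebra K (FinRootedTree →₀ K) :=
  SymmetricAlgebra.lift (Finsupp.linearCombination K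
    (Quot.lift (ckCoproduct K) fun _ _ h => ckCoproduct_congr K h))

theorem ckComul_treeGen (t : PlanarTree) : ckComul K (treeGen K t) = ckCoproduct K t := by
  rw [ckComul, treeGen, SymmetricAlgebra.lift_ι_apply]
  exact (Finsupp.linearCombination_single K 1 _).trans (one_smul _ _)

theorem ckComul_ι_grafting (x : SymmetricAlgebra K (FinRootedTree →₀ K)) :
    ckComul K (ι K _ (grafting K x)) = ι K _ (grafting K x) ⊗ₜ 1 +
      (ι K _ ∘ₗ (grafting K).toLinearMap).lTensor _ (ckComul K x) := by
  refine LinearMap.congr_fun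
    (f := (ckComul K).toLinearMap ∘ₗ ι K _ ∘ₗ (grafting K).toLinearMap)
    (g := (TensorProduct.mk K _ _).flip 1 ∘ₗ ι K _ ∘ₗ (grafting K).toLinearMap +
      (ι K _ ∘ₗ (grafting K).toLinearMap).lTensor _ ∘ₗ (ckComul K).toLinearMap)
    (linearMap_ext_prod_treeGen fun l => ?_) x
  have h1 : ι K _ (grafting K (l.map (treeGen K)).prod) = treeGen K (node l) := by
    rw [grafting_prod]; rfl
  have h2 : ckComul K (l.map (treeGen K)).prod = (l.map (ckCoproduct K)).prod := by
    rw [map_list_prod, List.map_map]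
    exact congrArg _ (List.map_congr_left fun t _ => ckComul_treeGen K t)
  simp only [LinearMap.comp_apply, LinearMap.add_apply, LinearEquiv.coe_coe,
    AlgHom.toLinearMap_apply, h1, h2, LinearMap.flip_apply, TensorProduct.mk_apply,
    ckComul_treeGen]
  exact ckCoproduct_node K l

variable {K} in
-- Every tree is the grafting of the product of its branches, so agreement propagates from the
-- branches to the tree.
theorem algHom_eq_of_grafting {A : Type*} [Semiring A] [Algebra K A]
    {F G : SymmetricAlgebra K (FinRootedTree →₀ K) →ₐ[K] A}
    (h : ∀ x, F x = G x → F (ι K _ (grafting K x)) = G (ι K _ (grafting K x))) : F = G := by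
  have h1 : ∀ t, F (treeGen K t) = G (treeGen K t) := by
    intro t
    induction t using PlanarTree.induction with
    | h l ih =>
      have h2 : treeGen K (node l) = ι K _ (grafting K (l.map (treeGen K)).prod) := by
        rw [grafting_prod]; rfl
      rw [h2]
      refine h _ ?_
      rw [map_list_prod, map_list_prod, List.map_map, List.map_map]
      exact congrArg _ (List.map_congr_left ih)
  refine symmetricAlgebra_algHom_ext fun c => ?_
  induction c using Finsupp.induction_linear with
  | zero => simp
  | add x y hx hy => simp only [map_add, hx, hy]
  | single t r =>
    induction t using Quot.inductionOn with
    | h t =>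
      have h2 : (Finsupp.single (Quot.mk _ t) r : FinRootedTree →₀ K) =
          r • Finsupp.single (mk t) 1 := by
        rw [Finsupp.smul_single, smul_eq_mul, mul_one]; rfl
      rw [h2, map_smul, map_smul, map_smul]
      exact congrArg _ (h1 t)

/-- The Connes–Kreimer bialgebra of rooted trees. -/
def ckBialgebra : RightSidedBialgebra K (FinRootedTree →₀ K) where
  comul := ckComul K
  coassoc := by
    refine algHom_eq_of_grafting fun x hx => ?_
    have e1 : ∀ z, Algebra.TensorProduct.assoc K K K _ _ _
        (Algebra.TensorProduct.map (ckComul K) (.id K _)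
          ((ι K _ ∘ₗ (grafting K).toLinearMap).lTensor _ z)) =
        ((ι K _ ∘ₗ (grafting K).toLinearMap).lTensor _).lTensor _
          (Algebra.TensorProduct.assoc K K K _ _ _
            (Algebra.TensorProduct.map (ckComul K) (.id K _) z)) := by
      intro z
      induction z using TensorProduct.induction_on with
      | zero => simp
      | add x y hx hy => simp only [map_add, hx, hy]
      | tmul a b =>
        simp only [LinearMap.lTensor_tmul, Algebra.TensorProduct.map_tmul, AlgHom.id_apply]
        induction ckComul K a using TensorProduct.induction_on with
        | zero => simp
        | add x y hx hy => simp only [TensorProduct.add_tmul, map_add, hx, hy]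
        | tmul c d => simp
    have e2 : ∀ z, Algebra.TensorProduct.map (.id K (SymmetricAlgebra K (FinRootedTree →₀ K)))
          (ckComul K)
          ((ι K _ ∘ₗ (grafting K).toLinearMap).lTensor _ z) =
        Algebra.TensorProduct.assoc K K K _ _ _
          ((ι K _ ∘ₗ (grafting K).toLinearMap).lTensor _ z ⊗ₜ 1) +
        ((ι K _ ∘ₗ (grafting K).toLinearMap).lTensor _).lTensor _
          (Algebra.TensorProduct.map (.id K _) (ckComul K) z) := by
      intro z
      induction z using TensorProduct.induction_on with
      | zero => simp
      | add x y hx hy =>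
        simp only [map_add, hx, hy, TensorProduct.add_tmul]
        abel
      | tmul a b => simp [ckComul_ι_grafting, TensorProduct.tmul_add]
    change Algebra.TensorProduct.assoc K K K _ _ _
      (Algebra.TensorProduct.map (ckComul K) (.id K _) (ckComul K x)) =
      Algebra.TensorProduct.map (.id K _) (ckComul K) (ckComul K x) at hx
    change Algebra.TensorProduct.assoc K K K _ _ _
      (Algebra.TensorProduct.map (ckComul K) (.id K _) (ckComul K _)) =
      Algebra.TensorProduct.map (.id K _) (ckComul K) (ckComul K _)
    -- With B the grafting, both sides become Bx ⊗ 1 ⊗ 1 + (id ⊗ B)Δ(x) ⊗ 1 plus id ⊗ id ⊗ B applied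
    -- to one side of coassociativity at x.
    rw [ckComul_ι_grafting, map_add, map_add, map_add, e1, hx, e2,
      Algebra.TensorProduct.map_tmul, Algebra.TensorProduct.map_tmul, ckComul_ι_grafting]
    simp only [AlgHom.id_apply, TensorProduct.add_tmul, map_add, map_one,
      Algebra.TensorProduct.assoc_tmul, Algebra.TensorProduct.one_def]
    abel
  rTensor_counit := by
    refine algHom_eq_of_grafting fun x hx => ?_
    have e1 : ∀ z, Algebra.TensorProduct.map (algebraMapInv : SymmetricAlgebra K (FinRootedTree →₀ K) →ₐ[K] K)
          (.id K (SymmetricAlgebra K (FinRootedTree →₀ K)))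
          ((ι K _ ∘ₗ (grafting K).toLinearMap).lTensor _ z) =
        (ι K _ ∘ₗ (grafting K).toLinearMap).lTensor _
          (Algebra.TensorProduct.map (algebraMapInv : SymmetricAlgebra K (FinRootedTree →₀ K) →ₐ[K] K)
          (.id K (SymmetricAlgebra K (FinRootedTree →₀ K))) z) := by
      intro z
      induction z using TensorProduct.induction_on with
      | zero => simp
      | add x y hx hy => simp only [map_add, hx, hy]
      | tmul a b => simp
    change Algebra.TensorProduct.map algebraMapInv (.id K _) (ckComul K x) =
      (Algebra.TensorProduct.lid K _).symm x at hx
    change Algebra.TensorProduct.map algebraMapInv (.id K _) (ckComul K _) =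
      (Algebra.TensorProduct.lid K _).symm _
    rw [ckComul_ι_grafting, map_add, e1, hx, Algebra.TensorProduct.map_tmul, algebraMapInv_ι]
    simp
  lTensor_counit := by
    refine algHom_eq_of_grafting fun x _ => ?_
    have e1 : ∀ z, Algebra.TensorProduct.map (.id K _) algebraMapInv
          ((ι K _ ∘ₗ (grafting K).toLinearMap).lTensor
            (SymmetricAlgebra K (FinRootedTree →₀ K)) z) = 0 := by
      intro z
      induction z using TensorProduct.induction_on with
      | zero => simp
      | add x y hx hy => simp only [map_add, hx, hy, add_zero]
      | tmul a b => simp [algebraMapInv_ι]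
    change Algebra.TensorProduct.map (.id K _) algebraMapInv (ckComul K _) =
      (Algebra.TensorProduct.rid K K _).symm _
    rw [ckComul_ι_grafting, map_add, e1]
    simp
  right_sided c := by
    obtain ⟨x, rfl⟩ := (grafting K).surjective c
    rw [ckComul_ι_grafting, add_sub_cancel_left, LinearMap.lTensor_comp]
    exact sub_mem ⟨_, rfl⟩ ⟨1 ⊗ₜ grafting K x, by simp⟩

end ConnesKreimerBialgebra

/-! ## The pre-Lie coalgebra of rooted trees -/

section FullFiltration

variable {K : Type*} [Field K] {C : Type*} [AddCommGroup C] [Module K C]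

theorem tmul_mem_range_map_subtype {V : Submodule K C} {a b : C} (ha : a ∈ V) (hb : b ∈ V) :
    a ⊗ₜ[K] b ∈ LinearMap.range (TensorProduct.map V.subtype V.subtype) :=
  ⟨⟨a, ha⟩ ⊗ₜ ⟨b, hb⟩, by simp⟩

theorem range_map_subtype_mono {V W : Submodule K C} (h : V ≤ W) :
    LinearMap.range (TensorProduct.map V.subtype V.subtype) ≤
      LinearMap.range (TensorProduct.map W.subtype W.subtype) := by
  rintro _ ⟨z, rfl⟩
  induction z using TensorProduct.induction_on with
  | zero => simp
  | tmul a b => exact tmul_mem_range_map_subtype (h a.2) (h b.2)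
  | add x y hx hy => rw [map_add]; exact add_mem hx hy

theorem contractSnd_mem_of_mem_range_map {V : Submodule K C} {z : C ⊗[K] C}
    (hz : z ∈ LinearMap.range (TensorProduct.map V.subtype V.subtype)) (f : C →ₗ[K] K) :
    contractSnd C f z ∈ V := by
  obtain ⟨w, rfl⟩ := hz
  rw [contractSnd_map]
  exact Submodule.coe_mem _

theorem contractSnd_congr_of_mem_range_map {V : Submodule K C} {z : C ⊗[K] C}
    (hz : z ∈ LinearMap.range (TensorProduct.map V.subtype V.subtype)) {f g : C →ₗ[K] K}
    (h : ∀ c ∈ V, f c = g c) : contractSnd C f z = contractSnd C g z := by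
  obtain ⟨w, rfl⟩ := hz
  have : f ∘ₗ V.subtype = g ∘ₗ V.subtype := LinearMap.ext fun c => h c c.2
  rw [contractSnd_map, contractSnd_map, this]

variable (δ : C →ₗ[K] C ⊗[K] C)

theorem fullFiltration_le_succ (n : ℕ) : fullFiltration δ n ≤ fullFiltration δ (n + 1) := by
  induction n with
  | zero => exact bot_le
  | succ n ih => exact Submodule.comap_mono (range_map_subtype_mono ih)

theorem fullFiltration_mono : Monotone (fullFiltration δ) :=
  monotone_nat_of_le_succ (fullFiltration_le_succ δ)

theorem fullFiltration_le_leftFiltration (n : ℕ) : fullFiltration δ n ≤ leftFiltration δ n := by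
  induction n with
  | zero => exact bot_le
  | succ n ih =>
    intro c hc
    exact mem_leftFiltration_succ.2 fun f => ih (contractSnd_mem_of_mem_range_map hc f)

variable {δ}

theorem IsStronglyConilpotent.isConilpotent (h : IsStronglyConilpotent δ) : IsConilpotent δ :=
  fun c => (h c).imp fun n hn => fullFiltration_le_leftFiltration δ n hn

end FullFiltration

section ConnesKreimerPreLie

open FinRootedTree PlanarTree SymmetricAlgebra

variable (K : Type u) [Field K]

theorem symProj_prod_treeGen_eq_zero {l : List PlanarTree} (hl : l.length ≠ 1) :
    symProj K (l.map (treeGen K)).prod = 0 := by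
  match l, hl with
  | [], _ => simpa using RightSidedBialgebra.symProj_one (K := K)
  | s :: t :: l, _ =>
    have h : ∀ s, (algebraMapInv (treeGen K s) : K) = 0 := fun s => algebraMapInv_ι _
    rw [List.map_cons, List.prod_cons, symProj_mul, h, zero_smul, zero_add, List.map_cons,
      List.prod_cons, map_mul, h, zero_mul, zero_smul]

theorem single_mem_fullFiltration (n : ℕ) (t : PlanarTree) (ht : t.vertexCount ≤ n) :
    Finsupp.single (mk t) (1 : K) ∈ fullFiltration (ckBialgebra K).delta n := by
  induction n generalizing t with
  | zero => exact absurd t.vertexCount_pos (by omega)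
  | succ n ih =>
    rw [fullFiltration, Submodule.mem_comap]
    have h1 : (ckBialgebra K).delta (Finsupp.single (mk t) 1) =
        TensorProduct.comm K _ _ (TensorProduct.map (symProj K) (symProj K) (ckCoproduct K t)) := by
      rw [← ckComul_treeGen]
      rfl
    have h2 : symProj K (treeGen K t) = Finsupp.single (mk t) 1 := symProj_ι K _
    rw [h1, ckCoproduct, map_add, TensorProduct.map_tmul, RightSidedBialgebra.symProj_one,
      TensorProduct.tmul_zero, zero_add, map_list_sum, map_list_sum, List.map_map, List.map_map]
    refine list_sum_mem fun x hx => ?_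
    obtain ⟨c, hc, rfl⟩ := List.mem_map.1 hx
    have hcount := vertexCount_of_mem_cuts t c hc
    simp only [Function.comp_apply, TensorProduct.map_tmul, TensorProduct.comm_tmul]
    -- Only cuts with exactly one piece cut off contribute to the cooperation, and then both pieces
    -- have fewer vertices.
    by_cases hl : c.1.length = 1
    · obtain ⟨p, hp⟩ := List.length_eq_one_iff.1 hl
      have hp' := p.vertexCount_pos
      have hr' := c.2.vertexCount_pos
      rw [hp, forestVertexCount, forestVertexCount] at hcount
      rw [hp, List.map_singleton, List.prod_singleton]
      have e : ∀ s, symProj K (treeGen K s) = Finsupp.single (mk s) 1 := fun s => symProj_ι K _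
      rw [e, e]
      exact tmul_mem_range_map_subtype (ih _ (by omega)) (ih _ (by omega))
    · rw [symProj_prod_treeGen_eq_zero K hl, TensorProduct.tmul_zero]
      exact zero_mem _

theorem isStronglyConilpotent_ckBialgebra : IsStronglyConilpotent (ckBialgebra K).delta := by
  intro c
  induction c using Finsupp.induction_linear with
  | zero => exact ⟨0, zero_mem _⟩
  | add x y hx hy =>
    obtain ⟨m, hm⟩ := hx
    obtain ⟨n, hn⟩ := hy
    exact ⟨max m n, add_mem (fullFiltration_mono _ (le_max_left m n) hm)
      (fullFiltration_mono _ (le_max_right m n) hn)⟩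
  | single t r =>
    have h := single_mem_fullFiltration K t.out.vertexCount t.out le_rfl
    rw [mk_out] at h
    refine ⟨t.out.vertexCount, ?_⟩
    rw [← mul_one r, ← smul_eq_mul, ← Finsupp.smul_single]
    exact Submodule.smul_mem _ r h

/-- The Connes–Kreimer Hopf algebra of rooted trees. -/
def ckHopf [CharZero K] : RightSidedHopf K (FinRootedTree →₀ K) :=
  (ckBialgebra K).toRightSidedHopf (isStronglyConilpotent_ckBialgebra K).isConilpotent

theorem coaction_grafting (x : SymmetricAlgebra K (FinRootedTree →₀ K)) :
    (ckBialgebra K).coaction (grafting K x) =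
      (grafting K).toLinearMap.lTensor _ ((ckBialgebra K).comul x) := by
  have h1 := ckComul_ι_grafting K x
  have h2 : symProj K ∘ₗ ι K _ ∘ₗ (grafting K).toLinearMap = (grafting K).toLinearMap :=
    LinearMap.ext fun y => symProj_ι K _
  rw [RightSidedBialgebra.coaction_apply]
  change (symProj K).lTensor _ (ckComul K _) = _
  rw [h1, map_add, LinearMap.lTensor_tmul, RightSidedBialgebra.symProj_one,
    TensorProduct.tmul_zero, zero_add, ← LinearMap.comp_apply, ← LinearMap.lTensor_comp, h2]
  rfl

/-- The cocycle equation contracted in the first factor: grafting conjugates D_f on S(T) to R_f on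
T. -/
theorem rightContraction_grafting (f : (FinRootedTree →₀ K) →ₗ[K] K)
    (x : SymmetricAlgebra K (FinRootedTree →₀ K)) :
    rightContraction (ckBialgebra K).delta f (grafting K x) =
      grafting K (affineDer f (rightContraction (ckBialgebra K).delta f) x) := by
  have h := LinearMap.congr_fun ((ckBialgebra K).leftShift_symProj f) x
  rw [RightSidedBialgebra.rightContraction_delta, coaction_grafting, contractFst_lTensor]
  exact congrArg (grafting K) h

/-- Transported by grafting, this is the fact that elements of S(T) are determined by their D_f and
their counit. -/
theorem eq_of_rightContraction_ckBialgebra_eq [CharZero K] {x y : FinRootedTree →₀ K}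
    (h : ∀ f, rightContraction (ckBialgebra K).delta f x =
      rightContraction (ckBialgebra K).delta f y)
    (h0 : (Finsupp.lapply FinRootedTree.single : (FinRootedTree →₀ K) →ₗ[K] K) x =
      (Finsupp.lapply FinRootedTree.single : (FinRootedTree →₀ K) →ₗ[K] K) y) : x = y := by
  obtain ⟨a, rfl⟩ := (grafting K).surjective x
  obtain ⟨b, rfl⟩ := (grafting K).surjective y
  rw [lapply_grafting, lapply_grafting] at h0
  rw [← sub_eq_zero]
  rw [← map_sub, eq_zero_of_affineDer_eq_zero (rightContraction (ckBialgebra K).delta)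
    (x := a - b), map_zero]
  · intro f
    apply (grafting K).injective
    rw [← rightContraction_grafting, map_sub, map_sub, h, sub_self, map_zero]
  · rw [map_sub, h0, sub_self]

end ConnesKreimerPreLie

-- Existence and uniqueness of the morphism to rooted trees

section SymMapAdjoin

open SymmetricAlgebra

variable {K : Type*} [Field K] {C : Type*} [AddCommGroup C] [Module K C]

theorem symMap_eq_of_mem_adjoin {D : Type*} [AddCommGroup D] [Module K D] {φ ψ : C →ₗ[K] D}
    {U : Submodule K C} (h : ∀ u ∈ U, φ u = ψ u) {x : SymmetricAlgebra K C}
    (hx : x ∈ Algebra.adjoin K (ι K C '' U)) : symMap φ x = symMap ψ x := by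
  induction hx using Algebra.adjoin_induction with
  | mem x hx =>
    obtain ⟨u, hu, rfl⟩ := hx
    rw [symMap_ι, symMap_ι, h u hu]
  | algebraMap r => rw [AlgHom.commutes, AlgHom.commutes]
  | add x y _ _ hx hy => rw [map_add, map_add, hx, hy]
  | mul x y _ _ hx hy => rw [map_mul, map_mul, hx, hy]

theorem affineDer_symMap_of_mem_adjoin {D : Type*} [AddCommGroup D] [Module K D] {φ : C →ₗ[K] D}
    {f : D →ₗ[K] K} {A : C →ₗ[K] C} {A' : D →ₗ[K] D} {U : Submodule K C}
    (h : ∀ u ∈ U, A' (φ u) = φ (A u)) {x : SymmetricAlgebra K C}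
    (hx : x ∈ Algebra.adjoin K (ι K C '' U)) :
    affineDer f A' (symMap φ x) = symMap φ (affineDer (f ∘ₗ φ) A x) := by
  induction hx using Algebra.adjoin_induction with
  | mem x hx =>
    obtain ⟨u, hu, rfl⟩ := hx
    simp [symMap_ι, h u hu]
  | algebraMap r => simp
  | add x y _ _ hx hy => simp only [map_add, hx, hy]
  | mul x y _ _ hx hy =>
    simp only [map_mul, Derivation.leibniz, hx, hy, map_add, smul_eq_mul]

end SymMapAdjoin

section Cofree

open FinRootedTree PlanarTree SymmetricAlgebra

variable (K : Type u) [Field K] [CharZero K] {C : Type w} [AddCommGroup C] [Module K C]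
  {γ : C →ₗ[K] C ⊗[K] C}

/-- Induction along F. Both factors of γ(c) lie in the previous step, so f ∘ φ and f ∘ ψ contract
the right factor equally and the left factor is covered by the induction; strong conilpotence is
what controls the right factor. -/
theorem eq_of_map_ckBialgebra_eq (hγ : IsStronglyConilpotent γ) {φ ψ : C →ₗ[K] FinRootedTree →₀ K}
    (hφ : TensorProduct.map φ φ ∘ₗ γ = (ckBialgebra K).delta ∘ₗ φ)
    (hψ : TensorProduct.map ψ ψ ∘ₗ γ = (ckBialgebra K).delta ∘ₗ ψ)
    (h : Finsupp.lapply FinRootedTree.single ∘ₗ φ = Finsupp.lapply FinRootedTree.single ∘ₗ ψ) :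
    φ = ψ := by
  refine LinearMap.ext fun c => ?_
  obtain ⟨n, hn⟩ := hγ c
  induction n generalizing c with
  | zero =>
    rw [fullFiltration, Submodule.mem_bot] at hn
    rw [hn, map_zero, map_zero]
  | succ n ih =>
    refine eq_of_rightContraction_ckBialgebra_eq K (fun f => ?_) (LinearMap.congr_fun h c)
    have h1 : rightContraction γ (f ∘ₗ φ) c = rightContraction γ (f ∘ₗ ψ) c :=
      contractSnd_congr_of_mem_range_map hn fun u hu => congrArg f (ih u hu)
    rw [rightContraction_comp_of_map_comp_eq hφ, rightContraction_comp_of_map_comp_eq hψ, h1]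
    exact ih _ (contractSnd_mem_of_mem_range_map hn _)

/-- The successive approximations of the morphism to the pre-Lie coalgebra of rooted trees. -/
def treeApprox (ω : C →ₗ[K] SymmetricAlgebra K C) : ℕ → C →ₗ[K] FinRootedTree →₀ K
  | 0 => 0
  | n + 1 => (grafting K).toLinearMap ∘ₗ (symMap (treeApprox ω n)).toLinearMap ∘ₗ ω

/-- For the coaction ρ integrating γ, the map ω = (id ⊗ f)ρ satisfies D_g ω = ω R_g. If φ = B S(φ) ω
with B the grafting, then R_g φ = B D_g S(φ) ω = B S(φ) D_{g∘φ} ω = φ R_{g∘φ}, which is the morphism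
property. The constant term of ω is f, which gives the cogenerator. -/
theorem exists_map_ckBialgebra (hγ : IsPreLieCooperation γ) (hγ' : IsStronglyConilpotent γ)
    (f : C →ₗ[K] K) : ∃ φ : C →ₗ[K] FinRootedTree →₀ K,
      TensorProduct.map φ φ ∘ₗ γ = (ckBialgebra K).delta ∘ₗ φ ∧
        Finsupp.lapply FinRootedTree.single ∘ₗ φ = f := by
  obtain ⟨B, rfl, hB⟩ := exists_rightSidedBialgebra hγ hγ'.isConilpotent
  let ω : C →ₗ[K] SymmetricAlgebra K C := contractSnd _ f ∘ₗ B.coaction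
  have hω : ∀ n, ∀ c ∈ fullFiltration B.delta (n + 1),
      ω c ∈ Algebra.adjoin K (ι K C '' fullFiltration B.delta n) := fun n c hc =>
    hB _ _ (fullFiltration_le_succ _ n) (fun c hc => hc) c hc f
  -- On F_{n+1} the value of ω is a polynomial in elements of F_n, so each approximation depends
  -- only on the previous one there and the sequence is constant from index n on F_n.
  have hstab : ∀ n, ∀ c ∈ fullFiltration B.delta n, ∀ m, n ≤ m →
      treeApprox K ω m c = treeApprox K ω n c := by
    intro n
    induction n with
    | zero =>
      intro c hc m _
      rw [fullFiltration, Submodule.mem_bot] at hc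
      rw [hc, map_zero, map_zero]
    | succ n ih =>
      intro c hc m hm
      obtain ⟨m, rfl⟩ := Nat.exists_eq_add_of_le' (show 1 ≤ m by omega)
      exact congrArg (grafting K)
        (symMap_eq_of_mem_adjoin (fun u hu => ih u hu m (by omega)) (hω n c hc))
  obtain ⟨φ, hφ⟩ := exists_linearMap_eventually_eq (treeApprox K ω) fun c =>
    (hγ' c).imp fun n hn m hm => hstab n c hn m hm
  have hφn : ∀ n, ∀ c ∈ fullFiltration B.delta n, φ c = treeApprox K ω n c := by
    intro n c hc
    obtain ⟨m, hm⟩ := hφ c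
    rw [← hm (max m n) (le_max_left m n), hstab n c hc _ (le_max_right m n)]
  have hfix : ∀ c, φ c = grafting K (symMap φ (ω c)) := by
    intro c
    obtain ⟨n, hn⟩ := hγ' c
    have hn' := fullFiltration_le_succ _ n hn
    rw [hφn _ c hn', symMap_eq_of_mem_adjoin (hφn n) (hω n c hn')]
    rfl
  refine ⟨φ, map_comp_eq_of_rightContraction fun g c => ?_, LinearMap.ext fun c => ?_⟩
  · obtain ⟨n, hn⟩ := hγ' c
    induction n generalizing c with
    | zero =>
      rw [fullFiltration, Submodule.mem_bot] at hn
      simp [hn]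
    | succ n ih =>
      -- Commuting D_g with S(φ) on ω(c) needs the morphism property only on F_n, which is the
      -- induction hypothesis.
      have h1 : affineDer (g ∘ₗ φ) (rightContraction B.delta (g ∘ₗ φ)) (ω c) =
          ω (rightContraction B.delta (g ∘ₗ φ) c) := by
        change _ = contractSnd _ f (B.coaction _)
        rw [← B.rTensor_affineDer_coaction, contractSnd_rTensor]
        rfl
      rw [hfix c, rightContraction_grafting,
        affineDer_symMap_of_mem_adjoin (fun u hu => ih u hu) (hω n c hn), h1, ← hfix]
  · rw [LinearMap.comp_apply, hfix, lapply_grafting, algebraMapInv_symMap]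
    exact (contractSnd_contractFst _ f _).symm.trans
      (congrArg f (B.contractFst_counit_coaction c))

theorem isCofreeOnOneGenerator_ckHopf :
    IsCofreeOnOneGenerator.{u, u, w} K (ckHopf K).delta
      (Finsupp.lapply FinRootedTree.single) := by
  refine ⟨(ckBialgebra K).isPreLieCooperation_delta, isStronglyConilpotent_ckBialgebra K, ?_⟩
  intro C _ _ γ hγ hγ' f
  obtain ⟨φ, hφ, hφf⟩ := exists_map_ckBialgebra K hγ hγ' f
  exact ⟨φ, ⟨hφ, hφf⟩, fun ψ hψ =>
    eq_of_map_ckBialgebra_eq K hγ' hψ.1 hφ (hψ.2.trans hφf.symm)⟩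

end Cofree

/-! ## The equivalence of categories -/

section Equivalence

variable {K : Type u} [Field K]

theorem RightSidedHopf.isPreLieCooperation_delta {C : Type v} [AddCommGroup C] [Module K C]
    (H : RightSidedHopf K C) : IsPreLieCooperation H.delta :=
  H.toRightSidedBialgebra.isPreLieCooperation_delta

namespace RightSidedCHA

variable (h : ∀ H : RightSidedCHA.{u, v} K, IsPreLieCooperation H.str.delta ∧
  IsConilpotent H.str.delta)

theorem faithful_toPreLieCoalgebra : (toPreLieCoalgebra h).Faithful where
  map_injective hfg := Hom.ext (congrArg PreLieCoalgebra.Hom.toLin hfg)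

theorem full_toPreLieCoalgebra [CharZero K] : (toPreLieCoalgebra h).Full where
  map_surjective {H H'} f :=
    ⟨⟨f.toLin, RightSidedBialgebra.comul_symMap H.str.toRightSidedBialgebra
      H'.str.toRightSidedBialgebra (h H).2 f.map_δ⟩, rfl⟩

/-- The bialgebra integrating the cooperation lives on the same space, so the identity map is the
required isomorphism. -/
theorem essSurj_toPreLieCoalgebra [CharZero K] : (toPreLieCoalgebra h).EssSurj where
  mem_essImage A := by
    obtain ⟨B, hB, -⟩ := exists_rightSidedBialgebra A.preLie A.conilpotent
    let H : RightSidedCHA.{u, v} K :=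
      { carrier := A.carrier
        str := B.toRightSidedHopf (by rw [hB]; exact A.conilpotent) }
    have hH : H.str.delta = A.δ := hB
    have h₁ : TensorProduct.map LinearMap.id LinearMap.id ∘ₗ H.str.delta =
        A.δ ∘ₗ LinearMap.id := by
      rw [TensorProduct.map_id, LinearMap.id_comp, LinearMap.comp_id, hH]
    have h₂ : TensorProduct.map LinearMap.id LinearMap.id ∘ₗ A.δ =
        H.str.delta ∘ₗ LinearMap.id := by
      rw [TensorProduct.map_id, LinearMap.id_comp, LinearMap.comp_id, hH]
    exact ⟨H, ⟨{
      hom := (⟨LinearMap.id, h₁⟩ : PreLieCoalgebra.Hom ((toPreLieCoalgebra h).obj H) A)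
      inv := (⟨LinearMap.id, h₂⟩ : PreLieCoalgebra.Hom A ((toPreLieCoalgebra h).obj H))
      hom_inv_id := rfl
      inv_hom_id := rfl }⟩⟩

theorem isEquivalence_toPreLieCoalgebra [CharZero K] : (toPreLieCoalgebra h).IsEquivalence where
  faithful := faithful_toPreLieCoalgebra h
  full := full_toPreLieCoalgebra h
  essSurj := essSurj_toPreLieCoalgebra h

end RightSidedCHA

end Equivalence

end

theorem theorem5p7 (K : Type u) [Field K] [CharZero K] :
    (∃ h : ∀ H : RightSidedCHA.{u, v} K,
        IsPreLieCooperation H.str.delta ∧ IsConilpotent H.str.delta,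
      (RightSidedCHA.toPreLieCoalgebra h).IsEquivalence) ∧
    (∃ H : RightSidedHopf K (FinRootedTree →₀ K),
      (∀ t : PlanarTree, H.comul (treeGen K t) = ckCoproduct K t) ∧
      IsCofreeOnOneGenerator.{u, u, w} K H.delta (Finsupp.lapply FinRootedTree.single)) :=
  ⟨⟨fun H => ⟨H.str.isPreLieCooperation_delta, H.str.isConilpotent_delta⟩,
    RightSidedCHA.isEquivalence_toPreLieCoalgebra _⟩,
    ckHopf K, ckComul_treeGen K, isCofreeOnOneGenerator_ckHopf K⟩
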